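/- **Setting.** Let $d$ be the space dimension and $(E,\mathcal E)$ a standard measurable (standard Borel) space with measurable $m,a:E\to(0,\infty)$ (mass, diffusivity) and a kernel $K(y,y',dz)$ from $E\times E$ to $E$ with $K(y,y',E)<\infty$, symmetric in $(y,y')$ and mass-preserving: $m(z)=m(y)+m(y')$ for $K(y,y',\cdot)$-a.a. $z$. Let $\phi:(0,\infty)\to(0,\infty)$ be continuous with $\phi(\lambda r)\le\lambda\phi(r)$ for $\lambda\ge1$, $r>0$; put $w(y)=a(y)^{d/2}\phi(m(y))$. Assume: $a$ and $1/a$ are bounded on $m^{-1}(B)$ for each compact $B\subseteq(0,\infty)$; $a(z)\le a(y)$ for $K(y,y',\cdot)$-a.a. $z$, for all $y,y'$; $\inf_E w>0$; $K(y,y',E)\le w(y)w(y')$. $\mathcal M$ is the set of finite measures $\mu$ on $\mathbb R^d\times E$ whose first marginal is absolutely continuous; such $\mu$ has a kernel $\mu(x,dy)$ with $\mu(B\times A)=\int_B\mu(x,A)\,dx$. For measurable $f\ge0$ on $E$, $\langle f,\mu\rangle(x)=\int_E f(y)\,\mu(x,dy)$. A process $(\mu_t)_{t<T}$ in $\mathcal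 M$, $T\in(0,\infty]$, is a family in $\mathcal M$ indexed by $t\in[0,T)$ such that $t\mapsto\mu_t(B\times A)$ is measurable for all measurable $B,A$. Let $$K^+(\mu)(B\times A)=\tfrac12\int_B\int_{E\times E}K(y,y',A)\,\mu(x,dy)\mu(x,dy')\,dx,\qquad K^-(\mu)(B\times A)=\int_B\int_{A\times E}K(y,y',E)\,\mu(x,dy)\mu(x,dy')\,dx,$$ $K(\mu)=K^+(\mu)-K^-(\mu)$, $p(t,x,x')=(2\pi t)^{-d/2}e^{-|x-x'|^2/2t}$, and, for $t>0$, $P_t\nu(dx',dy)=\int_x\nu(dx,dy)\,p(a(y)t,x,x')\,dx'$, with density $P_t\nu(x',dy)=\int_x\nu(dx,dy)\,p(a(y)t,x,x')$ in $x'$. Consider the coagulation-diffusion equation $\dot\mu_t=\frac12a\Delta\mu_t+K(\mu_t)$ and the following conditions. * (MCD) $\sup_{s\le t}\big(\|\langle w,\mu_s\rangle\|_{L^1(\mathbb R^d)}+\|\langle w,\mu_s\rangle\|_{L^\infty(\mathbb R^d)}\big)<\infty$ for all $t<T$. * (E) $\mu_t+\int_0^tP_{t-s}K^-(\mu_s)\,ds=P_t\mu_0+\int_0^tP_{t-s}K^+(\mu_s)\,ds$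 as measures, for all $t\in(0,T)$. * (I) $\int w(y)\,\mu_0(dx,dy)<\infty$, and $\mu_0(dx,dy)\le dx\otimes\mu_0^*(dy)$ for some measure $\mu_0^*$ on $E$ with $\int w\,d\mu_0^*<\infty$. * (G) $\int_0^t\int_Ew^R(y)\,P_{t-s}K^+(\mu_s)(x,dy)\,ds<\infty$ for a.a. $x\in\mathbb R^d$, for all $R\in(0,\infty)$ and $t<T$, where $w^R(y)=a(y)^{d/2}m(y)1_{\{m(y)\le R\}}$. A process $(\mu_t)_{t<T}$ in $\mathcal M$ is * a *(mild) solution* if (E), (I) and (G) hold; * a *weak solution* if (MCD) holds and, for all $t<T$ and $f\in\mathcal F$, $$\int f\,d\mu_t=\int f\,d\mu_0+\int_0^t\!\int\tfrac12a\Delta f\,d\mu_s\,ds+\int_0^t\!\int f\,dK(\mu_s)\,ds,$$ where $\mathcal F$ is the set of bounded measurable $f:\mathbb R^d\times E\to\mathbb R$, vanishing off $\mathbb R^d\times m^{-1}(B)$ for some compact $B\subseteq(0,\infty)$, such that $f(\cdot,y)$ is $C^2$ for every $y$, with first and second derivatives in $x$ bounded on $\mathbb R^d\times E$; * a *Markov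 solution* if (MCD) holds and $\mu_t=P^\mu_{t0}\mu_0+\int_0^tP^\mu_{ts}K^+(\mu_s)\,ds$ for all $t\in(0,T)$. Here, for $s<t$, $P^\mu_{ts}\nu(dx',dy)=\int_x\nu(dx,dy)\,p(a(y)(t-s),x,x')\,\pi_y(s,x;t,x')\,dx'$ with $\pi_y(s,x;t,x')=\mathbb E\exp\{-\int_s^tc_r(\beta_r,y)\,dr\}$, where $\beta$ is a Brownian bridge of diffusivity $a(y)$ from $x$ at time $s$ to $x'$ at time $t$, and $c_t(x,y)=\int_EK(y,y',E)\,\mu_t(x,dy')$ for a jointly measurable choice of the kernels $\mu_t(x,dy')$. **Proposition.** Let $(\mu_t)_{t<T}$ be a process in $\mathcal M$ for which (MCD) holds. 1. $(\mu_t)_{t<T}$ is a solution if and only if it is a weak solution and $\mu_0$ satisfies (I). In particular, when $\mu_0$ satisfies (I), it is a solution if and only if it is a weak solution. 2. If $(\mu_t)_{t<T}$ is a Markov solution and $\mu_0$ satisfies (I), then it is a solution. 3. Without assuming (I): $(\mu_t)_{t<T}$ is a weak solution if and only if (E) and (G) hold, and every Markov solution satisfies (E) and (G). -/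

import Mathlib

open MeasureTheory ProbabilityTheory Set
open scoped ENNReal NNReal Laplacian

namespace CoagDiff

noncomputable section

/-- A kernel all of whose measures are finite (no uniform bound is required) is s-finite. -/
theorem isSFiniteKernel_of_finite {α β : Type*} [MeasurableSpace α] [MeasurableSpace β]
    (κ : Kernel α β) (h : ∀ x, κ x univ < ∞) : IsSFiniteKernel κ := by
  classical
  have hm : Measurable fun x => κ x univ := κ.measurable_coe MeasurableSet.univ
  have hs : ∀ n : ℕ, MeasurableSet {x | ⌊(κ x univ).toReal⌋₊ = n} := fun n =>
    (Nat.measurable_floor.comp hm.ennreal_toReal) (measurableSet_singleton n)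
  refine ⟨⟨fun n => Kernel.piecewise (hs n) κ 0, fun n => ⟨⟨n + 1, by simp, fun x => ?_⟩⟩, ?_⟩⟩
  · rw [Kernel.piecewise_apply]
    split_ifs with hx
    · have h1 : (κ x univ).toReal < n + 1 := by
        have := Nat.lt_floor_add_one (κ x univ).toReal
        rw [show ⌊(κ x univ).toReal⌋₊ = n from hx] at this
        exact this
      rw [← ENNReal.ofReal_toReal (h x).ne]
      calc ENNReal.ofReal (κ x univ).toReal ≤ ENNReal.ofReal ((n : ℝ) + 1) :=
            ENNReal.ofReal_le_ofReal h1.le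
        _ = n + 1 := by
            rw [ENNReal.ofReal_add (by positivity) (by positivity)]; simp
    · simp
  · ext x s hs'
    rw [Kernel.sum_apply' _ _ hs', tsum_eq_single ⌊(κ x univ).toReal⌋₊]
    · rw [Kernel.piecewise_apply, if_pos (by simp)]
    · intro n hn
      rw [Kernel.piecewise_apply, if_neg (by simpa using hn.symm)]
      simp

/-! ### Rates and standing assumptions -/

/-- The weight `w(y) = a(y)^{d/2} φ(m(y))`. -/
def weight {E : Type*} (d : ℕ) (m a : E → ℝ) (φ : ℝ → ℝ) (y : E) : ℝ :=
  a y ^ ((d : ℝ) / 2) * φ (m y)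

/-- `f` is bounded on `m⁻¹(B)` for every compact `B ⊆ (0,∞)`. -/
def LocallyBounded {E : Type*} (m f : E → ℝ) : Prop :=
  ∀ B : Set ℝ, IsCompact B → B ⊆ Ioi 0 → ∃ C : ℝ, ∀ y, m y ∈ B → |f y| ≤ C

/-- Mass `m`, diffusivity `a`, auxiliary function `φ` and coagulation kernel `K` on a type
space `E`, for particles moving in `ℝ^d`, subject to the standing assumptions. -/
structure Model (d : ℕ) (E : Type*) [MeasurableSpace E] where
  m : E → ℝ
  a : E → ℝ
  φ : ℝ → ℝ
  K : Kernel (E × E) E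
  measurable_m : Measurable m
  measurable_a : Measurable a
  m_pos : ∀ y, 0 < m y
  a_pos : ∀ y, 0 < a y
  K_finite : ∀ y y', K (y, y') univ < ∞
  K_symm : ∀ y y', K (y, y') = K (y', y)
  K_mass : ∀ y y', ∀ᵐ z ∂(K (y, y')), m z = m y + m y'
  φ_pos : ∀ r, 0 < r → 0 < φ r
  φ_cont : ContinuousOn φ (Ioi 0)
  φ_sublinear : ∀ l r, 1 ≤ l → 0 < r → φ (l * r) ≤ l * φ r
  a_locallyBounded : LocallyBounded m a
  a_K_decreasing : ∀ y y', ∀ᵐ z ∂(K (y, y')), a z ≤ a y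
  a_inv_locallyBounded : LocallyBounded m fun y => (a y)⁻¹
  w_uniformlyPositive : ∃ ε : ℝ, 0 < ε ∧ ∀ y, ε ≤ weight d m a φ y
  K_le : ∀ y y', K (y, y') univ ≤ ENNReal.ofReal (weight d m a φ y * weight d m a φ y')

variable {d : ℕ} {E : Type*} [MeasurableSpace E]

/-- The weight `w` of a model. -/
def Model.w (M : Model d E) (y : E) : ℝ := weight d M.m M.a M.φ y

/-- `w^R(y) = a(y)^{d/2} φ^R(m(y))` with `φ^R(r) = r 1_{r ≤ R}`. -/
def Model.wTrunc (M : Model d E) (R : ℝ) (y : E) : ℝ :=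
  weight d M.m M.a (fun r => (Iic R).indicator (fun r => r) r) y

theorem Model.isSFiniteKernel_K (M : Model d E) : IsSFiniteKernel M.K :=
  isSFiniteKernel_of_finite _ fun p => M.K_finite p.1 p.2

/-! ### The state space and spatial densities -/

/-- The set `𝓜`: finite measures on `ℝ^d × E` with absolutely continuous first marginal. -/
def MemM (μ : Measure (EuclideanSpace ℝ (Fin d) × E)) : Prop :=
  IsFiniteMeasure μ ∧ μ.fst ≪ volume

/-- `κ` is a kernel for `μ`: `μ(B × A) = ∫_B κ(x, A) dx`. -/
def IsDensityKernel (κ : Kernel (EuclideanSpace ℝ (Fin d)) E)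
    (μ : Measure (EuclideanSpace ℝ (Fin d) × E)) : Prop :=
  (∀ x, κ x univ < ∞) ∧
    ∀ (B : Set (EuclideanSpace ℝ (Fin d))) (A : Set E), MeasurableSet B → MeasurableSet A →
      μ (B ×ˢ A) = ∫⁻ x in B, κ x A

theorem MemM.exists_density [StandardBorelSpace E]
    {μ : Measure (EuclideanSpace ℝ (Fin d) × E)} (h : MemM μ) :
    ∃ κ : Kernel (EuclideanSpace ℝ (Fin d)) E, IsDensityKernel κ μ := by
  obtain ⟨hfin, hac⟩ := h
  rcases isEmpty_or_nonempty E with hE | hE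
  · refine ⟨0, by simp, fun B A _ _ => ?_⟩
    rw [show A = ∅ from Subsingleton.elim _ _]
    simp
  · set ρ := μ.fst.rnDeriv volume with hρ
    have hρm : Measurable ρ := Measure.measurable_rnDeriv _ _
    set g : EuclideanSpace ℝ (Fin d) → E → ℝ≥0∞ := fun x _ => ((ρ x).toNNReal : ℝ≥0∞) with hg
    have hgm : Measurable (Function.uncurry g) :=
      (hρm.comp measurable_fst).ennreal_toNNReal.coe_nnreal_ennreal
    refine ⟨Kernel.withDensity μ.condKernel g, fun x => ?_, fun B A hB hA => ?_⟩
    · rw [Kernel.withDensity_apply _ hgm, withDensity_apply _ MeasurableSet.univ]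
      simp [hg]
    · have h1 : ∀ᵐ x ∂(volume : Measure (EuclideanSpace ℝ (Fin d))),
          Kernel.withDensity μ.condKernel g x A = ρ x * μ.condKernel x A := by
        filter_upwards [Measure.rnDeriv_lt_top μ.fst volume] with x hx
        rw [Kernel.withDensity_apply _ hgm, withDensity_apply _ hA]
        simp only [hg, lintegral_const, Measure.restrict_apply_univ]
        rw [ENNReal.coe_toNNReal (show ρ x ≠ ∞ from hx.ne)]
      rw [setLIntegral_congr_fun_ae hB (h1.mono fun x hx _ => hx)]
      conv_lhs => rw [← μ.disintegrate μ.condKernel, Measure.compProd_apply_prod hB hA]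
      conv_lhs => rw [← Measure.withDensity_rnDeriv_eq μ.fst volume hac]
      rw [setLIntegral_withDensity_eq_setLIntegral_mul _ hρm
        (Kernel.measurable_coe _ hA) hB]
      rfl

open Classical in
/-- A version `μ(x, dy)` of the spatial density of `μ` (junk value `0` if there is none). -/
def density (μ : Measure (EuclideanSpace ℝ (Fin d) × E)) :
    Kernel (EuclideanSpace ℝ (Fin d)) E :=
  if h : ∃ κ, IsDensityKernel κ μ then h.choose else 0

theorem MemM.isDensityKernel_density [StandardBorelSpace E]
    {μ : Measure (EuclideanSpace ℝ (Fin d) × E)} (h : MemM μ) :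
    IsDensityKernel (density μ) μ := by
  unfold density
  rw [dif_pos h.exists_density]
  exact h.exists_density.choose_spec

instance instIsSFiniteKernelDensity (μ : Measure (EuclideanSpace ℝ (Fin d) × E)) :
    IsSFiniteKernel (density μ) := by
  unfold density
  split_ifs with h
  · exact isSFiniteKernel_of_finite _ h.choose_spec.1
  · infer_instance

/-- `⟨f, μ⟩(x) = ∫_E f(y) μ(x, dy)` for `f ≥ 0`. -/
def pairing (f : E → ℝ) (μ : Measure (EuclideanSpace ℝ (Fin d) × E))
    (x : EuclideanSpace ℝ (Fin d)) : ℝ≥0∞ :=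
  ∫⁻ y, ENNReal.ofReal (f y) ∂(density μ x)

/-! ### The coagulation terms -/

/-- The gain term `K⁺(μ)`. -/
def Kplus (M : Model d E) (μ : Measure (EuclideanSpace ℝ (Fin d) × E)) :
    Measure (EuclideanSpace ℝ (Fin d) × E) :=
  (1 / 2 : ℝ≥0∞) • (volume.compProd (M.K.comp ((density μ).prod (density μ))))

/-- The loss term `K⁻(μ)`. -/
def Kminus (M : Model d E) (μ : Measure (EuclideanSpace ℝ (Fin d) × E)) :
    Measure (EuclideanSpace ℝ (Fin d) × E) :=
  (volume.compProd (density μ)).withDensity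
    fun q => ∫⁻ y', M.K (q.2, y') univ ∂(density μ q.1)

/-- `K⁺(μ)(B × A) = ½ ∫_B ∫∫ K(y,y',A) μ(x,dy) μ(x,dy') dx`. -/
theorem Kplus_prod (M : Model d E) (μ : Measure (EuclideanSpace ℝ (Fin d) × E))
    {B : Set (EuclideanSpace ℝ (Fin d))} {A : Set E}
    (hB : MeasurableSet B) (hA : MeasurableSet A) :
    Kplus M μ (B ×ˢ A) =
      (1 / 2) * ∫⁻ x in B, ∫⁻ y, ∫⁻ y', M.K (y, y') A ∂(density μ x) ∂(density μ x) := by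
  have := M.isSFiniteKernel_K
  rw [Kplus, Measure.smul_apply, Measure.compProd_apply_prod hB hA, smul_eq_mul]
  congr 1
  refine lintegral_congr fun x => ?_
  rw [Kernel.comp_apply' _ _ _ hA, Kernel.lintegral_prod _ _ _ (Kernel.measurable_coe _ hA)]

/-- `K⁻(μ)(B × A) = ∫_B ∫_A ∫_E K(y,y',E) μ(x,dy') μ(x,dy) dx`. -/
theorem Kminus_prod (M : Model d E) (μ : Measure (EuclideanSpace ℝ (Fin d) × E))
    {B : Set (EuclideanSpace ℝ (Fin d))} {A : Set E}
    (hB : MeasurableSet B) (hA : MeasurableSet A) :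
    Kminus M μ (B ×ˢ A) =
      ∫⁻ x in B, ∫⁻ y in A, ∫⁻ y', M.K (y, y') univ ∂(density μ x) ∂(density μ x) := by
  have hm : Measurable fun q : EuclideanSpace ℝ (Fin d) × E =>
      ∫⁻ y', M.K (q.2, y') univ ∂(density μ q.1) := by
    have h := Measurable.lintegral_kernel_prod_right'
      (κ := (density μ).comap (Prod.fst : EuclideanSpace ℝ (Fin d) × E → _) measurable_fst)
      (f := fun r : (EuclideanSpace ℝ (Fin d) × E) × E => M.K (r.1.2, r.2) univ)
      ((Kernel.measurable_coe M.K MeasurableSet.univ).comp (by fun_prop))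
    exact h
  rw [Kminus, withDensity_apply _ (hB.prod hA), Measure.setLIntegral_compProd hm hB hA]

/-! ### The heat flow -/

/-- `p(t, x, x') = (2πt)^{-d/2} exp(-|x-x'|²/(2t))`. -/
def heatKernel (t : ℝ) (x x' : EuclideanSpace ℝ (Fin d)) : ℝ :=
  (2 * Real.pi * t) ^ (-((d : ℝ) / 2)) * Real.exp (-(‖x - x'‖ ^ 2) / (2 * t))

/-- The measure `ν'(dx', dy) = ∫_x ν(dx, dy) k(x, y, x') dx'`. -/
def transport (k : EuclideanSpace ℝ (Fin d) → E → EuclideanSpace ℝ (Fin d) → ℝ≥0∞)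
    (ν : Measure (EuclideanSpace ℝ (Fin d) × E)) : Measure (EuclideanSpace ℝ (Fin d) × E) :=
  ((ν.prod (volume : Measure (EuclideanSpace ℝ (Fin d)))).withDensity
    fun q => k q.1.1 q.1.2 q.2).map fun q => (q.2, q.1.2)

/-- `P_t ν`, for `t > 0`. -/
def heatFlow (M : Model d E) (t : ℝ) (ν : Measure (EuclideanSpace ℝ (Fin d) × E)) :
    Measure (EuclideanSpace ℝ (Fin d) × E) :=
  transport (fun x y x' => ENNReal.ofReal (heatKernel (M.a y * t) x x')) ν

/-- `∫_E f(y) P_tν(x, dy) = ∫ f(y) p(a(y)t, x, x') ν(dx', dy)` for `f ≥ 0`, `t > 0`. -/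
def heatPairing (M : Model d E) (f : E → ℝ) (t : ℝ)
    (ν : Measure (EuclideanSpace ℝ (Fin d) × E)) (x : EuclideanSpace ℝ (Fin d)) : ℝ≥0∞ :=
  ∫⁻ q, ENNReal.ofReal (f q.2 * heatKernel (M.a q.2 * t) x q.1) ∂ν

theorem measurable_heatKernel (M : Model d E) (t : ℝ) :
    Measurable fun q : (EuclideanSpace ℝ (Fin d) × E) × EuclideanSpace ℝ (Fin d) =>
      heatKernel (M.a q.1.2 * t) q.1.1 q.2 := by
  have := M.measurable_a
  unfold heatKernel
  fun_prop

/-- `P_t ν(B × A) = ∫ ν(dx, dy) 1_A(y) ∫_B p(a(y)t, x, x') dx'`. -/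
theorem heatFlow_prod (M : Model d E) (t : ℝ) (ν : Measure (EuclideanSpace ℝ (Fin d) × E))
    [SFinite ν] {B : Set (EuclideanSpace ℝ (Fin d))} {A : Set E}
    (hB : MeasurableSet B) (hA : MeasurableSet A) :
    heatFlow M t ν (B ×ˢ A) =
      ∫⁻ q in univ ×ˢ A, (∫⁻ x' in B, ENNReal.ofReal (heatKernel (M.a q.2 * t) q.1 x')) ∂ν := by
  rw [heatFlow, transport, Measure.map_apply (by fun_prop) (hB.prod hA),
    withDensity_apply _ ((hB.prod hA).preimage (by fun_prop))]
  have hset : (fun q : (EuclideanSpace ℝ (Fin d) × E) × EuclideanSpace ℝ (Fin d) =>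
      (q.2, q.1.2)) ⁻¹' (B ×ˢ A) = (univ ×ˢ A) ×ˢ B := by
    ext q; simp [and_comm]
  rw [hset, ← Measure.prod_restrict,
    lintegral_prod _ (measurable_heatKernel M t).ennreal_ofReal.aemeasurable]

/-- `x ↦ heatPairing M f t ν x` is the spatial density of `f(y) P_tν(dx, dy)`. -/
theorem setLIntegral_heatPairing (M : Model d E) {f : E → ℝ} (hf : Measurable f)
    (hf0 : ∀ y, 0 ≤ f y) (t : ℝ) (ν : Measure (EuclideanSpace ℝ (Fin d) × E)) [SFinite ν]
    {B : Set (EuclideanSpace ℝ (Fin d))} (hB : MeasurableSet B) :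
    ∫⁻ x in B, heatPairing M f t ν x =
      ∫⁻ q in B ×ˢ univ, ENNReal.ofReal (f q.2) ∂(heatFlow M t ν) := by
  have hk := (measurable_heatKernel M t).ennreal_ofReal
  have hsymm : ∀ r (x x' : EuclideanSpace ℝ (Fin d)), heatKernel r x x' = heatKernel r x' x :=
    fun r x x' => by simp [heatKernel, norm_sub_rev]
  have hfq : Measurable fun q : (EuclideanSpace ℝ (Fin d) × E) × EuclideanSpace ℝ (Fin d) =>
      ENNReal.ofReal (f q.1.2) := by fun_prop
  have hset : (fun q : (EuclideanSpace ℝ (Fin d) × E) × EuclideanSpace ℝ (Fin d) =>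
      (q.2, q.1.2)) ⁻¹' (B ×ˢ univ) = univ ×ˢ B := by
    ext q; simp
  rw [heatFlow, transport, setLIntegral_map (hB.prod MeasurableSet.univ) (by fun_prop)
    (by fun_prop), hset, setLIntegral_withDensity_eq_setLIntegral_mul _ hk hfq
    (MeasurableSet.univ.prod hB), ← Measure.prod_restrict, Measure.restrict_univ,
    lintegral_prod_symm _ (hk.mul hfq).aemeasurable]
  refine lintegral_congr fun x => lintegral_congr fun q => ?_
  simp only [Pi.mul_apply]
  rw [ENNReal.ofReal_mul (hf0 _), mul_comm, hsymm]

/-! ### Processes and solutions -/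

/-- `t ∈ [0, T)`, for `T ∈ [0, ∞]`. -/
def Before (T : ℝ≥0∞) (t : ℝ) : Prop := 0 ≤ t ∧ ENNReal.ofReal t < T

/-- `(μ_t)_{t<T}` is a process in `𝓜`. Values of `μ` outside `[0, T)` are irrelevant. -/
def IsProcess (T : ℝ≥0∞) (μ : ℝ → Measure (EuclideanSpace ℝ (Fin d) × E)) : Prop :=
  (∀ t, Before T t → MemM (μ t)) ∧
    ∀ (B : Set (EuclideanSpace ℝ (Fin d))) (A : Set E), MeasurableSet B → MeasurableSet A →
      Measurable fun t : {t : ℝ // Before T t} => μ t (B ×ˢ A)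

/-- `sup_{s ≤ t} (‖⟨w, μ_s⟩‖₁ + ‖⟨w, μ_s⟩‖_∞) < ∞` for all `t < T`. -/
def MomentBound (M : Model d E) (T : ℝ≥0∞)
    (μ : ℝ → Measure (EuclideanSpace ℝ (Fin d) × E)) : Prop :=
  ∀ t, Before T t →
    (⨆ s ∈ Icc 0 t, ((∫⁻ x, pairing M.w (μ s) x) + essSup (pairing M.w (μ s)) volume)) < ∞

/-- The integral equation
`μ_t + ∫₀ᵗ P_{t-s} K⁻(μ_s) ds = P_t μ_0 + ∫₀ᵗ P_{t-s} K⁺(μ_s) ds`, `t ∈ (0, T)`. -/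
def MildEquation (M : Model d E) (T : ℝ≥0∞)
    (μ : ℝ → Measure (EuclideanSpace ℝ (Fin d) × E)) : Prop :=
  ∀ t, 0 < t → Before T t → ∀ C : Set (EuclideanSpace ℝ (Fin d) × E), MeasurableSet C →
    μ t C + ∫⁻ s in Ioo 0 t, heatFlow M (t - s) (Kminus M (μ s)) C =
      heatFlow M t (μ 0) C + ∫⁻ s in Ioo 0 t, heatFlow M (t - s) (Kplus M (μ s)) C

/-- `∫ w dμ_0 < ∞` and `μ_0(dx, dy) ≤ dx ⊗ μ_0^*(dy)` for some measure `μ_0^*` on `E` for which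
`w` is integrable. -/
def InitialBound (M : Model d E) (μ₀ : Measure (EuclideanSpace ℝ (Fin d) × E)) : Prop :=
  (∫⁻ q, ENNReal.ofReal (M.w q.2) ∂μ₀) < ∞ ∧
    ∃ ν : Measure E, (∫⁻ y, ENNReal.ofReal (M.w y) ∂ν) < ∞ ∧
      μ₀ ≤ (volume : Measure (EuclideanSpace ℝ (Fin d))).prod ν

/-- `∫₀ᵗ ∫_E w^R(y) P_{t-s} K⁺(μ_s)(x, dy) ds < ∞` for a.a. `x`, all `R ∈ (0,∞)`, all `t < T`. -/
def GainBound (M : Model d E) (T : ℝ≥0∞)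
    (μ : ℝ → Measure (EuclideanSpace ℝ (Fin d) × E)) : Prop :=
  ∀ R t, 0 < R → Before T t → ∀ᵐ x ∂(volume : Measure (EuclideanSpace ℝ (Fin d))),
    (∫⁻ s in Ioo 0 t, heatPairing M (M.wTrunc R) (t - s) (Kplus M (μ s)) x) < ∞

/-- (Mild) solutions. -/
def IsSolution (M : Model d E) (T : ℝ≥0∞)
    (μ : ℝ → Measure (EuclideanSpace ℝ (Fin d) × E)) : Prop :=
  MildEquation M T μ ∧ InitialBound M (μ 0) ∧ GainBound M T μ

/-! ### Weak solutions -/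

/-- The class `𝓕` of test functions. -/
structure IsTestFunction (M : Model d E) (f : EuclideanSpace ℝ (Fin d) → E → ℝ) : Prop where
  measurable : Measurable (Function.uncurry f)
  bounded : ∃ C : ℝ, ∀ x y, |f x y| ≤ C
  support : ∃ B : Set ℝ, IsCompact B ∧ B ⊆ Ioi 0 ∧ ∀ x y, M.m y ∉ B → f x y = 0
  contDiff : ∀ y, ContDiff ℝ 2 fun x => f x y
  fderiv_bounded : ∃ C : ℝ, ∀ x y, ‖fderiv ℝ (fun x => f x y) x‖ ≤ C
  fderiv2_bounded : ∃ C : ℝ, ∀ x y, ‖iteratedFDeriv ℝ 2 (fun x => f x y) x‖ ≤ C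

/-- `(f, K(μ))`, where `K(μ) = K⁺(μ) - K⁻(μ)`. -/
def coagPairing (M : Model d E) (f : EuclideanSpace ℝ (Fin d) → E → ℝ)
    (μ : Measure (EuclideanSpace ℝ (Fin d) × E)) : ℝ :=
  (∫ q, f q.1 q.2 ∂(Kplus M μ)) - ∫ q, f q.1 q.2 ∂(Kminus M μ)

/-- Weak solutions. -/
def IsWeakSolution (M : Model d E) (T : ℝ≥0∞)
    (μ : ℝ → Measure (EuclideanSpace ℝ (Fin d) × E)) : Prop :=
  MomentBound M T μ ∧ ∀ f, IsTestFunction M f → ∀ t, Before T t →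
    ∫ q, f q.1 q.2 ∂(μ t) =
      (∫ q, f q.1 q.2 ∂(μ 0)) +
      (∫ s in (0 : ℝ)..t, ∫ q, (1 / 2) * M.a q.2 * (Δ fun x => f x q.2) q.1 ∂(μ s)) +
      ∫ s in (0 : ℝ)..t, coagPairing M f (μ s)

/-! ### Markov solutions -/

/-- `b` is a Brownian bridge in `ℝ^d` from `0` to `0` over the time interval `[0, 1]`: a
continuous centred Gaussian process with covariance `σ (1 - τ) I` for `σ ≤ τ`. -/
structure IsBrownianBridge {Ω : Type*} [MeasurableSpace Ω]
    (b : ℝ → Ω → EuclideanSpace ℝ (Fin d)) (P : Measure Ω) : Prop where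
  measurable : ∀ τ ∈ Icc (0 : ℝ) 1, Measurable (b τ)
  continuous : ∀ ω, ContinuousOn (fun τ => b τ ω) (Icc 0 1)
  gaussian : IsGaussianProcess (fun (τ : Icc (0 : ℝ) 1) ω => b τ ω) P
  mean : ∀ τ ∈ Icc (0 : ℝ) 1, ∀ i, ∫ ω, b τ ω i ∂P = 0
  covariance : ∀ σ ∈ Icc (0 : ℝ) 1, ∀ τ ∈ Icc (0 : ℝ) 1, σ ≤ τ → ∀ i j,
    ∫ ω, b σ ω i * b τ ω j ∂P = if i = j then σ * (1 - τ) else 0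

/-- `κ` is a jointly measurable choice of spatial densities: for all `t < T`, the kernel
`κ((t, x), dy)` is a kernel for `μ_t`. -/
def IsDensityProcess (T : ℝ≥0∞) (κ : Kernel (ℝ × EuclideanSpace ℝ (Fin d)) E)
    (μ : ℝ → Measure (EuclideanSpace ℝ (Fin d) × E)) : Prop :=
  ∀ t, Before T t → IsDensityKernel (κ.comap (Prod.mk t) measurable_prodMk_left) (μ t)

/-- `c_t(x, y) = ∫_E K(y, y', E) μ_t(x, dy')`, where `κ` gives the densities of `(μ_t)`. -/
def lossRate (M : Model d E) (κ : Kernel (ℝ × EuclideanSpace ℝ (Fin d)) E)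
    (t : ℝ) (x : EuclideanSpace ℝ (Fin d)) (y : E) : ℝ≥0∞ :=
  ∫⁻ y', M.K (y, y') univ ∂(κ (t, x))

/-- `π_y(s,x;t,x') = 𝔼 exp(-∫_s^t c_r(β_r, y) dr)`, where `β` is the Brownian bridge of
diffusivity `a(y)` from `x` at time `s` to `x'` at time `t`, obtained from the standard Brownian
bridge `b` by scaling. -/
def bridgeFactor (M : Model d E) {Ω : Type*} [MeasurableSpace Ω]
    (b : ℝ → Ω → EuclideanSpace ℝ (Fin d)) (P : Measure Ω)
    (c : ℝ → EuclideanSpace ℝ (Fin d) → E → ℝ≥0∞) (s t : ℝ)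
    (x : EuclideanSpace ℝ (Fin d)) (y : E) (x' : EuclideanSpace ℝ (Fin d)) : ℝ≥0∞ :=
  ∫⁻ ω, EReal.exp (-((∫⁻ r in Ioo s t,
    c r (x + ((r - s) / (t - s)) • (x' - x)
      + √(M.a y * (t - s)) • b ((r - s) / (t - s)) ω) y : ℝ≥0∞) : EReal)) ∂P

/-- The propagator `P_{ts}`, `s < t`, on measures associated to `½ a(y) Δ - c_t(·, y)`:
`P_{ts} ν(dx', dy) = ∫_x ν(dx, dy) p(a(y)(t-s), x, x') π_y(s,x;t,x') dx'`. -/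
def propagator (M : Model d E) {Ω : Type*} [MeasurableSpace Ω]
    (b : ℝ → Ω → EuclideanSpace ℝ (Fin d)) (P : Measure Ω)
    (c : ℝ → EuclideanSpace ℝ (Fin d) → E → ℝ≥0∞) (s t : ℝ)
    (ν : Measure (EuclideanSpace ℝ (Fin d) × E)) : Measure (EuclideanSpace ℝ (Fin d) × E) :=
  transport (fun x y x' => ENNReal.ofReal (heatKernel (M.a y * (t - s)) x x') *
    bridgeFactor M b P c s t x y x') ν

/-- Markov solutions: `μ_t = P^μ_{t0} μ_0 + ∫₀ᵗ P^μ_{ts} K⁺(μ_s) ds`, `t ∈ (0, T)`, together with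
the moment bound. Neither the realization of the Brownian bridge nor the version of the densities
affects the propagators. -/
def IsMarkovSolution (M : Model d E) (T : ℝ≥0∞)
    (μ : ℝ → Measure (EuclideanSpace ℝ (Fin d) × E)) : Prop :=
  MomentBound M T μ ∧
    ∃ (Ω : Type) (_ : MeasurableSpace Ω) (P : Measure Ω)
      (b : ℝ → Ω → EuclideanSpace ℝ (Fin d))
      (κ : Kernel (ℝ × EuclideanSpace ℝ (Fin d)) E),
      IsBrownianBridge b P ∧ IsDensityProcess T κ μ ∧
      ∀ t, 0 < t → Before T t →
        ∀ C : Set (EuclideanSpace ℝ (Fin d) × E), MeasurableSet C →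
          μ t C = propagator M b P (lossRate M κ) 0 t (μ 0) C +
            ∫⁻ s in Ioo 0 t, propagator M b P (lossRate M κ) s t (Kplus M (μ s)) C

end

end CoagDiff

/-! The moment bound makes `K⁺(μ_s)` and `K⁻(μ_s)` finite measures of mass at most `C²`, uniformly
for `s ≤ t`. Under it all the claims follow from four implications: (E) gives (G), (E) gives the
weak equation, the weak equation gives (E), and the Markov equation gives (E). Condition (I) is only
carried along.

(E) ⇒ (G). The function `a ↦ a^{d/2} p(aτ, x, x')` is increasing, and coagulation lowers `a`. So if
`g` is subadditive under coagulation, so is `g a^{d/2} p(aτ, x₀, ·)`, and the gain term integrates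
it to at most what the loss term does. Testing (E) at time `s` with `τ = t - s` and cancelling the
finite loss gives `∫ g a^{d/2} dP_{t-s}μ_s ≤ ∫ g a^{d/2} dP_tμ_0` for the densities at `x₀`
(`MildEquation.lintegral_heatWeight_le`). With `g` increasing to `w`, the right side is at most `C
(2πt)^{-d/2}`. The gain with weight `w^R` is then bounded by the loss, hence by `C R` times this
quantity (`MildEquation.gainBound`).

(E) ⇒ weak. Test (E) at time `r` with `½aΔf`, integrate over `r ∈ (0,t)`, and use Fubini and `P_τ f
- f = ∫₀^τ P_σ(½aΔf) dσ` (`MildEquation.isWeakSolution`).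

Weak ⇒ (E). For `f = h(y) cos(⟨x,ξ⟩ + θ)` one has `½aΔf = -λf` with `λ = ½a|ξ|²` free of `x`. Test
functions may not depend on time, so Duhamel's formula is obtained by averaging: the weak equation
at each `r` is tested with `λ e^{-λ(t-r)} f` and integrated over `r`
(`IsWeakSolution.integral_wave`). Waves determine finite measures through characteristic functions.

Markov ⇒ (E). The identity `1 = exp(-∫_s^t c) + ∫_s^t c_r exp(-∫_s^r c) dr`, averaged over the
Brownian bridge, splits the heat kernel at the first collision (`IsBrownianBridge.heatKernel_eq`):
`P_{t-s}ν = P^μ_{ts}ν + ∫_s^t P_{t-r}(c_r P^μ_{rs}ν) dr`. Insert this on the right of (E), insert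
`K⁻(μ_r) = c_r μ_r` and the Markov equation for `μ_r` on the left, and exchange the order of
integration. The term at time `r` needs the law of the bridge at `r` jointly with its past: the
rescaled past is again a standard bridge, independent of the position at `r`. -/

namespace CoagDiff
variable {d : ℕ} {E : Type*} [MeasurableSpace E]

/-! ### The heat kernel -/

/-- The space `ℝ^d`. -/
abbrev Space (d : ℕ) : Type := EuclideanSpace ℝ (Fin d)

theorem measurable_heatKernel_uncurry :
    Measurable fun p : ℝ × Space d × Space d => heatKernel p.1 p.2.1 p.2.2 := by
  unfold heatKernel
  fun_prop

@[fun_prop]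
theorem measurable_heatKernel_comp {α : Type*} [MeasurableSpace α] {t : α → ℝ}
    {x x' : α → Space d} (ht : Measurable t) (hx : Measurable x) (hx' : Measurable x') :
    Measurable fun q => heatKernel (t q) (x q) (x' q) :=
  measurable_heatKernel_uncurry.comp (ht.prodMk (hx.prodMk hx'))

theorem heatKernel_nonneg {t : ℝ} (ht : 0 ≤ t) (x x' : Space d) : 0 ≤ heatKernel t x x' := by
  unfold heatKernel
  positivity

theorem heatKernel_symm (t : ℝ) (x x' : Space d) : heatKernel t x x' = heatKernel t x' x := by
  simp [heatKernel, norm_sub_rev]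

/-- Brownian scaling. It lets every heat integral be written as an expectation over one fixed
standard Gaussian, with time and diffusivity only in the argument. -/
theorem heatKernel_scale {t : ℝ} (ht : 0 < t) (x z : Space d) :
    heatKernel t x (x + √t • z) = t ^ (-((d : ℝ) / 2)) * heatKernel 1 0 z := by
  unfold heatKernel
  rw [Real.mul_rpow (by positivity) ht.le]
  have h1 : ‖x - (x + √t • z)‖ ^ 2 = t * ‖z‖ ^ 2 := by
    rw [show x - (x + √t • z) = -(√t • z) by abel, norm_neg, norm_smul, mul_pow]
    simp [Real.sq_sqrt ht.le]
  have h2 : ‖(0 : Space d) - z‖ ^ 2 = ‖z‖ ^ 2 := by simp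
  rw [h1, h2, mul_one, mul_one]
  have h3 : -(t * ‖z‖ ^ 2) / (2 * t) = -‖z‖ ^ 2 / 2 := by field_simp
  rw [h3]
  ring

theorem integrable_heatKernel_one : Integrable (fun z : Space d => heatKernel 1 0 z) := by
  have h := GaussianFourier.integrable_cexp_neg_mul_sq_norm_add (V := Space d) (b := 1 / 2)
    (by norm_num) 0 0
  have h2 := h.re.const_mul ((2 * Real.pi * 1) ^ (-((d : ℝ) / 2)))
  refine h2.congr (Filter.Eventually.of_forall fun z => ?_)
  simp only [heatKernel, zero_sub, norm_neg, zero_mul, add_zero]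
  congr 1
  have : (-(1 / 2 : ℂ) * (‖z‖ : ℂ) ^ 2) = ((-‖z‖ ^ 2 / (2 * 1) : ℝ) : ℂ) := by
    push_cast; ring
  rw [this, ← Complex.ofReal_exp]
  rfl

/-- Both measures are finite and have characteristic function `exp(-|ξ|²/2)`; on the left this is
the Gaussian Fourier integral. -/
theorem withDensity_heatKernel_one :
    (volume : Measure (Space d)).withDensity (fun z => ENNReal.ofReal (heatKernel 1 0 z)) =
      stdGaussian (Space d) := by
  have hfin : IsFiniteMeasure ((volume : Measure (Space d)).withDensity
      (fun z => ENNReal.ofReal (heatKernel 1 0 z))) :=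
    isFiniteMeasure_withDensity_ofReal integrable_heatKernel_one.2
  refine Measure.ext_of_charFun (funext fun ξ => ?_)
  rw [charFun_stdGaussian, charFun_apply, integral_withDensity_eq_integral_toReal_smul
    (by fun_prop) (by simp)]
  have h := GaussianFourier.integral_cexp_neg_mul_sq_norm_add (V := Space d) (b := 1 / 2)
    (by norm_num) Complex.I ξ
  have hpi : ((Real.pi : ℂ) / (1 / 2)) ^ ((Module.finrank ℝ (Space d) : ℂ) / 2) =
      (((2 * Real.pi * 1) ^ ((d : ℝ) / 2) : ℝ) : ℂ) := by
    rw [Complex.ofReal_cpow (by positivity)]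
    simp only [finrank_euclideanSpace, Fintype.card_fin]
    push_cast
    congr 1
    ring
  rw [hpi] at h
  have h2 : ∀ z : Space d, (ENNReal.ofReal (heatKernel 1 0 z)).toReal •
      Complex.exp (inner ℝ z ξ * Complex.I) = (((2 * Real.pi * 1) ^ (-((d : ℝ) / 2)) : ℝ) : ℂ) *
        Complex.exp (-(1 / 2) * ‖z‖ ^ 2 + Complex.I * inner ℝ ξ z) := by
    intro z
    rw [ENNReal.toReal_ofReal (heatKernel_nonneg zero_le_one _ _), heatKernel, zero_sub, norm_neg,
      Complex.exp_add, Complex.real_smul]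
    push_cast
    rw [real_inner_comm, mul_comm (Complex.I), mul_assoc]
    congr 3
    ring
  simp_rw [h2]
  rw [integral_const_mul, h, ← mul_assoc, ← Complex.ofReal_mul, ← Real.rpow_add (by positivity)]
  simp only [neg_add_cancel, Real.rpow_zero, Complex.ofReal_one, one_mul, Complex.I_sq]
  congr 1
  ring

/-- The heat kernel is the density of a scaled and shifted standard Gaussian. -/
theorem lintegral_heatKernel_mul {t : ℝ} (ht : 0 < t) (x : Space d) {F : Space d → ℝ≥0∞}
    (hF : Measurable F) :
    ∫⁻ x', ENNReal.ofReal (heatKernel t x x') * F x' =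
      ∫⁻ z, F (x + √t • z) ∂(stdGaussian (Space d)) := by
  have hs : √t ≠ 0 := (Real.sqrt_pos.2 ht).ne'
  rw [← withDensity_heatKernel_one, lintegral_withDensity_eq_lintegral_mul _ (by fun_prop)
    (by fun_prop), ← lintegral_add_left_eq_self _ x]
  have hG : Measurable fun z : Space d => ENNReal.ofReal (heatKernel t x (x + z)) * F (x + z) := by
    fun_prop
  have hmap := Measure.map_addHaar_smul (volume : Measure (Space d)) hs
  have hc : |(√t ^ Module.finrank ℝ (Space d))⁻¹| = t ^ (-((d : ℝ) / 2)) := by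
    rw [abs_of_nonneg (by positivity), finrank_euclideanSpace, Fintype.card_fin,
      Real.rpow_neg ht.le, Real.sqrt_eq_rpow, ← Real.rpow_natCast, ← Real.rpow_mul ht.le]
    congr 2
    ring
  rw [hc] at hmap
  have hpos : 0 < t ^ (-((d : ℝ) / 2)) := Real.rpow_pos_of_pos ht _
  -- The same integral is computed twice, by the Jacobian of `z ↦ √t z` and by Brownian scaling.
  -- Both give the factor `t^{-d/2}`, which cancels.
  have h1 : ∫⁻ z : Space d, ENNReal.ofReal (heatKernel t x (x + √t • z)) * F (x + √t • z) =
      ENNReal.ofReal (t ^ (-((d : ℝ) / 2))) *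
        ∫⁻ z : Space d, ENNReal.ofReal (heatKernel t x (x + z)) * F (x + z) := by
    rw [← smul_eq_mul, ← lintegral_smul_measure, ← hmap, lintegral_map hG (by fun_prop)]
  have h2 : ∫⁻ z : Space d, ENNReal.ofReal (heatKernel t x (x + √t • z)) * F (x + √t • z) =
      ENNReal.ofReal (t ^ (-((d : ℝ) / 2))) *
        ∫⁻ z : Space d, ENNReal.ofReal (heatKernel 1 0 z) * F (x + √t • z) := by
    rw [← lintegral_const_mul _ (by fun_prop)]
    refine lintegral_congr fun z => ?_
    rw [heatKernel_scale ht, ENNReal.ofReal_mul hpos.le, mul_assoc]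
  rw [h2] at h1
  exact ((ENNReal.mul_right_inj (by simpa using hpos) ENNReal.ofReal_ne_top).1 h1).symm

theorem lintegral_heatKernel {t : ℝ} (ht : 0 < t) (x : Space d) :
    ∫⁻ x', ENNReal.ofReal (heatKernel t x x') = 1 := by
  have := lintegral_heatKernel_mul ht x (F := fun _ => 1) measurable_const
  simpa using this

/-- Bridge decomposition of the heat kernel at an intermediate time. -/
theorem heatKernel_mul_bridge {τ ρ : ℝ} (hτ : 0 < τ) (hρ : 0 < ρ) (hρ1 : ρ < 1)
    (x x' z : Space d) :
    heatKernel τ x x' * heatKernel (τ * (ρ * (1 - ρ))) (x + ρ • (x' - x)) z =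
      heatKernel (τ * ρ) x z * heatKernel (τ * (1 - ρ)) z x' := by
  have h1 : 0 < 1 - ρ := by linarith
  unfold heatKernel
  rw [mul_mul_mul_comm, mul_mul_mul_comm ((2 * Real.pi * (τ * ρ)) ^ _), ← Real.exp_add, ← Real.exp_add,
    ← Real.mul_rpow (by positivity) (by positivity), ← Real.mul_rpow (by positivity) (by positivity)]
  congr 1
  · congr 1
    ring
  · congr 1
    -- In the variables `u = x - z` and `v = z - x'` the equality of the exponents is a polynomial
    -- identity in `|u|²`, `|v|²` and `⟨u,v⟩`.
    have e1 : x + ρ • (x' - x) - z = (1 - ρ) • (x - z) - ρ • (z - x') := by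
      module
    have e2 : x - x' = (x - z) + (z - x') := by abel
    rw [e1, e2]
    generalize x - z = u, z - x' = v
    rw [norm_add_sq_real, norm_sub_sq_real, norm_smul, norm_smul, inner_smul_left,
      inner_smul_right, mul_pow, mul_pow]
    simp only [Real.norm_eq_abs, sq_abs, conj_trivial]
    field_simp
    ring

/-- Chapman–Kolmogorov. -/
theorem lintegral_heatKernel_mul_heatKernel {σ τ : ℝ} (hσ : 0 < σ) (hτ : 0 < τ)
    (x x' : Space d) :
    ∫⁻ z, ENNReal.ofReal (heatKernel σ x z) * ENNReal.ofReal (heatKernel τ z x') =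
      ENNReal.ofReal (heatKernel (σ + τ) x x') := by
  have hs : 0 < σ + τ := by positivity
  have hρ : 0 < σ / (σ + τ) := by positivity
  have hρ1 : σ / (σ + τ) < 1 := by rw [div_lt_one hs]; linarith
  have e1 : (σ + τ) * (σ / (σ + τ)) = σ := by field_simp
  have e2 : (σ + τ) * (1 - σ / (σ + τ)) = τ := by field_simp; ring
  -- By the bridge decomposition at `ρ = σ/(σ+τ)`, the integrand is the answer times a heat kernel
  -- in `z`, whose total mass is one.
  have h : ∀ z, ENNReal.ofReal (heatKernel σ x z) * ENNReal.ofReal (heatKernel τ z x') =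
      ENNReal.ofReal (heatKernel (σ + τ) x x') * ENNReal.ofReal (heatKernel
        ((σ + τ) * (σ / (σ + τ) * (1 - σ / (σ + τ)))) (x + (σ / (σ + τ)) • (x' - x)) z) := by
    intro z
    have := heatKernel_mul_bridge hs hρ hρ1 x x' z
    rw [e1, e2] at this
    rw [← ENNReal.ofReal_mul (heatKernel_nonneg hσ.le _ _),
      ← ENNReal.ofReal_mul (heatKernel_nonneg hs.le _ _), this]
  simp_rw [h]
  rw [lintegral_const_mul _ (by fun_prop), lintegral_heatKernel (by
    have : 0 < 1 - σ / (σ + τ) := by linarith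
    positivity), mul_one]


/-! ### Gaussian averages of smooth functions -/

theorem integral_stdGaussian_eq (g : Space d → ℝ) :
    ∫ z, g z ∂(stdGaussian (Space d)) = ∫ z, g z * heatKernel 1 0 z := by
  rw [← withDensity_heatKernel_one, integral_withDensity_eq_integral_toReal_smul
    (by fun_prop) (by simp)]
  refine integral_congr_ae (Filter.Eventually.of_forall fun z => ?_)
  simp only [smul_eq_mul]
  rw [ENNReal.toReal_ofReal (heatKernel_nonneg zero_le_one _ _), mul_comm]

theorem integrable_stdGaussian_iff (g : Space d → ℝ) :
    Integrable g (stdGaussian (Space d)) ↔ Integrable fun z => g z * heatKernel 1 0 z := by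
  rw [← withDensity_heatKernel_one, integrable_withDensity_iff_integrable_smul'
    (by fun_prop) (by simp)]
  refine integrable_congr (Filter.Eventually.of_forall fun z => ?_)
  simp only [smul_eq_mul]
  rw [ENNReal.toReal_ofReal (heatKernel_nonneg zero_le_one _ _), mul_comm]

theorem hasFDerivAt_heatKernel_one (z : Space d) :
    HasFDerivAt (fun z : Space d => heatKernel 1 0 z)
      (-(heatKernel 1 0 z) • innerSL ℝ z) z := by
  have h1 : HasFDerivAt (fun z : Space d => ‖z‖ ^ 2) (2 • innerSL ℝ z) z :=
    (hasStrictFDerivAt_norm_sq z).hasFDerivAt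
  have h2 : HasFDerivAt (fun z : Space d => -‖z‖ ^ 2 / 2) (-innerSL ℝ z) z := by
    have h := h1.const_mul (-(1 / 2) : ℝ)
    have e : (-innerSL ℝ z : Space d →L[ℝ] ℝ) = (-(1 / 2) : ℝ) • (2 • innerSL ℝ z) := by
      rw [← Nat.cast_smul_eq_nsmul ℝ, smul_smul]
      norm_num
    rw [e]
    exact h.congr_of_eventuallyEq (Filter.Eventually.of_forall fun z => by ring)
  have h3 := (h2.exp).const_mul ((2 * Real.pi * 1) ^ (-((d : ℝ) / 2)))
  have e : (fun z : Space d => heatKernel 1 0 z) = fun z =>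
      (2 * Real.pi * 1) ^ (-((d : ℝ) / 2)) * Real.exp (-‖z‖ ^ 2 / 2) := by
    ext z
    simp [heatKernel]
  rw [e]
  refine h3.congr_fderiv ?_
  rw [smul_smul, smul_neg, neg_smul]
  simp [heatKernel]

theorem integrable_inner_stdGaussian (v : Space d) :
    Integrable (fun z => inner ℝ z v) (stdGaussian (Space d)) :=
  (IsGaussian.integrable_id (μ := stdGaussian (Space d))).inner_const v

/-- Gaussian integration by parts. -/
theorem integral_mul_inner_stdGaussian {g : Space d → ℝ} (hg : Differentiable ℝ g)
    {C : ℝ} (hC : ∀ z, |g z| ≤ C) {v : Space d} (hv : Continuous fun z => fderiv ℝ g z v)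
    {C' : ℝ} (hC' : ∀ z, |fderiv ℝ g z v| ≤ C') :
    ∫ z, g z * inner ℝ z v ∂(stdGaussian (Space d)) =
      ∫ z, fderiv ℝ g z v ∂(stdGaussian (Space d)) := by
  have hρ : ∀ z : Space d, fderiv ℝ (fun z : Space d => heatKernel 1 0 z) z v =
      -(heatKernel 1 0 z * inner ℝ z v) := fun z => by
    rw [(hasFDerivAt_heatKernel_one z).fderiv]
    simp
  have i1 : Integrable (fun z => fderiv ℝ g z v) (stdGaussian (Space d)) :=
    Integrable.of_bound hv.aestronglyMeasurable C' (Filter.Eventually.of_forall hC')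
  have i2 : Integrable g (stdGaussian (Space d)) :=
    Integrable.of_bound hg.continuous.aestronglyMeasurable C (Filter.Eventually.of_forall hC)
  have i3 : Integrable (fun z => g z * inner ℝ z v) (stdGaussian (Space d)) :=
    (integrable_inner_stdGaussian v).bdd_mul hg.continuous.aestronglyMeasurable
      (Filter.Eventually.of_forall hC)
  rw [integrable_stdGaussian_iff] at i1 i2 i3
  have h := integral_mul_fderiv_eq_neg_fderiv_mul_of_integrable (μ := volume) (f := g)
    (g := fun z : Space d => heatKernel 1 0 z) (v := v) i1
    (by
      refine i3.neg.congr (Filter.Eventually.of_forall fun z => ?_)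
      simp only [Pi.neg_apply, hρ]
      ring) i2 (fun z _ => hg z) (fun z _ => (hasFDerivAt_heatKernel_one z).differentiableAt)
  rw [integral_stdGaussian_eq, integral_stdGaussian_eq, ← neg_neg (∫ z, fderiv ℝ g z v * _), ← h,
    ← integral_neg]
  refine integral_congr_ae (Filter.Eventually.of_forall fun z => ?_)
  simp only [hρ]
  ring

/-! ### The Laplacian in coordinates and the heat equation for Gaussian averages. -/

theorem laplacian_eq_sum (f : Space d → ℝ) (x : Space d) :
    (Δ f) x = ∑ i, fderiv ℝ (fderiv ℝ f) x (EuclideanSpace.basisFun (Fin d) ℝ i)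
      (EuclideanSpace.basisFun (Fin d) ℝ i) := by
  rw [InnerProductSpace.laplacian_eq_iteratedFDeriv_orthonormalBasis f
    (EuclideanSpace.basisFun (Fin d) ℝ)]
  simp [iteratedFDeriv_two_apply]

theorem norm_fderiv_fderiv_eq (f : Space d → ℝ) (x : Space d) :
    ‖fderiv ℝ (fderiv ℝ f) x‖ = ‖iteratedFDeriv ℝ 2 f x‖ := by
  rw [← norm_iteratedFDeriv_fderiv, norm_iteratedFDeriv_one]

theorem abs_fderiv_fderiv_basisFun_le {f : Space d → ℝ} {C : ℝ}
    (hC : ∀ x, ‖iteratedFDeriv ℝ 2 f x‖ ≤ C) (x : Space d) (i : Fin d) :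
    |fderiv ℝ (fderiv ℝ f) x (EuclideanSpace.basisFun (Fin d) ℝ i)
      (EuclideanSpace.basisFun (Fin d) ℝ i)| ≤ C := by
  have h := (fderiv ℝ (fderiv ℝ f) x).le_opNorm₂ (EuclideanSpace.basisFun (Fin d) ℝ i)
    (EuclideanSpace.basisFun (Fin d) ℝ i)
  rw [norm_fderiv_fderiv_eq, (EuclideanSpace.basisFun (Fin d) ℝ).norm_eq_one i, mul_one,
    mul_one] at h
  exact h.trans (hC x)

theorem abs_laplacian_le {f : Space d → ℝ} {C : ℝ}
    (hC : ∀ x, ‖iteratedFDeriv ℝ 2 f x‖ ≤ C) (x : Space d) : |(Δ f) x| ≤ d * C := by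
  rw [laplacian_eq_sum]
  refine (Finset.abs_sum_le_sum_abs _ _).trans ((Finset.sum_le_sum fun i _ =>
    abs_fderiv_fderiv_basisFun_le hC x i).trans ?_)
  simp

theorem continuous_laplacian {f : Space d → ℝ} (hf : ContDiff ℝ 2 f) : Continuous (Δ f) := by
  have h1 : Continuous (fderiv ℝ (fderiv ℝ f)) :=
    (hf.fderiv_right (m := 1) (by norm_num)).continuous_fderiv one_ne_zero
  have e : Δ f = fun x => ∑ i, fderiv ℝ (fderiv ℝ f) x (EuclideanSpace.basisFun (Fin d) ℝ i)
      (EuclideanSpace.basisFun (Fin d) ℝ i) := funext fun x => laplacian_eq_sum f x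
  rw [e]
  fun_prop

/-- `∂_σ 𝔼 f(x + √σ Z) = ½ 𝔼 Δf(x + √σ Z)`. -/
theorem hasDerivAt_integral_stdGaussian {f : Space d → ℝ} (hf : ContDiff ℝ 2 f) {C₀ C₁ C₂ : ℝ}
    (h0 : ∀ x, |f x| ≤ C₀) (h1 : ∀ x, ‖fderiv ℝ f x‖ ≤ C₁)
    (h2 : ∀ x, ‖iteratedFDeriv ℝ 2 f x‖ ≤ C₂) (x : Space d) {σ : ℝ} (hσ : 0 < σ) :
    HasDerivAt (fun σ => ∫ z, f (x + √σ • z) ∂(stdGaussian (Space d)))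
      (∫ z, 1 / 2 * (Δ f) (x + √σ • z) ∂(stdGaussian (Space d))) σ := by
  have hfd : Differentiable ℝ f := hf.differentiable two_ne_zero
  have hf1 : ContDiff ℝ 1 (fderiv ℝ f) := hf.fderiv_right (m := 1) (by norm_num)
  have hsp : 0 < √σ := Real.sqrt_pos.2 hσ
  have hC1 : 0 ≤ C₁ := (norm_nonneg _).trans (h1 0)
  -- Differentiation under the integral gives `Df(x + √σ z)(z / (2√σ))`. The neighbourhood `(σ/2,
  -- ∞)` keeps `1/√s` bounded, and the dominating function is a multiple of `‖z‖`.
  have key := (hasDerivAt_integral_of_dominated_loc_of_deriv_le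
    (μ := stdGaussian (Space d)) (F := fun σ z => f (x + √σ • z))
    (F' := fun σ z => fderiv ℝ f (x + √σ • z) ((1 / (2 * √σ)) • z))
    (bound := fun z => C₁ * ((1 / (2 * √(σ / 2))) * ‖z‖)) (x₀ := σ) (s := Ioi (σ / 2))
    (Ioi_mem_nhds (by linarith))
    (Filter.Eventually.of_forall fun s => (hfd.continuous.comp
      (by fun_prop)).aestronglyMeasurable)
    (Integrable.of_bound (hfd.continuous.comp (by fun_prop)).aestronglyMeasurable C₀
      (Filter.Eventually.of_forall fun z => h0 _))
    (by
      have : Continuous (fderiv ℝ f) := hf1.continuous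
      exact (by fun_prop : Continuous fun z : Space d =>
        fderiv ℝ f (x + √σ • z) ((1 / (2 * √σ)) • z)).aestronglyMeasurable)
    (Filter.Eventually.of_forall fun z s hs => by
      have hs' : σ / 2 < s := hs
      have hp : 0 < √(σ / 2) := Real.sqrt_pos.2 (by linarith)
      have hle : √(σ / 2) ≤ √s := Real.sqrt_le_sqrt hs'.le
      refine (ContinuousLinearMap.le_opNorm _ _).trans ?_
      rw [norm_smul, Real.norm_eq_abs, abs_of_nonneg (by positivity)]
      gcongr
      exact h1 _)
    (((IsGaussian.integrable_id (μ := stdGaussian (Space d))).norm.const_mul _).const_mul _)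
    (Filter.Eventually.of_forall fun z s hs => by
      have hs' : 0 < s := lt_trans (by linarith) (mem_Ioi.1 hs)
      have hg : HasDerivAt (fun s : ℝ => x + √s • z) ((1 / (2 * √s)) • z) s :=
        ((Real.hasDerivAt_sqrt hs'.ne').smul_const z).const_add x
      exact (hfd (x + √s • z)).hasFDerivAt.comp_hasDerivAt s hg)).2
  -- Gaussian integration by parts in each basis direction turns the factor `⟨z, eᵢ⟩` into another
  -- derivative; the chain-rule factor `√σ` cancels `1/√σ`.
  suffices hs : ∫ z, 1 / 2 * (Δ f) (x + √σ • z) ∂(stdGaussian (Space d)) =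
      ∫ z, fderiv ℝ f (x + √σ • z) ((1 / (2 * √σ)) • z) ∂(stdGaussian (Space d)) by
    rw [hs]
    exact key
  set e := EuclideanSpace.basisFun (Fin d) ℝ with he
  have hcont2 : Continuous (fderiv ℝ (fderiv ℝ f)) := hf1.continuous_fderiv one_ne_zero
  have hderiv : ∀ i z, HasFDerivAt (fun z : Space d => fderiv ℝ f (x + √σ • z) (e i))
      (√σ • (fderiv ℝ (fderiv ℝ f) (x + √σ • z)).flip (e i)) z := by
    intro i z
    have hg : HasFDerivAt (fun z : Space d => x + √σ • z)
        (√σ • ContinuousLinearMap.id ℝ (Space d)) z :=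
      ((hasFDerivAt_id z).const_smul √σ).const_add x
    have h3 := ((hf1.differentiable one_ne_zero) (x + √σ • z)).hasFDerivAt.comp z hg
    have h4 := h3.clm_apply (hasFDerivAt_const (e i) z)
    refine h4.congr_fderiv ?_
    ext v
    simp
  have hstein : ∀ i, ∫ z, fderiv ℝ f (x + √σ • z) (e i) * inner ℝ z (e i)
      ∂(stdGaussian (Space d)) = ∫ z, √σ * fderiv ℝ (fderiv ℝ f) (x + √σ • z) (e i) (e i)
        ∂(stdGaussian (Space d)) := by
    intro i
    have hfe : ∀ z, fderiv ℝ (fun z : Space d => fderiv ℝ f (x + √σ • z) (e i)) z (e i) =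
        √σ * fderiv ℝ (fderiv ℝ f) (x + √σ • z) (e i) (e i) := fun z => by
      rw [(hderiv i z).fderiv]
      simp
    rw [integral_mul_inner_stdGaussian (C := C₁) (C' := √σ * C₂)
      (fun z => (hderiv i z).differentiableAt)]
    · simp_rw [hfe]
    · intro z
      refine ((fderiv ℝ f (x + √σ • z)).le_opNorm (e i)).trans ?_
      rw [e.norm_eq_one i, mul_one]
      exact h1 _
    · simp_rw [hfe]
      fun_prop
    · intro z
      rw [hfe, abs_mul, abs_of_pos hsp]
      gcongr
      exact abs_fderiv_fderiv_basisFun_le h2 _ i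
  have hexp : ∀ z : Space d, fderiv ℝ f (x + √σ • z) ((1 / (2 * √σ)) • z) =
      ∑ i, (1 / (2 * √σ)) * (fderiv ℝ f (x + √σ • z) (e i) * inner ℝ z (e i)) := by
    intro z
    have hz : fderiv ℝ f (x + √σ • z) ((1 / (2 * √σ)) • z) =
        fderiv ℝ f (x + √σ • z) ((1 / (2 * √σ)) • ∑ i, e.repr z i • e i) := by rw [e.sum_repr]
    rw [hz, map_smul, map_sum, ← Finset.mul_sum, smul_eq_mul]
    congr 1
    refine Finset.sum_congr rfl fun i _ => ?_
    rw [map_smul, smul_eq_mul, e.repr_apply_apply, real_inner_comm, mul_comm]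
  have hint : ∀ i, Integrable (fun z : Space d =>
      fderiv ℝ f (x + √σ • z) (e i) * inner ℝ z (e i)) (stdGaussian (Space d)) := by
    intro i
    have hc : Continuous (fderiv ℝ f) := hf1.continuous
    refine (integrable_inner_stdGaussian (e i)).bdd_mul (c := C₁)
      (by fun_prop : Continuous fun z : Space d =>
        fderiv ℝ f (x + √σ • z) (e i)).aestronglyMeasurable
      (Filter.Eventually.of_forall fun z => ?_)
    refine (ContinuousLinearMap.le_opNorm _ _).trans ?_
    rw [e.norm_eq_one i, mul_one]
    exact h1 _
  simp_rw [hexp]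
  rw [integral_finsetSum _ fun i _ => (hint i).const_mul _]
  simp only [integral_const_mul, hstein, laplacian_eq_sum]
  rw [← he]
  rw [integral_finsetSum _ fun i _ => Integrable.of_bound (C := C₂)
    (by fun_prop : Continuous fun z : Space d =>
      fderiv ℝ (fderiv ℝ f) (x + √σ • z) (e i) (e i)).aestronglyMeasurable
    (Filter.Eventually.of_forall fun z => abs_fderiv_fderiv_basisFun_le h2 _ i), Finset.mul_sum]
  refine Finset.sum_congr rfl fun i _ => ?_
  field_simp

theorem continuous_integral_stdGaussian {g : Space d → ℝ} (hg : Continuous g) {C : ℝ}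
    (hC : ∀ x, |g x| ≤ C) (x : Space d) :
    Continuous fun σ : ℝ => ∫ z, g (x + √σ • z) ∂(stdGaussian (Space d)) :=
  continuous_of_dominated (bound := fun _ => C)
    (fun σ => (hg.comp (by fun_prop)).aestronglyMeasurable)
    (fun σ => Filter.Eventually.of_forall fun z => hC _) (integrable_const _)
    (Filter.Eventually.of_forall fun z => hg.comp (by fun_prop))

/-- The heat equation in integrated form: `P_τ f - f = ∫₀^τ P_σ (½ Δ f) dσ`. -/
theorem integral_stdGaussian_sub_eq {f : Space d → ℝ} (hf : ContDiff ℝ 2 f) {C₀ C₁ C₂ : ℝ}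
    (h0 : ∀ x, |f x| ≤ C₀) (h1 : ∀ x, ‖fderiv ℝ f x‖ ≤ C₁)
    (h2 : ∀ x, ‖iteratedFDeriv ℝ 2 f x‖ ≤ C₂) (x : Space d) {τ : ℝ} (hτ : 0 ≤ τ) :
    (∫ z, f (x + √τ • z) ∂(stdGaussian (Space d))) - f x =
      ∫ σ in (0 : ℝ)..τ, ∫ z, 1 / 2 * (Δ f) (x + √σ • z) ∂(stdGaussian (Space d)) := by
  have hΔ : Continuous fun σ : ℝ => ∫ z, 1 / 2 * (Δ f) (x + √σ • z) ∂(stdGaussian (Space d)) :=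
    continuous_integral_stdGaussian (g := fun x => 1 / 2 * (Δ f) x) (C := 1 / 2 * (d * C₂))
      ((continuous_laplacian hf).const_mul _ |>.congr fun _ => rfl) (fun x => by
        rw [abs_mul, abs_of_pos (by norm_num : (0 : ℝ) < 1 / 2)]
        gcongr
        exact abs_laplacian_le h2 x) x
  -- The derivative formula is available only for `σ > 0`, because of the square root; at `σ = 0`
  -- continuity suffices.
  rw [intervalIntegral.integral_eq_sub_of_hasDerivAt_of_le hτ
    (continuous_integral_stdGaussian hf.continuous h0 x).continuousOn
    (fun σ hσ => hasDerivAt_integral_stdGaussian hf h0 h1 h2 x hσ.1)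
    (hΔ.intervalIntegrable _ _)]
  simp

/-! ### Integration against the heat flow -/

theorem lintegral_transport {k : Space d → E → Space d → ℝ≥0∞}
    (hk : Measurable fun q : (Space d × E) × Space d => k q.1.1 q.1.2 q.2)
    (ν : Measure (Space d × E)) [SFinite ν] {F : Space d × E → ℝ≥0∞} (hF : Measurable F) :
    ∫⁻ q, F q ∂(transport k ν) = ∫⁻ q, (∫⁻ x', k q.1 q.2 x' * F (x', q.2)) ∂ν := by
  have hF' : Measurable fun q : (Space d × E) × Space d => F (q.2, q.1.2) := by fun_prop
  rw [transport, lintegral_map hF (by fun_prop), lintegral_withDensity_eq_lintegral_mul _ hk hF',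
    lintegral_prod _ (hk.mul hF').aemeasurable]
  rfl

theorem lintegral_heatFlow (M : Model d E) (t : ℝ) (ν : Measure (Space d × E)) [SFinite ν]
    {F : Space d × E → ℝ≥0∞} (hF : Measurable F) :
    ∫⁻ q, F q ∂(heatFlow M t ν) =
      ∫⁻ q, (∫⁻ x', ENNReal.ofReal (heatKernel (M.a q.2 * t) q.1 x') * F (x', q.2)) ∂ν :=
  lintegral_transport (k := fun x y x' => ENNReal.ofReal (heatKernel (M.a y * t) x x'))
    (measurable_heatKernel M t).ennreal_ofReal ν hF

theorem lintegral_heatFlow_gaussian (M : Model d E) {t : ℝ} (ht : 0 < t)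
    (ν : Measure (Space d × E)) [SFinite ν] {F : Space d × E → ℝ≥0∞} (hF : Measurable F) :
    ∫⁻ q, F q ∂(heatFlow M t ν) =
      ∫⁻ q, ∫⁻ z, F (q.1 + √(M.a q.2 * t) • z, q.2) ∂(stdGaussian (Space d)) ∂ν := by
  rw [lintegral_heatFlow M t ν hF]
  exact lintegral_congr fun q =>
    lintegral_heatKernel_mul (mul_pos (M.a_pos _) ht) q.1 (F := fun x' => F (x', q.2))
      (by fun_prop)

theorem heatFlow_univ (M : Model d E) {t : ℝ} (ht : 0 < t) (ν : Measure (Space d × E))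
    [SFinite ν] : heatFlow M t ν univ = ν univ := by
  rw [← lintegral_one, lintegral_heatFlow_gaussian M ht ν measurable_const]
  simp

theorem isFiniteMeasure_heatFlow (M : Model d E) {t : ℝ} (ht : 0 < t) (ν : Measure (Space d × E))
    [IsFiniteMeasure ν] : IsFiniteMeasure (heatFlow M t ν) :=
  ⟨by rw [heatFlow_univ M ht]; exact measure_lt_top _ _⟩

/-- The semigroup property of the heat flow, tested against the heat kernel. -/
theorem lintegral_heatKernel_heatFlow (M : Model d E) {σ τ : ℝ} (hσ : 0 < σ) (hτ : 0 < τ)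
    (ν : Measure (Space d × E)) [SFinite ν] {h : E → ℝ≥0∞} (hh : Measurable h) (x₀ : Space d) :
    ∫⁻ q, h q.2 * ENNReal.ofReal (heatKernel (M.a q.2 * σ) x₀ q.1) ∂(heatFlow M τ ν) =
      ∫⁻ q, h q.2 * ENNReal.ofReal (heatKernel (M.a q.2 * (σ + τ)) x₀ q.1) ∂ν := by
  have ha := M.measurable_a
  rw [lintegral_heatFlow M τ ν (by fun_prop)]
  refine lintegral_congr fun q => ?_
  have h1 := lintegral_heatKernel_mul_heatKernel (mul_pos (M.a_pos q.2) hσ)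
    (mul_pos (M.a_pos q.2) hτ) x₀ q.1
  rw [mul_add, ← h1, ← lintegral_const_mul _ (by fun_prop)]
  refine lintegral_congr fun z => ?_
  simp only
  rw [heatKernel_symm _ q.1 z]
  ring

/-! ### Densities -/

theorem IsDensityKernel.isSFiniteKernel {κ : Kernel (Space d) E} {μ : Measure (Space d × E)}
    (h : IsDensityKernel κ μ) : IsSFiniteKernel κ :=
  isSFiniteKernel_of_finite κ h.1

theorem IsDensityKernel.isFiniteMeasure {κ : Kernel (Space d) E} {μ : Measure (Space d × E)}
    (h : IsDensityKernel κ μ) (x : Space d) : IsFiniteMeasure (κ x) := ⟨h.1 x⟩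

theorem IsDensityKernel.compProd_eq {κ : Kernel (Space d) E} {μ : Measure (Space d × E)}
    [IsFiniteMeasure μ] (h : IsDensityKernel κ μ) : (volume : Measure (Space d)).compProd κ = μ := by
  have := h.isSFiniteKernel
  symm
  refine Measure.ext_prod fun {B A} hB hA => ?_
  rw [h.2 B A hB hA, Measure.compProd_apply_prod hB hA]

theorem IsDensityKernel.lintegral_eq {κ : Kernel (Space d) E} {μ : Measure (Space d × E)}
    [IsFiniteMeasure μ] (h : IsDensityKernel κ μ) {F : Space d × E → ℝ≥0∞} (hF : Measurable F) :
    ∫⁻ q, F q ∂μ = ∫⁻ x, ∫⁻ y, F (x, y) ∂(κ x) := by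
  have := h.isSFiniteKernel
  rw [← h.compProd_eq, Measure.lintegral_compProd hF]

/-- For a fixed set the two densities agree almost everywhere. The σ-algebra of `E` is generated by
a countable algebra, so one null set serves for all its members, and finite measures agreeing on a
generating algebra are equal. -/
theorem IsDensityKernel.ae_eq [StandardBorelSpace E]
    {κ κ' : Kernel (Space d) E}
    {μ : Measure (Space d × E)} [IsFiniteMeasure μ] (h : IsDensityKernel κ μ)
    (h' : IsDensityKernel κ' μ) : ∀ᵐ x ∂(volume : Measure (Space d)), κ x = κ' x := by
  have hA : ∀ A, MeasurableSet A → ∀ᵐ x ∂(volume : Measure (Space d)), κ x A = κ' x A := by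
    intro A hA
    refine ae_eq_of_forall_setLIntegral_eq_of_sigmaFinite (κ.measurable_coe hA)
      (κ'.measurable_coe hA) fun B hB _ => ?_
    rw [← h.2 B A hB hA, ← h'.2 B A hB hA]
  set G := MeasurableSpace.countableGeneratingSet E with hG
  have hgen : MeasurableSpace.generateFrom (generateSetAlgebra G) = ‹MeasurableSpace E› := by
    rw [generateFrom_generateSetAlgebra_eq, MeasurableSpace.generateFrom_countableGeneratingSet]
  have hcount : (generateSetAlgebra G).Countable :=
    countable_generateSetAlgebra (MeasurableSpace.countable_countableGeneratingSet)
  have hall : ∀ᵐ x ∂(volume : Measure (Space d)), ∀ A ∈ generateSetAlgebra G, κ x A = κ' x A := by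
    rw [ae_ball_iff hcount]
    intro A hA'
    refine hA A ?_
    rw [← hgen]
    exact MeasurableSpace.measurableSet_generateFrom hA'
  have halg : IsSetAlgebra (generateSetAlgebra G) := isSetAlgebra_generateSetAlgebra
  filter_upwards [hall] with x hx
  have := h.isFiniteMeasure x
  exact ext_of_generate_finite (generateSetAlgebra G) hgen.symm
    (fun s hs t ht _ => halg.inter_mem hs ht) (fun A hA' => hx A hA') (hx univ halg.univ_mem)


/-! ### The coagulation terms in terms of an arbitrary density -/

/-- `Kplus` is defined through one chosen version of the density. Freedom in the version is needed
later, when versions jointly measurable in time are used. -/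
theorem lintegral_Kplus [StandardBorelSpace E]
    (M : Model d E) {μ : Measure (Space d × E)}
    (hμ : MemM μ) {κ : Kernel (Space d) E} (hκ : IsDensityKernel κ μ)
    {F : Space d × E → ℝ≥0∞} (hF : Measurable F) :
    ∫⁻ q, F q ∂(Kplus M μ) =
      1 / 2 * ∫⁻ x, ∫⁻ y, ∫⁻ y', ∫⁻ z, F (x, z) ∂(M.K (y, y')) ∂(κ x) ∂(κ x) := by
  have := hμ.1
  have := M.isSFiniteKernel_K
  rw [Kplus, lintegral_smul_measure, Measure.lintegral_compProd hF, smul_eq_mul]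
  congr 1
  refine lintegral_congr_ae ?_
  filter_upwards [hκ.ae_eq hμ.isDensityKernel_density] with x hx
  have hG : Measurable fun p : E × E => ∫⁻ z, F (x, z) ∂(M.K p) :=
    Measurable.lintegral_kernel (f := fun z => F (x, z)) (by fun_prop)
  rw [Kernel.lintegral_comp _ _ _ (by fun_prop), Kernel.lintegral_prod _ _ _ hG, hx]

theorem measurable_lintegral_K_univ (M : Model d E) {α : Type*} [MeasurableSpace α]
    (κ : Kernel α E) [IsSFiniteKernel κ] :
    Measurable fun q : α × E => ∫⁻ y', M.K (q.2, y') univ ∂(κ q.1) :=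
  Measurable.lintegral_kernel_prod_right'
    (κ := κ.comap (Prod.fst : α × E → α) measurable_fst)
    (f := fun r : (α × E) × E => M.K (r.1.2, r.2) univ)
    ((Kernel.measurable_coe M.K MeasurableSet.univ).comp (by fun_prop))

/-- Exhibits the loss term as the collision rate times `μ`. Two versions of the rate agree for
Lebesgue-a.e. `x`, hence `μ`-a.e., since the first marginal is absolutely continuous. -/
theorem Kminus_eq_withDensity [StandardBorelSpace E]
    (M : Model d E) {μ : Measure (Space d × E)}
    (hμ : MemM μ) {κ : Kernel (Space d) E} (hκ : IsDensityKernel κ μ) :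
    Kminus M μ = μ.withDensity fun q => ∫⁻ y', M.K (q.2, y') univ ∂(κ q.1) := by
  have := hμ.1
  have := hκ.isSFiniteKernel
  rw [Kminus, hμ.isDensityKernel_density.compProd_eq]
  refine withDensity_congr_ae ?_
  have h := hκ.ae_eq hμ.isDensityKernel_density
  have h2 : ∀ᵐ x ∂μ.fst, κ x = density μ x := hμ.2.ae_le h
  rw [Measure.fst] at h2
  filter_upwards [ae_of_ae_map measurable_fst.aemeasurable h2] with q hq
  rw [hq]

theorem lintegral_Kminus [StandardBorelSpace E]
    (M : Model d E) {μ : Measure (Space d × E)}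
    (hμ : MemM μ) {κ : Kernel (Space d) E} (hκ : IsDensityKernel κ μ)
    {F : Space d × E → ℝ≥0∞} (hF : Measurable F) :
    ∫⁻ q, F q ∂(Kminus M μ) =
      ∫⁻ x, ∫⁻ y, F (x, y) * ∫⁻ y', M.K (y, y') univ ∂(κ x) ∂(κ x) := by
  have := hμ.1
  have := hκ.isSFiniteKernel
  have hc := measurable_lintegral_K_univ M κ
  rw [Kminus_eq_withDensity M hμ hκ, lintegral_withDensity_eq_lintegral_mul _ hc hF,
    hκ.lintegral_eq (hc.mul hF)]
  refine lintegral_congr fun x => lintegral_congr fun y => ?_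
  simp only [Pi.mul_apply]
  rw [mul_comm]

/-- Coagulation decreases subadditive functionals. -/
theorem lintegral_Kplus_le [StandardBorelSpace E]
    (M : Model d E) {μ : Measure (Space d × E)}
    (hμ : MemM μ) {F : Space d × E → ℝ≥0∞} (hF : Measurable F)
    (hsub : ∀ x y y', ∀ᵐ z ∂(M.K (y, y')), F (x, z) ≤ F (x, y) + F (x, y')) :
    ∫⁻ q, F q ∂(Kplus M μ) ≤ ∫⁻ q, F q ∂(Kminus M μ) := by
  have hκ := hμ.isDensityKernel_density
  set κ := density μ
  rw [lintegral_Kplus M hμ hκ hF, lintegral_Kminus M hμ hκ hF, one_div,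
    ← lintegral_const_mul' _ _ (by simp)]
  refine lintegral_mono fun x => ?_
  have := hκ.isFiniteMeasure x
  have hK : Measurable fun p : E × E => M.K p univ := M.K.measurable_coe MeasurableSet.univ
  have hFx : Measurable fun y => F (x, y) := by fun_prop
  set I := ∫⁻ y, F (x, y) * ∫⁻ y', M.K (y, y') univ ∂(κ x) ∂(κ x) with hI
  have h1 : ∫⁻ y, ∫⁻ y', F (x, y) * M.K (y, y') univ ∂(κ x) ∂(κ x) = I := by
    refine lintegral_congr fun y => ?_
    rw [lintegral_const_mul _ (by fun_prop)]
  -- By symmetry of `K` both parents contribute the same integral `I`, and the factor one half in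
  -- the gain term compensates for counting it twice.
  have h2 : ∫⁻ y, ∫⁻ y', F (x, y') * M.K (y, y') univ ∂(κ x) ∂(κ x) = I := by
    rw [lintegral_lintegral_swap (by fun_prop), ← h1]
    refine lintegral_congr fun y => lintegral_congr fun y' => ?_
    rw [M.K_symm]
  calc 2⁻¹ * ∫⁻ y, ∫⁻ y', ∫⁻ z, F (x, z) ∂(M.K (y, y')) ∂(κ x) ∂(κ x)
      ≤ 2⁻¹ * ∫⁻ y, ∫⁻ y', (F (x, y) * M.K (y, y') univ + F (x, y') * M.K (y, y') univ)
          ∂(κ x) ∂(κ x) := by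
        gcongr with y y'
        refine (lintegral_mono_ae (hsub x y y')).trans ?_
        rw [lintegral_const, add_mul]
    _ = 2⁻¹ * (I + I) := by
        congr 1
        rw [← h1]
        nth_rw 2 [h1]
        rw [← h2, ← lintegral_add_left (by fun_prop)]
        refine lintegral_congr fun y => ?_
        rw [← lintegral_add_left (by fun_prop)]
    _ = I := by
        rw [← two_mul, ← mul_assoc, ENNReal.inv_mul_cancel two_ne_zero ENNReal.ofNat_ne_top, one_mul]

/-! ### Consequences of the moment bound -/

theorem Model.measurable_φ_m (M : Model d E) : Measurable fun y => M.φ (M.m y) := by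
  have h : Measurable ((Ioi (0 : ℝ)).indicator M.φ) :=
    (M.φ_cont.measurable_piecewise continuousOn_const measurableSet_Ioi)
  convert h.comp M.measurable_m using 1
  ext y
  simp [M.m_pos y]

theorem Model.measurable_w (M : Model d E) : Measurable M.w :=
  (M.measurable_a.pow_const _).mul M.measurable_φ_m

theorem Model.w_pos (M : Model d E) (y : E) : 0 < M.w y :=
  mul_pos (Real.rpow_pos_of_pos (M.a_pos y) _) (M.φ_pos _ (M.m_pos y))

/-- The bound `⟨w, μ⟩ ≤ C` in `L¹` and `L^∞`. -/
structure MomentLE (M : Model d E) (μ : Measure (Space d × E)) (C : ℝ≥0) : Prop where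
  memM : MemM μ
  l1 : ∫⁻ q, ENNReal.ofReal (M.w q.2) ∂μ ≤ C
  linfty : ∀ κ : Kernel (Space d) E, IsDensityKernel κ μ →
    ∀ᵐ x ∂(volume : Measure (Space d)), ∫⁻ y, ENNReal.ofReal (M.w y) ∂(κ x) ≤ C

theorem MomentBound.exists_momentLE [StandardBorelSpace E]
    {M : Model d E} {T : ℝ≥0∞}
    {μ : ℝ → Measure (Space d × E)} (h : MomentBound M T μ) (hμ : IsProcess T μ) {t : ℝ}
    (ht : Before T t) : ∃ C : ℝ≥0, ∀ s ∈ Icc 0 t, MomentLE M (μ s) C := by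
  have hs : ∀ s ∈ Icc 0 t, Before T s := fun s hs =>
    ⟨hs.1, (ENNReal.ofReal_le_ofReal hs.2).trans_lt ht.2⟩
  have hw := M.measurable_w
  refine ⟨(⨆ s ∈ Icc 0 t, ((∫⁻ x, pairing M.w (μ s) x) +
    essSup (pairing M.w (μ s)) volume)).toNNReal, fun s hst => ?_⟩
  set S := ⨆ s ∈ Icc 0 t, ((∫⁻ x, pairing M.w (μ s) x) + essSup (pairing M.w (μ s)) volume)
  have hle : (∫⁻ x, pairing M.w (μ s) x) + essSup (pairing M.w (μ s)) volume ≤ S :=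
    le_iSup₂_of_le s hst le_rfl
  have hS : (S.toNNReal : ℝ≥0∞) = S := ENNReal.coe_toNNReal (h t ht).ne
  have hM := hμ.1 s (hs s hst)
  have := hM.1
  refine ⟨hM, ?_, fun κ hκ => ?_⟩
  · rw [hM.isDensityKernel_density.lintegral_eq (by fun_prop), hS]
    exact le_self_add.trans hle
  · filter_upwards [hκ.ae_eq hM.isDensityKernel_density, ae_le_essSup (f := pairing M.w (μ s))]
      with x hx hx'
    rw [hx, hS]
    exact hx'.trans (le_add_self.trans hle)

theorem lintegral_K_univ_le (M : Model d E) (ν : Measure E) (y : E) :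
    ∫⁻ y', M.K (y, y') univ ∂ν ≤
      ENNReal.ofReal (M.w y) * ∫⁻ y', ENNReal.ofReal (M.w y') ∂ν := by
  have hw := M.measurable_w
  rw [← lintegral_const_mul _ (by fun_prop)]
  refine lintegral_mono fun y' => ?_
  rw [← ENNReal.ofReal_mul (M.w_pos y).le]
  exact M.K_le y y'

/-- The collision rate at `(x, y)` is at most `w(y) ⟨w, μ⟩(x)`, hence at most `C w(y)` by the `L^∞`
half of the moment bound. The `L¹` half is what later controls the remaining `w`. -/
theorem MomentLE.lintegral_Kminus_le [StandardBorelSpace E]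
    {M : Model d E}
    {μ : Measure (Space d × E)} {C : ℝ≥0} (h : MomentLE M μ C) {F : Space d × E → ℝ≥0∞}
    (hF : Measurable F) :
    ∫⁻ q, F q ∂(Kminus M μ) ≤ C * ∫⁻ q, F q * ENNReal.ofReal (M.w q.2) ∂μ := by
  have hκ := h.memM.isDensityKernel_density
  have := h.memM.1
  have hw := M.measurable_w
  rw [lintegral_Kminus M h.memM hκ hF, hκ.lintegral_eq (by fun_prop),
    ← lintegral_const_mul' _ _ (by simp)]
  refine lintegral_mono_ae ?_
  filter_upwards [h.linfty _ hκ] with x hx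
  rw [← lintegral_const_mul' _ _ (by simp)]
  refine lintegral_mono fun y => ?_
  calc F (x, y) * ∫⁻ y', M.K (y, y') univ ∂(density μ x)
      ≤ F (x, y) * (ENNReal.ofReal (M.w y) * C) := by
        gcongr
        exact (lintegral_K_univ_le M _ y).trans (by gcongr)
    _ = C * (F (x, y) * ENNReal.ofReal (M.w y)) := by ring

theorem MomentLE.Kminus_univ_le [StandardBorelSpace E]
    {M : Model d E}
    {μ : Measure (Space d × E)} {C : ℝ≥0} (h : MomentLE M μ C) : Kminus M μ univ ≤ C * C := by
  have h1 := h.lintegral_Kminus_le (F := fun _ => 1) measurable_const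
  rw [lintegral_one] at h1
  refine h1.trans ?_
  gcongr
  simpa using h.l1

theorem MomentLE.Kplus_univ_le [StandardBorelSpace E]
    {M : Model d E}
    {μ : Measure (Space d × E)} {C : ℝ≥0} (h : MomentLE M μ C) : Kplus M μ univ ≤ C * C := by
  refine le_trans ?_ h.Kminus_univ_le
  rw [← lintegral_one, ← lintegral_one]
  exact lintegral_Kplus_le M h.memM measurable_const fun x y y' =>
    Filter.Eventually.of_forall fun z => by norm_num

theorem MomentLE.univ_le {M : Model d E} {μ : Measure (Space d × E)} {C : ℝ≥0}
    (h : MomentLE M μ C) {ε : ℝ} (hε : 0 < ε) (hw : ∀ y, ε ≤ M.w y) :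
    μ univ ≤ C / ENNReal.ofReal ε := by
  rw [ENNReal.le_div_iff_mul_le (by simp [hε]) (by simp), mul_comm, ← lintegral_const]
  exact (lintegral_mono fun q => ENNReal.ofReal_le_ofReal (hw q.2)).trans h.l1

/-! ### Measurable dependence on time -/

theorem measurableSet_before (T : ℝ≥0∞) : MeasurableSet {t | Before T t} :=
  measurableSet_Ici.inter (measurableSet_lt ENNReal.measurable_ofReal measurable_const)

/-- Measurability in time is assumed on rectangles only; they form a π-system, which suffices for
finite measures. Extension by zero is needed because `μ` is arbitrary off `[0, T)`. -/
theorem IsProcess.exists_kernel {T : ℝ≥0∞} {μ : ℝ → Measure (Space d × E)}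
    (hμ : IsProcess T μ) : ∃ m : Kernel ℝ (Space d × E),
      (∀ t, m t univ < ∞) ∧ (∀ t, Before T t → m t = μ t) ∧ ∀ t, ¬ Before T t → m t = 0 := by
  have hfin : ∀ t : {t : ℝ // Before T t}, IsFiniteMeasure (μ t) := fun t => (hμ.1 t t.2).1
  have h1 : Measurable fun t : {t : ℝ // Before T t} => μ t := by
    refine Measurable.measure_of_isPiSystem generateFrom_prod.symm isPiSystem_prod ?_ ?_
    · rintro _ ⟨B, hB, A, hA, rfl⟩
      exact hμ.2 B A hB hA
    · rw [← univ_prod_univ]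
      exact hμ.2 _ _ MeasurableSet.univ MeasurableSet.univ
  have hemb := MeasurableEmbedding.subtype_coe (measurableSet_before T)
  have h2 := hemb.measurable_extend h1 (measurable_const (a := (0 : Measure (Space d × E))))
  have h3 : ∀ t, Before T t → Function.extend Subtype.val
      (fun t : {t : ℝ // Before T t} => μ t) (fun _ => 0) t = μ t := fun t ht =>
    Subtype.val_injective.extend_apply _ _ (⟨t, ht⟩ : {t : ℝ // Before T t})
  have h4 : ∀ t, ¬ Before T t → Function.extend Subtype.val
      (fun t : {t : ℝ // Before T t} => μ t) (fun _ => 0) t = 0 := fun t ht =>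
    Function.extend_apply' _ _ _ fun ⟨s, hs⟩ => ht (hs ▸ s.2)
  refine ⟨⟨_, h2⟩, fun t => ?_, h3, h4⟩
  by_cases ht : Before T t
  · change (Function.extend Subtype.val
      (fun t : {t : ℝ // Before T t} => μ t) (fun _ => 0) t) univ < ∞
    rw [h3 t ht]
    have := (hμ.1 t ht).1
    exact measure_lt_top _ _
  · change (Function.extend Subtype.val
      (fun t : {t : ℝ // Before T t} => μ t) (fun _ => 0) t) univ < ∞
    rw [h4 t ht]
    simp


/-- The Gaussian serves as a finite reference measure in place of Lebesgue measure when
Radon–Nikodym derivatives are taken jointly in time and space. -/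
theorem volume_absolutelyContinuous_stdGaussian :
    (volume : Measure (Space d)) ≪ stdGaussian (Space d) := by
  rw [← withDensity_heatKernel_one]
  refine withDensity_absolutelyContinuous' (by fun_prop) (Filter.Eventually.of_forall fun z => ?_)
  have : 0 < heatKernel 1 0 z := by
    unfold heatKernel
    positivity
  simpa using this

/-- Choosing a density separately for each time would lose measurability in time. The Radon–Nikodym
derivative and the disintegration are therefore taken for kernels, with time as parameter. -/
theorem IsProcess.exists_isDensityProcess [StandardBorelSpace E]
    {T : ℝ≥0∞}
    {μ : ℝ → Measure (Space d × E)} (hμ : IsProcess T μ) :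
    ∃ κ : Kernel (ℝ × Space d) E, (∀ p, κ p univ < ∞) ∧ IsDensityProcess T κ μ ∧
      ∀ t x, ¬ Before T t → κ (t, x) = 0 := by
  classical
  rcases isEmpty_or_nonempty E with hE | hE
  · refine ⟨0, by simp, fun t ht => ⟨by simp, fun B A _ _ => ?_⟩, by simp⟩
    rw [show A = ∅ from Subsingleton.elim _ _]
    simp
  obtain ⟨m, hmfin, hm, -⟩ := hμ.exists_kernel
  have := isSFiniteKernel_of_finite m hmfin
  have hmass : Measurable fun t => m t univ := m.measurable_coe MeasurableSet.univ
  -- The masses `m t univ` need not be bounded in `t`; this normalization gives a uniformly finite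
  -- kernel. The factor `1 + m t univ` is restored in `g₀`, together with the Gaussian density.
  set c : ℝ → Space d × E → ℝ≥0∞ := fun t _ => (1 + m t univ)⁻¹ with hc
  have hcm : Measurable (Function.uncurry c) :=
    (measurable_const.add (hmass.comp measurable_fst)).inv
  set m' := Kernel.withDensity m c with hm'
  have hm'_apply : ∀ t, m' t = (1 + m t univ)⁻¹ • m t := fun t => by
    rw [hm', Kernel.withDensity_apply _ hcm]
    exact withDensity_const _
  have hm'fin : IsFiniteKernel m' := ⟨⟨1, by simp, fun t => by
    rw [hm'_apply, Measure.smul_apply, smul_eq_mul, ← ENNReal.div_eq_inv_mul]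
    exact ENNReal.div_le_of_le_mul (by rw [one_mul]; exact le_add_self)⟩⟩
  set η : Kernel ℝ (Space d) := Kernel.const ℝ (stdGaussian (Space d)) with hη
  set ρ := Kernel.rnDeriv m'.fst η with hρ
  have hρm : Measurable fun p : ℝ × Space d => ρ p.1 p.2 := Kernel.measurable_rnDeriv _ _
  set g₀ : ℝ × Space d → ℝ≥0∞ := fun p =>
    ρ p.1 p.2 * ENNReal.ofReal (heatKernel 1 0 p.2) * (1 + m p.1 univ) with hg₀
  have hg₀m : Measurable g₀ := by fun_prop
  -- `toNNReal` sends the value `∞`, taken for `t < T` only on a null set of `x`, to `0`, so that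
  -- the density is finite at every point.
  set g : ℝ × Space d → E → ℝ≥0∞ := fun p _ =>
    if Before T p.1 then ((g₀ p).toNNReal : ℝ≥0∞) else 0 with hg
  have hgm : Measurable (Function.uncurry g) :=
    Measurable.ite ((measurable_fst.comp measurable_fst) (measurableSet_before T))
      (hg₀m.comp measurable_fst).ennreal_toNNReal.coe_nnreal_ennreal measurable_const
  refine ⟨Kernel.withDensity m'.condKernel g, fun p => ?_, fun t ht => ⟨fun x => ?_,
    fun B A hB hA => ?_⟩, fun t x ht => ?_⟩
  · rw [Kernel.withDensity_apply _ hgm, withDensity_apply _ MeasurableSet.univ]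
    simp only [hg]
    split_ifs <;> simp
  · rw [Kernel.comap_apply, Kernel.withDensity_apply _ hgm, withDensity_apply _ MeasurableSet.univ]
    simp only [hg]
    split_ifs <;> simp
  · have hfst : m'.fst t ≪ volume := by
      rw [Kernel.fst_apply, hm'_apply, Measure.map_smul, hm t ht]
      exact (hμ.1 t ht).2.smul_left _
    have hrn : m'.fst t = (volume : Measure (Space d)).withDensity
        fun x => ENNReal.ofReal (heatKernel 1 0 x) * ρ t x := by
      have h1 := Kernel.withDensity_rnDeriv_eq (κ := m'.fst) (η := η) (a := t)
        (hfst.trans volume_absolutelyContinuous_stdGaussian)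
      rw [Kernel.withDensity_apply _ (Kernel.measurable_rnDeriv _ _),
        show η t = _ from withDensity_heatKernel_one.symm, ← withDensity_mul _ (by fun_prop)
          (Kernel.measurable_rnDeriv_right _ _ _)] at h1
      exact h1.symm
    have hmt : m t = (1 + m t univ) • m' t := by
      rw [hm'_apply, smul_smul, ENNReal.mul_inv_cancel (by simp)
        (by simpa using (hmfin t).ne), one_smul]
    have hκA : Measurable fun x => m'.condKernel (t, x) A :=
      (m'.condKernel.measurable_coe hA).comp measurable_prodMk_left
    have hρt : Measurable fun x => ENNReal.ofReal (heatKernel 1 0 x) * ρ t x := by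
      have : Measurable fun x => ρ t x := hρm.comp measurable_prodMk_left
      fun_prop
    have hlt : ∀ᵐ x ∂(volume : Measure (Space d)), g₀ (t, x) < ∞ := by
      have h2 : ∫⁻ x, ENNReal.ofReal (heatKernel 1 0 x) * ρ t x < ∞ := by
        rw [← setLIntegral_univ, ← withDensity_apply _ MeasurableSet.univ, ← hrn]
        exact measure_lt_top _ _
      filter_upwards [ae_lt_top hρt h2.ne] with x hx
      rw [hg₀]
      simp only
      rw [mul_comm (ρ t x)]
      exact ENNReal.mul_lt_top hx (by simpa using hmfin t)
    rw [← hm t ht, hmt, Measure.smul_apply, smul_eq_mul]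
    conv_lhs => rw [← Kernel.disintegrate m' m'.condKernel]
    rw [Kernel.compProd_apply_prod hB hA, hrn, setLIntegral_withDensity_eq_setLIntegral_mul _ hρt
      hκA hB, ← lintegral_const_mul _ (hρt.mul hκA)]
    refine setLIntegral_congr_fun_ae hB (hlt.mono fun x hx _ => ?_)
    rw [Kernel.comap_apply, Kernel.withDensity_apply _ hgm, withDensity_apply _ hA]
    simp only [hg, if_pos ht, lintegral_const, Measure.restrict_apply_univ, Pi.mul_apply]
    rw [ENNReal.coe_toNNReal hx.ne, hg₀]
    ring
  · rw [Kernel.withDensity_apply _ hgm]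
    simp only [hg, if_neg ht]
    exact withDensity_zero

/-- A process, its gain terms and its loss terms as kernels in time, vanishing off `[0, T)`. -/
structure ProcessKernels (M : Model d E) (T : ℝ≥0∞) (μ : ℝ → Measure (Space d × E)) where
  m : Kernel ℝ (Space d × E)
  gain : Kernel ℝ (Space d × E)
  loss : Kernel ℝ (Space d × E)
  m_eq : ∀ t, Before T t → m t = μ t
  gain_eq : ∀ t, Before T t → gain t = Kplus M (μ t)
  loss_eq : ∀ t, Before T t → loss t = Kminus M (μ t)
  m_fin : ∀ t, m t univ < ∞
  gain_fin : ∀ t, gain t univ < ∞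
  loss_fin : ∀ t, loss t univ < ∞

/-- Time measurability of the gain and loss terms is read off from their formulas in a jointly
measurable density; their finiteness is the moment bound. -/
theorem IsProcess.nonempty_processKernels [StandardBorelSpace E]
    {M : Model d E} {T : ℝ≥0∞}
    {μ : ℝ → Measure (Space d × E)} (hμ : IsProcess T μ) (hMCD : MomentBound M T μ) :
    Nonempty (ProcessKernels M T μ) := by
  classical
  obtain ⟨m, hmfin, hm, -⟩ := hμ.exists_kernel
  obtain ⟨κ, hκfin, hκ, hκ0⟩ := hμ.exists_isDensityProcess
  have := isSFiniteKernel_of_finite κ hκfin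
  have := M.isSFiniteKernel_K
  have hB := measurableSet_before T
  have hgain : Measurable fun t => if Before T t then Kplus M (μ t) else 0 := by
    refine Measure.measurable_of_measurable_coe _ fun C hC => ?_
    have e : (fun t => (if Before T t then Kplus M (μ t) else 0 : Measure (Space d × E)) C) =
        fun t => 1 / 2 * ∫⁻ x, ∫⁻ y, ∫⁻ y', ∫⁻ z, C.indicator 1 (x, z)
          ∂(M.K (y, y')) ∂(κ (t, x)) ∂(κ (t, x)) := by
      ext t
      split_ifs with ht
      · rw [← lintegral_indicator_one hC,
          lintegral_Kplus M (hμ.1 t ht) (hκ t ht) (measurable_one.indicator hC)]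
        rfl
      · simp [hκ0 t _ ht]
    rw [e]
    have h4 : Measurable fun p : (((ℝ × Space d) × E) × E) × E =>
        C.indicator (1 : Space d × E → ℝ≥0∞) (p.1.1.1.2, p.2) :=
      (measurable_one.indicator hC).comp (by fun_prop)
    have h3 : Measurable fun p : ((ℝ × Space d) × E) × E => ∫⁻ z,
        C.indicator (1 : Space d × E → ℝ≥0∞) (p.1.1.2, z) ∂(M.K (p.1.2, p.2)) :=
      Measurable.lintegral_kernel_prod_right' (κ := M.K.comap
        (fun p : ((ℝ × Space d) × E) × E => (p.1.2, p.2)) (by fun_prop)) h4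
    have h2 : Measurable fun p : (ℝ × Space d) × E => ∫⁻ y', ∫⁻ z,
        C.indicator (1 : Space d × E → ℝ≥0∞) (p.1.2, z) ∂(M.K (p.2, y')) ∂(κ p.1) :=
      Measurable.lintegral_kernel_prod_right' (κ := κ.comap
        (fun p : (ℝ × Space d) × E => p.1) (by fun_prop)) h3
    have h1 : Measurable fun p : ℝ × Space d => ∫⁻ y, ∫⁻ y', ∫⁻ z,
        C.indicator (1 : Space d × E → ℝ≥0∞) (p.2, z) ∂(M.K (y, y')) ∂(κ p) ∂(κ p) :=
      Measurable.lintegral_kernel_prod_right' h2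
    exact h1.lintegral_prod_right'.const_mul _
  have hloss : Measurable fun t => if Before T t then Kminus M (μ t) else 0 := by
    refine Measure.measurable_of_measurable_coe _ fun C hC => ?_
    have e : (fun t => (if Before T t then Kminus M (μ t) else 0 : Measure (Space d × E)) C) =
        fun t => ∫⁻ x, ∫⁻ y, C.indicator 1 (x, y) * (∫⁻ y', M.K (y, y') univ
          ∂(κ (t, x))) ∂(κ (t, x)) := by
      ext t
      split_ifs with ht
      · rw [← lintegral_indicator_one hC,
          lintegral_Kminus M (hμ.1 t ht) (hκ t ht) (measurable_one.indicator hC)]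
        rfl
      · simp [hκ0 t _ ht]
    rw [e]
    have h2 : Measurable fun p : (ℝ × Space d) × E => C.indicator 1 (p.1.2, p.2) *
        ∫⁻ y', M.K (p.2, y') univ ∂(κ p.1) :=
      ((measurable_one.indicator hC).comp (by fun_prop)).mul (measurable_lintegral_K_univ M κ)
    have h1 : Measurable fun p : ℝ × Space d => ∫⁻ y, C.indicator 1 (p.2, y) *
        (∫⁻ y', M.K (y, y') univ ∂(κ p)) ∂(κ p) :=
      Measurable.lintegral_kernel_prod_right' h2
    exact h1.lintegral_prod_right'
  refine ⟨⟨m, ⟨_, hgain⟩, ⟨_, hloss⟩, hm, fun t ht => if_pos ht, fun t ht => if_pos ht, hmfin,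
    fun t => ?_, fun t => ?_⟩⟩
  · change (if Before T t then Kplus M (μ t) else 0 : Measure (Space d × E)) univ < ∞
    split_ifs with ht
    · obtain ⟨C, hC⟩ := hMCD.exists_momentLE hμ ht
      exact ((hC t ⟨ht.1, le_rfl⟩).Kplus_univ_le).trans_lt (by simp [ENNReal.mul_lt_top])
    · simp
  · change (if Before T t then Kminus M (μ t) else 0 : Measure (Space d × E)) univ < ∞
    split_ifs with ht
    · obtain ⟨C, hC⟩ := hMCD.exists_momentLE hμ ht
      exact ((hC t ⟨ht.1, le_rfl⟩).Kminus_univ_le).trans_lt (by simp [ENNReal.mul_lt_top])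
    · simp


theorem Before.mono {T : ℝ≥0∞} {s t : ℝ} (ht : Before T t) (hs : 0 ≤ s) (hst : s ≤ t) :
    Before T s := ⟨hs, (ENNReal.ofReal_le_ofReal hst).trans_lt ht.2⟩

/-! ### The mild equation as an identity of measures -/

theorem measurable_heatFlow (M : Model d E) (ν : Kernel ℝ (Space d × E)) [IsSFiniteKernel ν]
    {τ : ℝ → ℝ} (hτ : Measurable τ) : Measurable fun r => heatFlow M (τ r) (ν r) := by
  have ha := M.measurable_a
  refine Measure.measurable_of_measurable_coe _ fun C hC => ?_
  have hind : Measurable (C.indicator (1 : Space d × E → ℝ≥0∞)) := measurable_one.indicator hC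
  have e : (fun r => heatFlow M (τ r) (ν r) C) = fun r => ∫⁻ q, (∫⁻ x',
      ENNReal.ofReal (heatKernel (M.a q.2 * τ r) q.1 x') * C.indicator 1 (x', q.2)) ∂(ν r) := by
    ext r
    rw [← lintegral_indicator_one hC, lintegral_heatFlow M _ _ hind]
  rw [e]
  refine Measurable.lintegral_kernel_prod_right' (f := fun p : ℝ × Space d × E => ∫⁻ x',
      ENNReal.ofReal (heatKernel (M.a p.2.2 * τ p.1) p.2.1 x') * C.indicator 1 (x', p.2.2)) ?_
  refine Measurable.lintegral_prod_right' (f := fun p : (ℝ × Space d × E) × Space d =>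
    ENNReal.ofReal (heatKernel (M.a p.1.2.2 * τ p.1.1) p.1.2.1 p.2) *
      C.indicator 1 (p.2, p.1.2.2)) ?_
  have := hind.comp (f := fun p : (ℝ × Space d × E) × Space d => (p.2, p.1.2.2)) (by fun_prop)
  exact Measurable.mul (by fun_prop) this

/-- The measure `∫₀ᵗ P_{t-s} ν_s ds`. -/
noncomputable def duhamel (M : Model d E) (ν : Kernel ℝ (Space d × E)) (t : ℝ) :
    Measure (Space d × E) :=
  (volume.restrict (Ioo 0 t)).bind fun s => heatFlow M (t - s) (ν s)

theorem lintegral_duhamel (M : Model d E) (ν : Kernel ℝ (Space d × E)) [IsSFiniteKernel ν] (t : ℝ)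
    {F : Space d × E → ℝ≥0∞} (hF : Measurable F) :
    ∫⁻ q, F q ∂(duhamel M ν t) = ∫⁻ s in Ioo 0 t, ∫⁻ q, F q ∂(heatFlow M (t - s) (ν s)) :=
  Measure.lintegral_bind (measurable_heatFlow M ν (by fun_prop)).aemeasurable hF.aemeasurable

theorem duhamel_apply (M : Model d E) (ν : Kernel ℝ (Space d × E)) [IsSFiniteKernel ν] (t : ℝ)
    {C : Set (Space d × E)} (hC : MeasurableSet C) :
    duhamel M ν t C = ∫⁻ s in Ioo 0 t, heatFlow M (t - s) (ν s) C :=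
  Measure.bind_apply hC (measurable_heatFlow M ν (by fun_prop)).aemeasurable

section
variable {M : Model d E} {T : ℝ≥0∞} {μ : ℝ → Measure (Space d × E)}

theorem ProcessKernels.isSFiniteKernel_m (k : ProcessKernels M T μ) : IsSFiniteKernel k.m :=
  isSFiniteKernel_of_finite _ k.m_fin

theorem ProcessKernels.isSFiniteKernel_gain (k : ProcessKernels M T μ) :
    IsSFiniteKernel k.gain :=
  isSFiniteKernel_of_finite _ k.gain_fin

theorem ProcessKernels.isSFiniteKernel_loss (k : ProcessKernels M T μ) :
    IsSFiniteKernel k.loss :=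
  isSFiniteKernel_of_finite _ k.loss_fin

/-- The setwise equation becomes an equality of measures, which can be integrated against functions.
-/
theorem ProcessKernels.mildEquation_iff (k : ProcessKernels M T μ) :
    MildEquation M T μ ↔ ∀ t, 0 < t → Before T t →
      k.m t + duhamel M k.loss t = heatFlow M t (k.m 0) + duhamel M k.gain t := by
  have := k.isSFiniteKernel_gain
  have := k.isSFiniteKernel_loss
  unfold MildEquation
  refine forall_congr' fun t => forall_congr' fun ht0 => forall_congr' fun ht => ?_
  have h0 : Before T 0 := ht.mono le_rfl ht0.le
  have hg : ∀ C, ∫⁻ s in Ioo 0 t, heatFlow M (t - s) (k.gain s) C =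
      ∫⁻ s in Ioo 0 t, heatFlow M (t - s) (Kplus M (μ s)) C := fun C =>
    setLIntegral_congr_fun measurableSet_Ioo fun s hs => by
      simp only [k.gain_eq s (ht.mono hs.1.le hs.2.le)]
  have hl : ∀ C, ∫⁻ s in Ioo 0 t, heatFlow M (t - s) (k.loss s) C =
      ∫⁻ s in Ioo 0 t, heatFlow M (t - s) (Kminus M (μ s)) C := fun C =>
    setLIntegral_congr_fun measurableSet_Ioo fun s hs => by
      simp only [k.loss_eq s (ht.mono hs.1.le hs.2.le)]
  rw [k.m_eq t ht, k.m_eq 0 h0]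
  constructor
  · intro h
    ext C hC
    rw [Measure.add_apply, Measure.add_apply, duhamel_apply M _ t hC, duhamel_apply M _ t hC,
      hg, hl]
    exact h C hC
  · intro h C hC
    have h1 := congrArg (fun ν : Measure (Space d × E) => ν C) h
    rw [Measure.add_apply, Measure.add_apply, duhamel_apply M _ t hC, duhamel_apply M _ t hC,
      hg, hl] at h1
    exact h1
end

/-! ### Subadditive weights -/

/-- The factor `a^{d/2}` cancels the `a` in the prefactor of the kernel. What is left depends on `a`
through the exponent only, hence is increasing in `a` and bounded uniformly in it; this is why the
weights contain `a^{d/2}`. -/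
theorem rpow_mul_heatKernel {a τ : ℝ} (ha : 0 < a) (hτ : 0 < τ) (x x' : Space d) :
    a ^ ((d : ℝ) / 2) * heatKernel (a * τ) x x' =
      (2 * Real.pi * τ) ^ (-((d : ℝ) / 2)) * Real.exp (-(‖x - x'‖ ^ 2 / (2 * τ) / a)) := by
  unfold heatKernel
  rw [show 2 * Real.pi * (a * τ) = a * (2 * Real.pi * τ) by ring,
    Real.mul_rpow ha.le (by positivity), ← mul_assoc, ← mul_assoc, ← Real.rpow_add ha]
  simp only [add_neg_cancel, Real.rpow_zero, one_mul]
  congr 2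
  field_simp

theorem rpow_mul_heatKernel_mono {a b τ : ℝ} (ha : 0 < a) (hab : a ≤ b) (hτ : 0 < τ)
    (x x' : Space d) : a ^ ((d : ℝ) / 2) * heatKernel (a * τ) x x' ≤
      b ^ ((d : ℝ) / 2) * heatKernel (b * τ) x x' := by
  rw [rpow_mul_heatKernel ha hτ, rpow_mul_heatKernel (ha.trans_le hab) hτ]
  gcongr

theorem rpow_mul_heatKernel_le {a τ : ℝ} (ha : 0 < a) (hτ : 0 < τ) (x x' : Space d) :
    a ^ ((d : ℝ) / 2) * heatKernel (a * τ) x x' ≤ (2 * Real.pi * τ) ^ (-((d : ℝ) / 2)) := by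
  rw [rpow_mul_heatKernel ha hτ]
  refine mul_le_of_le_one_right (by positivity) (Real.exp_le_one_iff.2 ?_)
  rw [neg_nonpos]
  positivity

/-- `g` is subadditive under coagulation. -/
def Model.Subadditive (M : Model d E) (g : E → ℝ≥0∞) : Prop :=
  ∀ y y', ∀ᵐ z ∂(M.K (y, y')), g z ≤ g y + g y'

/-- The weight `g(y) a(y)^{d/2}`. -/
noncomputable def Model.heatWeight (M : Model d E) (g : E → ℝ≥0∞) (y : E) : ℝ≥0∞ :=
  g y * ENNReal.ofReal (M.a y ^ ((d : ℝ) / 2))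

theorem Model.measurable_heatWeight (M : Model d E) {g : E → ℝ≥0∞} (hg : Measurable g) :
    Measurable (M.heatWeight g) := by
  have := M.measurable_a
  unfold Model.heatWeight
  fun_prop

theorem Model.heatWeight_mul (M : Model d E) (g : E → ℝ≥0∞) (y : E) (τ : ℝ) (x x' : Space d) :
    M.heatWeight g y * ENNReal.ofReal (heatKernel (M.a y * τ) x x') =
      g y * ENNReal.ofReal (M.a y ^ ((d : ℝ) / 2) * heatKernel (M.a y * τ) x x') := by
  rw [Model.heatWeight, mul_assoc, ENNReal.ofReal_mul (Real.rpow_nonneg (M.a_pos y).le _)]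

theorem Model.heatWeight_mul_le (M : Model d E) (g : E → ℝ≥0∞) (y : E) {τ : ℝ} (hτ : 0 < τ)
    (x x' : Space d) : M.heatWeight g y * ENNReal.ofReal (heatKernel (M.a y * τ) x x') ≤
      g y * ENNReal.ofReal ((2 * Real.pi * τ) ^ (-((d : ℝ) / 2))) := by
  rw [M.heatWeight_mul]
  gcongr
  exact rpow_mul_heatKernel_le (M.a_pos y) hτ x x'

/-- Multiplication by `a^{d/2} p(aτ, x₀, ·)` preserves subadditivity: it increases with `a`, and the
merged particle diffuses no faster than either parent. For the second parent this uses the symmetry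
of `K`. -/
theorem Model.Subadditive.lintegral_gain_le [StandardBorelSpace E]
    {M : Model d E}
    {g : E → ℝ≥0∞} (hg : M.Subadditive g) (hgm : Measurable g) {μ : Measure (Space d × E)}
    (hμ : MemM μ) {τ : ℝ} (hτ : 0 < τ) (x₀ : Space d) :
    ∫⁻ q, M.heatWeight g q.2 * ENNReal.ofReal (heatKernel (M.a q.2 * τ) x₀ q.1) ∂(Kplus M μ) ≤
    ∫⁻ q, M.heatWeight g q.2 * ENNReal.ofReal (heatKernel (M.a q.2 * τ) x₀ q.1)
      ∂(Kminus M μ) := by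
  have ha := M.measurable_a
  have hw := M.measurable_heatWeight hgm
  refine lintegral_Kplus_le M hμ (by fun_prop) fun x y y' => ?_
  filter_upwards [hg y y', M.a_K_decreasing y y',
    (M.K_symm y y' ▸ M.a_K_decreasing y' y : ∀ᵐ z ∂(M.K (y, y')), M.a z ≤ M.a y')]
    with z h1 h2 h3
  simp only [M.heatWeight_mul]
  refine (mul_le_mul_left h1 _).trans ?_
  rw [add_mul]
  exact add_le_add
    (mul_le_mul_right (ENNReal.ofReal_le_ofReal
      (rpow_mul_heatKernel_mono (M.a_pos z) h2 hτ _ _)) _)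
    (mul_le_mul_right (ENNReal.ofReal_le_ofReal
      (rpow_mul_heatKernel_mono (M.a_pos z) h3 hτ _ _)) _)

/-- The growth condition gives `r φ(r+s) ≤ (r+s) φ(r)` and `s φ(r+s) ≤ (r+s) φ(s)`. Add the two and
divide by `r + s`. -/
theorem Model.φ_subadditive (M : Model d E) {r s : ℝ} (hr : 0 < r) (hs : 0 < s) :
    M.φ (r + s) ≤ M.φ r + M.φ s := by
  have h1 := M.φ_sublinear ((r + s) / r) r (by rw [le_div_iff₀ hr]; linarith) hr
  have h2 := M.φ_sublinear ((r + s) / s) s (by rw [le_div_iff₀ hs]; linarith) hs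
  rw [div_mul_cancel₀ _ hr.ne', div_mul_eq_mul_div, le_div_iff₀ hr] at h1
  rw [div_mul_cancel₀ _ hs.ne', div_mul_eq_mul_div, le_div_iff₀ hs] at h2
  have h3 : 0 < r + s := by positivity
  nlinarith

/-- If the merged mass is at most `R`, so are both parent masses and equality holds; otherwise the
left side is zero. -/
theorem Model.subadditive_truncMass (M : Model d E) (R : ℝ) :
    M.Subadditive fun y => ENNReal.ofReal ((Iic R).indicator (fun r => r) (M.m y)) := by
  intro y y'
  filter_upwards [M.K_mass y y'] with z hz
  have h1 := M.m_pos y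
  have h2 := M.m_pos y'
  rw [hz]
  by_cases h : M.m y + M.m y' ≤ R
  · rw [indicator_of_mem (mem_Iic.2 h), indicator_of_mem (mem_Iic.2 (by linarith)),
      indicator_of_mem (mem_Iic.2 (by linarith)), ENNReal.ofReal_add h1.le h2.le]
  · rw [indicator_of_notMem (by simpa using h)]
    simp

/-- The truncated weight `(a ∧ n)^{d/2} (φ(m) ∧ n)`. -/
noncomputable def Model.truncWeight (M : Model d E) (n : ℕ) (y : E) : ℝ≥0∞ :=
  ENNReal.ofReal (min (M.a y) n ^ ((d : ℝ) / 2) * min (M.φ (M.m y)) n)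

theorem Model.measurable_truncWeight (M : Model d E) (n : ℕ) : Measurable (M.truncWeight n) := by
  have := M.measurable_a
  have := M.measurable_φ_m
  unfold Model.truncWeight
  fun_prop

theorem Model.truncWeight_le_nat (M : Model d E) (n : ℕ) (y : E) :
    M.truncWeight n y ≤ ENNReal.ofReal ((n : ℝ) ^ ((d : ℝ) / 2) * n) := by
  have ha := M.a_pos y
  have hφ := M.φ_pos _ (M.m_pos y)
  unfold Model.truncWeight
  gcongr
  · exact min_le_right _ _
  · exact min_le_right _ _

theorem Model.truncWeight_le (M : Model d E) (n : ℕ) (y : E) :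
    M.truncWeight n y ≤ ENNReal.ofReal (M.w y) := by
  have ha := M.a_pos y
  have hφ := M.φ_pos _ (M.m_pos y)
  unfold Model.truncWeight Model.w weight
  gcongr
  · exact min_le_left _ _
  · exact min_le_left _ _

theorem Model.truncWeight_eventually_eq (M : Model d E) (y : E) :
    ∀ᶠ n in Filter.atTop, M.truncWeight n y = ENNReal.ofReal (M.w y) := by
  obtain ⟨n₀, hn₀⟩ := exists_nat_ge (max (M.a y) (M.φ (M.m y)))
  filter_upwards [Filter.eventually_ge_atTop n₀] with n hn
  have h : max (M.a y) (M.φ (M.m y)) ≤ n := hn₀.trans (by exact_mod_cast hn)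
  rw [Model.truncWeight, min_eq_left ((le_max_left _ _).trans h),
    min_eq_left ((le_max_right _ _).trans h)]
  rfl

/-- `min (·) n` preserves subadditivity of nonnegative functions, and `(a ∧ n)^{d/2}` does not
increase under coagulation. The truncation gives a bounded weight, for which the loss term is finite
and can be cancelled. -/
theorem Model.subadditive_truncWeight (M : Model d E) (n : ℕ) :
    M.Subadditive (M.truncWeight n) := by
  intro y y'
  filter_upwards [M.K_mass y y', M.a_K_decreasing y y',
    (M.K_symm y y' ▸ M.a_K_decreasing y' y : ∀ᵐ z ∂(M.K (y, y')), M.a z ≤ M.a y')]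
    with z hz h2 h3
  have hφ := M.φ_subadditive (M.m_pos y) (M.m_pos y')
  rw [← hz] at hφ
  have p1 := M.φ_pos _ (M.m_pos y)
  have p2 := M.φ_pos _ (M.m_pos y')
  have p3 := M.φ_pos _ (M.m_pos z)
  have hn : (0 : ℝ) ≤ n := n.cast_nonneg
  have hmin : min (M.φ (M.m z)) (n : ℝ) ≤ min (M.φ (M.m y)) n + min (M.φ (M.m y')) n := by
    rcases min_cases (M.φ (M.m y)) (n : ℝ) with h | h <;>
    rcases min_cases (M.φ (M.m y')) (n : ℝ) with h' | h' <;>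
    rcases min_cases (M.φ (M.m z)) (n : ℝ) with h'' | h'' <;> linarith
  have ha := M.a_pos z
  have m1 : 0 ≤ min (M.φ (M.m y)) (n : ℝ) := le_min p1.le hn
  have m2 : 0 ≤ min (M.φ (M.m y')) (n : ℝ) := le_min p2.le hn
  have m0 : 0 ≤ min (M.a z) (n : ℝ) := le_min ha.le hn
  have m3 : 0 ≤ min (M.a y) (n : ℝ) := le_min (M.a_pos y).le hn
  have m4 : 0 ≤ min (M.a y') (n : ℝ) := le_min (M.a_pos y').le hn
  unfold Model.truncWeight
  rw [← ENNReal.ofReal_add (by positivity) (by positivity)]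
  refine ENNReal.ofReal_le_ofReal ((mul_le_mul_of_nonneg_left hmin (by positivity)).trans ?_)
  rw [mul_add]
  gcongr

/-! ### The gain bound -/

section
variable [StandardBorelSpace E] {M : Model d E} {T : ℝ≥0∞} {μ : ℝ → Measure (Space d × E)}

/-- Along solutions of the mild equation, `s ↦ ∫ h(y) P_{t-s}μ_s(x₀, dy)` is dominated by its
initial value, for bounded subadditive `g` and `h = g a^{d/2}`. -/
theorem MildEquation.lintegral_heatWeight_le (hE : MildEquation M T μ) (hμ : IsProcess T μ)
    (hMCD : MomentBound M T μ) {g : E → ℝ≥0∞} (hg : M.Subadditive g) (hgm : Measurable g)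
    {N : ℝ≥0∞} (hN : N ≠ ∞) (hgN : ∀ y, g y ≤ N) {s t : ℝ} (hs : 0 < s) (hst : s < t)
    (hsT : Before T s) (x₀ : Space d) :
    ∫⁻ q, M.heatWeight g q.2 * ENNReal.ofReal (heatKernel (M.a q.2 * (t - s)) x₀ q.1) ∂(μ s) ≤
    ∫⁻ q, M.heatWeight g q.2 * ENNReal.ofReal (heatKernel (M.a q.2 * t) x₀ q.1) ∂(μ 0) := by
  obtain ⟨k⟩ := hμ.nonempty_processKernels hMCD
  have := k.isSFiniteKernel_gain
  have := k.isSFiniteKernel_loss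
  have := k.isSFiniteKernel_m
  obtain ⟨C, hC⟩ := hMCD.exists_momentLE hμ hsT
  have h0 : Before T 0 := hsT.mono le_rfl hs.le
  have ha := M.measurable_a
  have hw := M.measurable_heatWeight hgm
  have hFm : ∀ τ, Measurable fun q : Space d × E =>
    M.heatWeight g q.2 * ENNReal.ofReal (heatKernel (M.a q.2 * τ) x₀ q.1) := fun τ => by fun_prop
  -- The equation at time `s` is tested with the kernel of duration `t - s`; by the semigroup
  -- property a source at time `r` is then seen through the kernel of duration `t - r`.
  have h1 := congrArg (fun ν : Measure (Space d × E) => ∫⁻ q,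
    M.heatWeight g q.2 * ENNReal.ofReal (heatKernel (M.a q.2 * (t - s)) x₀ q.1) ∂ν)
    (k.mildEquation_iff.1 hE s hs hsT)
  rw [lintegral_add_measure, lintegral_add_measure, lintegral_duhamel M _ _ (hFm _),
    lintegral_duhamel M _ _ (hFm _), lintegral_heatKernel_heatFlow M (sub_pos.2 hst) hs _ hw,
    k.m_eq s hsT, k.m_eq 0 h0] at h1
  have hflow : ∀ ν : Kernel ℝ (Space d × E), IsSFiniteKernel ν → ∫⁻ r in Ioo 0 s, ∫⁻ q,
      M.heatWeight g q.2 * ENNReal.ofReal (heatKernel (M.a q.2 * (t - s)) x₀ q.1)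
        ∂(heatFlow M (s - r) (ν r)) = ∫⁻ r in Ioo 0 s, ∫⁻ q,
      M.heatWeight g q.2 * ENNReal.ofReal (heatKernel (M.a q.2 * (t - r)) x₀ q.1) ∂(ν r) :=
    fun ν _ => setLIntegral_congr_fun measurableSet_Ioo fun r hr => by
      rw [lintegral_heatKernel_heatFlow M (sub_pos.2 hst) (sub_pos.2 hr.2) _ hw]
      simp
  rw [hflow _ inferInstance, hflow _ inferInstance, sub_add_cancel] at h1
  set L := ∫⁻ r in Ioo 0 s, ∫⁻ q, M.heatWeight g q.2 *
    ENNReal.ofReal (heatKernel (M.a q.2 * (t - r)) x₀ q.1) ∂(k.loss r) with hL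
  have hle : ∫⁻ r in Ioo 0 s, ∫⁻ q, M.heatWeight g q.2 *
      ENNReal.ofReal (heatKernel (M.a q.2 * (t - r)) x₀ q.1) ∂(k.gain r) ≤ L := by
    refine setLIntegral_mono' measurableSet_Ioo fun r hr => ?_
    have hr' : Before T r := hsT.mono hr.1.le hr.2.le
    rw [k.gain_eq r hr', k.loss_eq r hr']
    exact hg.lintegral_gain_le hgm (hμ.1 r hr') (by linarith [hr.2]) x₀
  -- Since `r < s < t`, the weighted kernel of duration `t - r` is at most `(2π(t-s))^{-d/2}`. With
  -- `g` bounded and loss terms of finite mass, `L` is finite and can be subtracted.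
  have hfin : L ≠ ∞ := by
    have hb : L ≤ ∫⁻ r in Ioo 0 s, N *
        ENNReal.ofReal ((2 * Real.pi * (t - s)) ^ (-((d : ℝ) / 2))) * (C * C) := by
      refine setLIntegral_mono' measurableSet_Ioo fun r hr => ?_
      have hr' : Before T r := hsT.mono hr.1.le hr.2.le
      have hts : 0 < t - s := sub_pos.2 hst
      rw [k.loss_eq r hr']
      refine le_trans ?_ (mul_le_mul_right (hC r ⟨hr.1.le, hr.2.le⟩).Kminus_univ_le _)
      rw [← lintegral_const]
      have hle : (2 * Real.pi * (t - r)) ^ (-((d : ℝ) / 2)) ≤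
          (2 * Real.pi * (t - s)) ^ (-((d : ℝ) / 2)) := by
        refine Real.rpow_le_rpow_of_nonpos (by positivity) ?_ (neg_nonpos.2 (by positivity))
        have := hr.2.le
        gcongr
      exact lintegral_mono fun q => (M.heatWeight_mul_le g q.2 (by linarith [hr.2]) _ _).trans
        (mul_le_mul' (hgN _) (ENNReal.ofReal_le_ofReal hle))
    refine (hb.trans_lt ?_).ne
    rw [lintegral_const, Measure.restrict_apply_univ, Real.volume_Ioo]
    exact ENNReal.mul_lt_top (ENNReal.mul_lt_top (ENNReal.mul_lt_top hN.lt_top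
      ENNReal.ofReal_lt_top) (by simp [ENNReal.mul_lt_top])) ENNReal.ofReal_lt_top
  refine (ENNReal.add_le_add_iff_right hfin).1 ?_
  rw [h1]
  gcongr

/-- The integrand is in fact bounded by a constant uniform in `s` and in the point `x₀`, so the
bound holds everywhere. -/
theorem MildEquation.gainBound (hE : MildEquation M T μ) (hμ : IsProcess T μ)
    (hMCD : MomentBound M T μ) : GainBound M T μ := by
  intro R t hR ht
  refine Filter.Eventually.of_forall fun x₀ => ?_
  have ha := M.measurable_a
  have hm := M.measurable_m
  have hw := M.measurable_w
  obtain ⟨C, hC⟩ := hMCD.exists_momentLE hμ ht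
  set c := ENNReal.ofReal ((2 * Real.pi * t) ^ (-((d : ℝ) / 2))) with hc
  -- Domination by the initial value is proved for truncated weights and passes to `w` by Fatou. At
  -- time zero `∫ w dμ_0 ≤ C` is already part of the moment bound, so (I) plays no role.
  have hfull : ∀ s ∈ Ioo 0 t, ∫⁻ q, ENNReal.ofReal (M.w q.2) *
      ENNReal.ofReal (M.a q.2 ^ ((d : ℝ) / 2) * heatKernel (M.a q.2 * (t - s)) x₀ q.1) ∂(μ s) ≤
        C * c := by
    intro s hs
    have htr : ∀ n, ∫⁻ q, M.heatWeight (M.truncWeight n) q.2 *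
        ENNReal.ofReal (heatKernel (M.a q.2 * (t - s)) x₀ q.1) ∂(μ s) ≤ C * c := by
      intro n
      refine (hE.lintegral_heatWeight_le hμ hMCD (M.subadditive_truncWeight n)
        (M.measurable_truncWeight n) ENNReal.ofReal_ne_top (M.truncWeight_le_nat n) hs.1 hs.2
        (ht.mono hs.1.le hs.2.le) x₀).trans ?_
      refine le_trans ?_ (mul_le_mul_left (hC 0 ⟨le_rfl, ht.1⟩).l1 c)
      rw [← lintegral_mul_const _ (by fun_prop)]
      refine lintegral_mono fun q =>
        (M.heatWeight_mul_le _ q.2 (hs.1.trans hs.2) _ _).trans ?_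
      gcongr
      exact M.truncWeight_le n q.2
    have hmeas : ∀ n, Measurable fun q : Space d × E => M.heatWeight (M.truncWeight n) q.2 *
        ENNReal.ofReal (heatKernel (M.a q.2 * (t - s)) x₀ q.1) := fun n => by
      have := M.measurable_heatWeight (M.measurable_truncWeight n)
      fun_prop
    refine le_trans (lintegral_mono fun q => ?_) ((lintegral_liminf_le (u := Filter.atTop) hmeas).trans
      (Filter.liminf_le_of_frequently_le' (Filter.Frequently.of_forall htr)))
    refine le_of_eq (Filter.Tendsto.liminf_eq ?_).symm
    refine tendsto_const_nhds.congr' ?_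
    filter_upwards [M.truncWeight_eventually_eq q.2] with n hn
    rw [M.heatWeight_mul, hn]
  have hbound : ∀ s ∈ Ioo 0 t, heatPairing M (M.wTrunc R) (t - s) (Kplus M (μ s)) x₀ ≤
      C * (ENNReal.ofReal R * (C * c)) := by
    intro s hs
    have hs' : Before T s := ht.mono hs.1.le hs.2.le
    have hgm : Measurable fun y =>
        ENNReal.ofReal ((Iic R).indicator (fun r => r) (M.m y)) :=
      ((measurable_id.indicator measurableSet_Iic).comp hm).ennreal_ofReal
    set g : E → ℝ≥0∞ := fun y => ENNReal.ofReal ((Iic R).indicator (fun r => r) (M.m y)) with hg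
    have hwm := M.measurable_heatWeight hgm
    have e : heatPairing M (M.wTrunc R) (t - s) (Kplus M (μ s)) x₀ = ∫⁻ q, M.heatWeight g q.2 *
        ENNReal.ofReal (heatKernel (M.a q.2 * (t - s)) x₀ q.1) ∂(Kplus M (μ s)) := by
      unfold heatPairing
      refine lintegral_congr fun q => ?_
      have hi : 0 ≤ (Iic R).indicator (fun r => r) (M.m q.2) :=
        indicator_apply_nonneg fun _ => (M.m_pos _).le
      rw [M.heatWeight_mul, hg, ← ENNReal.ofReal_mul hi]
      congr 1
      unfold Model.wTrunc weight
      ring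
    rw [e]
    -- Gain is dominated by loss, and loss by `C` times an integral carrying an extra factor `w`.
    -- Bounding the truncated mass by `R` leaves exactly the integral in `hfull`.
    refine (M.subadditive_truncMass R).lintegral_gain_le hgm (hμ.1 s hs') (sub_pos.2 hs.2) x₀
      |>.trans (((hC s ⟨hs.1.le, hs.2.le⟩).lintegral_Kminus_le (by fun_prop)).trans ?_)
    gcongr
    refine le_trans ?_ (mul_le_mul_right (hfull s hs) _)
    rw [← lintegral_const_mul _ (by fun_prop)]
    refine lintegral_mono fun q => ?_
    rw [M.heatWeight_mul]
    have hgR : g q.2 ≤ ENNReal.ofReal R := by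
      refine ENNReal.ofReal_le_ofReal ?_
      by_cases h : M.m q.2 ≤ R
      · rwa [indicator_of_mem (mem_Iic.2 h)]
      · rw [indicator_of_notMem (by simpa using h)]
        exact hR.le
    calc g q.2 * ENNReal.ofReal (M.a q.2 ^ ((d : ℝ) / 2) * heatKernel (M.a q.2 * (t - s)) x₀ q.1) *
          ENNReal.ofReal (M.w q.2)
        = g q.2 * (ENNReal.ofReal (M.w q.2) * ENNReal.ofReal (M.a q.2 ^ ((d : ℝ) / 2) *
            heatKernel (M.a q.2 * (t - s)) x₀ q.1)) := by ring
      _ ≤ _ := by gcongr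
  refine (setLIntegral_mono' measurableSet_Ioo hbound).trans_lt ?_
  rw [setLIntegral_const, Real.volume_Ioo]
  exact ENNReal.mul_lt_top (ENNReal.mul_lt_top ENNReal.coe_lt_top (ENNReal.mul_lt_top
    ENNReal.ofReal_lt_top (ENNReal.mul_lt_top ENNReal.coe_lt_top ENNReal.ofReal_lt_top)))
    ENNReal.ofReal_lt_top

end


/-! ### Space-time measures -/

/-- The measure `1_{(0,t)}(s) ds ν_s(dq)`. -/
noncomputable def spaceTime (ν : Kernel ℝ (Space d × E)) (t : ℝ) :
    Measure (ℝ × Space d × E) :=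
  (volume.restrict (Ioo 0 t)).compProd ν

section
variable {ν : Kernel ℝ (Space d × E)} [IsSFiniteKernel ν]

theorem isFiniteMeasure_spaceTime {t : ℝ} {C : ℝ≥0∞} (hC : C ≠ ∞)
    (hν : ∀ s ∈ Ioo 0 t, ν s univ ≤ C) : IsFiniteMeasure (spaceTime ν t) := by
  refine ⟨?_⟩
  rw [spaceTime, Measure.compProd_apply MeasurableSet.univ]
  simp only [preimage_univ]
  refine (setLIntegral_mono' measurableSet_Ioo hν).trans_lt ?_
  rw [setLIntegral_const, Real.volume_Ioo]
  exact ENNReal.mul_lt_top hC.lt_top ENNReal.ofReal_lt_top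

/-- All shorter time spans sit inside one finite measure, so integration over the triangle `0 < s <
r < t` becomes Fubini on a product with an indicator. -/
theorem spaceTime_eq_restrict {r t : ℝ} (hrt : r ≤ t) :
    spaceTime ν r = (spaceTime ν t).restrict {p | p.1 < r} := by
  have hm : MeasurableSet {p : ℝ × Space d × E | p.1 < r} :=
    measurableSet_lt measurable_fst measurable_const
  ext C hC
  rw [Measure.restrict_apply hC, spaceTime, spaceTime, Measure.compProd_apply hC,
    Measure.compProd_apply (hC.inter hm)]
  have e : Ioo 0 r = Ioo 0 t ∩ Iio r := by
    rw [Ioo_inter_Iio, min_eq_right hrt]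
  rw [e, inter_comm, ← Measure.restrict_restrict measurableSet_Iio,
    ← lintegral_indicator measurableSet_Iio]
  refine lintegral_congr fun s => ?_
  by_cases hs : s < r
  · rw [indicator_of_mem (mem_Iio.2 hs)]
    congr 1
    ext q
    simp [hs]
  · rw [indicator_of_notMem (by simpa using hs)]
    have : Prod.mk s ⁻¹' (C ∩ {p : ℝ × Space d × E | p.1 < r}) = ∅ := by
      ext q
      simp [hs]
    rw [this, measure_empty]

theorem ae_spaceTime_mem (t : ℝ) : ∀ᵐ p ∂(spaceTime ν t), p.1 ∈ Ioo 0 t := by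
  rw [spaceTime, Measure.ae_compProd_iff (measurable_fst measurableSet_Ioo)]
  filter_upwards [ae_restrict_mem measurableSet_Ioo] with s hs
  exact Filter.Eventually.of_forall fun q => hs

theorem integral_spaceTime {t : ℝ} (ht : 0 ≤ t) {f : ℝ × Space d × E → ℝ}
    (hf : Integrable f (spaceTime ν t)) :
    ∫ p, f p ∂(spaceTime ν t) = ∫ s in (0 : ℝ)..t, ∫ q, f (s, q) ∂(ν s) := by
  rw [spaceTime, Measure.integral_compProd hf, intervalIntegral.integral_of_le ht,
    integral_Ioc_eq_integral_Ioo]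

theorem intervalIntegrable_spaceTime {t : ℝ} (ht : 0 ≤ t) {f : ℝ × Space d × E → ℝ}
    (hf : Integrable f (spaceTime ν t)) :
    IntervalIntegrable (fun s => ∫ q, f (s, q) ∂(ν s)) volume 0 t := by
  rw [intervalIntegrable_iff_integrableOn_Ioo_of_le ht]
  exact Integrable.integral_compProd (κ := Kernel.const Unit (volume.restrict (Ioo 0 t)))
    (η := Kernel.prodMkLeft Unit ν) (a := ()) hf

theorem integral_spaceTime_eq_indicator {G : ℝ → ℝ × Space d × E → ℝ} {r t : ℝ} (hrt : r ≤ t) :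
    ∫ p, G r p ∂(spaceTime ν r) = ∫ p, {p : ℝ × (ℝ × Space d × E) | p.2.1 < p.1}.indicator
      (Function.uncurry G) (r, p) ∂(spaceTime ν t) := by
  rw [spaceTime_eq_restrict hrt, ← integral_indicator
    (measurableSet_lt measurable_fst measurable_const)]
  rfl

theorem integrable_indicator_triangle {t : ℝ} [IsFiniteMeasure (spaceTime ν t)]
    {G : ℝ → ℝ × Space d × E → ℝ} (hG : Measurable (Function.uncurry G)) {C : ℝ}
    (hC : ∀ r p, 0 < p.1 → p.1 < r → r < t → |G r p| ≤ C) :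
    Integrable ({p : ℝ × (ℝ × Space d × E) | p.2.1 < p.1}.indicator (Function.uncurry G))
      ((volume.restrict (Ioo 0 t)).prod (spaceTime ν t)) := by
  have hHm := hG.indicator (measurableSet_lt (f := fun p : ℝ × (ℝ × Space d × E) => p.2.1)
    (g := fun p => p.1) (by fun_prop) (by fun_prop))
  -- Off the triangle the integrand is `0`, where `C` itself need not be an upper bound if it is
  -- negative.
  refine Integrable.of_bound hHm.aestronglyMeasurable |C| ?_
  have h1 : ∀ᵐ r ∂(volume.restrict (Ioo 0 t)), r ∈ Ioo 0 t := ae_restrict_mem measurableSet_Ioo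
  refine Measure.ae_prod_iff_ae_ae ?_ |>.2 ?_
  · exact measurableSet_le hHm.norm measurable_const
  filter_upwards [h1] with r hr
  filter_upwards [ae_spaceTime_mem t] with p hp
  rw [Set.indicator_apply]
  split_ifs with h
  · exact (hC r p hp.1 h hr.2).trans (le_abs_self C)
  · simp

theorem intervalIntegrable_integral_spaceTime {t : ℝ} (ht : 0 ≤ t)
    [IsFiniteMeasure (spaceTime ν t)]
    {G : ℝ → ℝ × Space d × E → ℝ} (hG : Measurable (Function.uncurry G)) {C : ℝ}
    (hC : ∀ r p, 0 < p.1 → p.1 < r → r < t → |G r p| ≤ C) :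
    IntervalIntegrable (fun r => ∫ p, G r p ∂(spaceTime ν r)) volume 0 t := by
  rw [intervalIntegrable_iff_integrableOn_Ioo_of_le ht]
  refine (integrable_indicator_triangle (ν := ν) hG hC).integral_prod_left.congr ?_
  filter_upwards [ae_restrict_mem measurableSet_Ioo] with r hr
  exact (integral_spaceTime_eq_indicator hr.2.le).symm

/-- Fubini on the triangle `0 < s < r < t`. -/
theorem integral_integral_spaceTime {t : ℝ} (ht : 0 ≤ t) [IsFiniteMeasure (spaceTime ν t)]
    {G : ℝ → ℝ × Space d × E → ℝ} (hG : Measurable (Function.uncurry G)) {C : ℝ}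
    (hC : ∀ r p, 0 < p.1 → p.1 < r → r < t → |G r p| ≤ C) :
    ∫ r in (0 : ℝ)..t, ∫ p, G r p ∂(spaceTime ν r) =
      ∫ p, (∫ r in p.1..t, G r p) ∂(spaceTime ν t) := by
  have hint := integrable_indicator_triangle (ν := ν) hG hC
  set H : ℝ × (ℝ × Space d × E) → ℝ :=
    {p : ℝ × (ℝ × Space d × E) | p.2.1 < p.1}.indicator (Function.uncurry G) with hH
  have h1 : ∫ r in (0 : ℝ)..t, ∫ p, G r p ∂(spaceTime ν r) =
      ∫ r in Ioo 0 t, ∫ p, H (r, p) ∂(spaceTime ν t) := by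
    rw [intervalIntegral.integral_of_le ht, integral_Ioc_eq_integral_Ioo]
    exact setIntegral_congr_fun measurableSet_Ioo fun r hr =>
      integral_spaceTime_eq_indicator hr.2.le
  rw [h1, integral_integral_swap (f := fun r p => H (r, p)) hint]
  refine integral_congr_ae ?_
  filter_upwards [ae_spaceTime_mem t] with p hp
  rw [intervalIntegral.integral_of_le hp.2.le, integral_Ioc_eq_integral_Ioo]
  have e : Ioo p.1 t = Ioo 0 t ∩ Ioi p.1 := by
    rw [Ioo_inter_Ioi, max_eq_right hp.1.le]
  rw [e, inter_comm, ← Measure.restrict_restrict measurableSet_Ioi,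
    ← integral_indicator measurableSet_Ioi]
  rfl

end

theorem integrable_prod_Ioo {α : Type*} [MeasurableSpace α] (ρ : Measure α) [IsFiniteMeasure ρ]
    {t : ℝ} {G : ℝ → α → ℝ} (hG : Measurable (Function.uncurry G)) {C : ℝ}
    (hC : ∀ r q, 0 < r → r < t → |G r q| ≤ C) :
    Integrable (Function.uncurry G) ((volume.restrict (Ioo 0 t)).prod ρ) := by
  refine Integrable.of_bound hG.aestronglyMeasurable C ?_
  refine Measure.ae_prod_iff_ae_ae (measurableSet_le hG.norm measurable_const) |>.2 ?_
  filter_upwards [ae_restrict_mem measurableSet_Ioo] with r hr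
  exact Filter.Eventually.of_forall fun q => hC r q hr.1 hr.2

theorem intervalIntegrable_integral {α : Type*} [MeasurableSpace α] (ρ : Measure α)
    [IsFiniteMeasure ρ] {t : ℝ} (ht : 0 ≤ t) {G : ℝ → α → ℝ}
    (hG : Measurable (Function.uncurry G)) {C : ℝ} (hC : ∀ r q, 0 < r → r < t → |G r q| ≤ C) :
    IntervalIntegrable (fun r => ∫ q, G r q ∂ρ) volume 0 t := by
  rw [intervalIntegrable_iff_integrableOn_Ioo_of_le ht]
  exact (integrable_prod_Ioo ρ hG hC).integral_prod_left

theorem intervalIntegral_integral_comm {α : Type*} [MeasurableSpace α] (ρ : Measure α)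
    [IsFiniteMeasure ρ] {t : ℝ} (ht : 0 ≤ t) {G : ℝ → α → ℝ}
    (hG : Measurable (Function.uncurry G)) {C : ℝ} (hC : ∀ r q, 0 < r → r < t → |G r q| ≤ C) :
    ∫ r in (0 : ℝ)..t, ∫ q, G r q ∂ρ = ∫ q, (∫ r in (0 : ℝ)..t, G r q) ∂ρ := by
  simp_rw [intervalIntegral.integral_of_le ht, integral_Ioc_eq_integral_Ioo]
  exact integral_integral_swap (integrable_prod_Ioo ρ hG hC)

/-! ### Heat averages of bounded functions -/

/-- `P_τ f(x, y) = 𝔼 f(x + √(a(y) τ) Z, y)`. -/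
noncomputable def heatAvg (M : Model d E) (τ : ℝ) (f : Space d × E → ℝ) (q : Space d × E) : ℝ :=
  ∫ z, f (q.1 + √(M.a q.2 * τ) • z, q.2) ∂(stdGaussian (Space d))

theorem measurable_heatShift (M : Model d E) : Measurable
    fun p : (ℝ × Space d × E) × Space d =>
      ((p.1.2.1 + √(M.a p.1.2.2 * p.1.1) • p.2, p.1.2.2) : Space d × E) := by
  have := M.measurable_a
  fun_prop

theorem measurable_heatAvg (M : Model d E) {f : Space d × E → ℝ} (hf : Measurable f) :
    Measurable fun p : ℝ × Space d × E => heatAvg M p.1 f p.2 :=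
  ((hf.comp (measurable_heatShift M)).stronglyMeasurable.integral_prod_right').measurable

theorem abs_heatAvg_le (M : Model d E) {f : Space d × E → ℝ} {C : ℝ} (hC : ∀ q, |f q| ≤ C)
    (τ : ℝ) (q : Space d × E) : |heatAvg M τ f q| ≤ C := by
  have := norm_integral_le_of_norm_le_const (μ := stdGaussian (Space d)) (C := C)
    (f := fun z => f (q.1 + √(M.a q.2 * τ) • z, q.2)) (Filter.Eventually.of_forall fun z => hC _)
  simpa [heatAvg] using this

/-- As an image of a product with the Gaussian, the heat flow can be moved onto real-valued test
functions by a change of variables and Fubini; `duhamel_eq_map` does the same for the time integral.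
-/
theorem heatFlow_eq_map (M : Model d E) {τ : ℝ} (hτ : 0 < τ) (ν : Measure (Space d × E))
    [SFinite ν] : heatFlow M τ ν = (ν.prod (stdGaussian (Space d))).map
      fun p => (p.1.1 + √(M.a p.1.2 * τ) • p.2, p.1.2) := by
  have ha := M.measurable_a
  ext C hC
  have hind : Measurable (C.indicator (1 : Space d × E → ℝ≥0∞)) := measurable_one.indicator hC
  have hcomp : Measurable fun p : (Space d × E) × Space d =>
      C.indicator (1 : Space d × E → ℝ≥0∞) (p.1.1 + √(M.a p.1.2 * τ) • p.2, p.1.2) :=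
    hind.comp (by fun_prop)
  rw [← lintegral_indicator_one hC, ← lintegral_indicator_one hC,
    lintegral_heatFlow_gaussian M hτ ν hind, lintegral_map hind (by fun_prop),
    lintegral_prod _ hcomp.aemeasurable]

theorem integral_heatFlow (M : Model d E) {τ : ℝ} (hτ : 0 < τ) (ν : Measure (Space d × E))
    [IsFiniteMeasure ν] {f : Space d × E → ℝ} (hf : Measurable f) {C : ℝ} (hC : ∀ q, |f q| ≤ C) :
    ∫ q, f q ∂(heatFlow M τ ν) = ∫ q, heatAvg M τ f q ∂ν := by
  have ha := M.measurable_a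
  have hm : Measurable fun p : (Space d × E) × Space d =>
    ((p.1.1 + √(M.a p.1.2 * τ) • p.2, p.1.2) : Space d × E) := by fun_prop
  have hint : Integrable (fun p : (Space d × E) × Space d =>
      f (p.1.1 + √(M.a p.1.2 * τ) • p.2, p.1.2)) (ν.prod (stdGaussian (Space d))) :=
    Integrable.of_bound (hf.comp hm).aestronglyMeasurable C
      (Filter.Eventually.of_forall fun p => hC _)
  rw [heatFlow_eq_map M hτ, integral_map hm.aemeasurable hf.aestronglyMeasurable,
    integral_prod _ hint]
  rfl

theorem duhamel_eq_map (M : Model d E) (ν : Kernel ℝ (Space d × E)) [IsSFiniteKernel ν] (t : ℝ) :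
    duhamel M ν t = ((spaceTime ν t).prod (stdGaussian (Space d))).map
      fun p => (p.1.2.1 + √(M.a p.1.2.2 * (t - p.1.1)) • p.2, p.1.2.2) := by
  have ha := M.measurable_a
  have hm : Measurable fun p : (ℝ × Space d × E) × Space d =>
    ((p.1.2.1 + √(M.a p.1.2.2 * (t - p.1.1)) • p.2, p.1.2.2) : Space d × E) := by fun_prop
  ext C hC
  have hind : Measurable (C.indicator (1 : Space d × E → ℝ≥0∞)) := measurable_one.indicator hC
  have hcomp : Measurable fun p : (ℝ × Space d × E) × Space d => C.indicator
      (1 : Space d × E → ℝ≥0∞) (p.1.2.1 + √(M.a p.1.2.2 * (t - p.1.1)) • p.2, p.1.2.2) :=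
    hind.comp hm
  rw [← lintegral_indicator_one hC, ← lintegral_indicator_one hC, lintegral_duhamel M ν t hind,
    lintegral_map hind hm, lintegral_prod _ hcomp.aemeasurable, spaceTime,
    Measure.lintegral_compProd hcomp.lintegral_prod_right']
  refine setLIntegral_congr_fun measurableSet_Ioo fun s hs => ?_
  exact lintegral_heatFlow_gaussian M (sub_pos.2 hs.2) _ hind

theorem isFiniteMeasure_duhamel (M : Model d E) (ν : Kernel ℝ (Space d × E)) [IsSFiniteKernel ν]
    (t : ℝ) [IsFiniteMeasure (spaceTime ν t)] : IsFiniteMeasure (duhamel M ν t) := by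
  rw [duhamel_eq_map]
  infer_instance

theorem integral_duhamel (M : Model d E) (ν : Kernel ℝ (Space d × E)) [IsSFiniteKernel ν]
    (t : ℝ) [IsFiniteMeasure (spaceTime ν t)] {f : Space d × E → ℝ} (hf : Measurable f) {C : ℝ}
    (hC : ∀ q, |f q| ≤ C) :
    ∫ q, f q ∂(duhamel M ν t) = ∫ p, heatAvg M (t - p.1) f p.2 ∂(spaceTime ν t) := by
  have ha := M.measurable_a
  have hm : Measurable fun p : (ℝ × Space d × E) × Space d =>
    ((p.1.2.1 + √(M.a p.1.2.2 * (t - p.1.1)) • p.2, p.1.2.2) : Space d × E) := by fun_prop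
  have hint : Integrable (fun p : (ℝ × Space d × E) × Space d =>
      f (p.1.2.1 + √(M.a p.1.2.2 * (t - p.1.1)) • p.2, p.1.2.2))
      ((spaceTime ν t).prod (stdGaussian (Space d))) :=
    Integrable.of_bound (hf.comp hm).aestronglyMeasurable C
      (Filter.Eventually.of_forall fun p => hC _)
  rw [duhamel_eq_map, integral_map hm.aemeasurable hf.aestronglyMeasurable,
    integral_prod _ hint]
  rfl

/-! ### Measurability of the Laplacian -/

/-- `f` is only measurable in `y`, so joint measurability of the derivative is obtained from
difference quotients of step `1/n`. -/
theorem measurable_fderiv_apply {f : Space d → E → ℝ} (hf : Measurable (Function.uncurry f))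
    (hd : ∀ y, Differentiable ℝ fun x => f x y) (v : Space d) :
    Measurable fun q : Space d × E => fderiv ℝ (fun x => f x q.2) q.1 v := by
  refine measurable_of_tendsto_metrizable (f := fun (n : ℕ) (q : Space d × E) =>
    (n : ℝ) • (f (q.1 + (n : ℝ)⁻¹ • v) q.2 - f q.1 q.2)) (fun n => ?_) ?_
  · have h1 : Measurable fun q : Space d × E => f (q.1 + (n : ℝ)⁻¹ • v) q.2 :=
      hf.comp (f := fun q : Space d × E => (q.1 + (n : ℝ)⁻¹ • v, q.2)) (by fun_prop)
    have h2 : Measurable fun q : Space d × E => f q.1 q.2 := hf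
    exact (h1.sub h2).const_smul (n : ℝ)
  · rw [tendsto_pi_nhds]
    intro q
    exact ((hd q.2) q.1).hasFDerivAt.lim v
      (by simpa using tendsto_natCast_atTop_atTop (R := ℝ))

theorem measurable_laplacian {f : Space d → E → ℝ} (hf : Measurable (Function.uncurry f))
    (hd : ∀ y, ContDiff ℝ 2 fun x => f x y) :
    Measurable fun q : Space d × E => (Δ fun x => f x q.2) q.1 := by
  simp_rw [laplacian_eq_sum]
  refine Finset.measurable_sum _ fun i _ => ?_
  set e := EuclideanSpace.basisFun (Fin d) ℝ i
  have h1 : ∀ y, ContDiff ℝ 1 (fderiv ℝ fun x => f x y) := fun y =>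
    (hd y).fderiv_right (m := 1) (by norm_num)
  have h2 := measurable_fderiv_apply (f := fun x y => fderiv ℝ (fun x => f x y) x e)
    (measurable_fderiv_apply hf (fun y => (hd y).differentiable two_ne_zero) e)
    (fun y => ((h1 y).differentiable one_ne_zero).clm_apply (differentiable_const e)) e
  convert h2 using 2 with q
  rw [fderiv_clm_apply ((h1 q.2).differentiable one_ne_zero q.1) (differentiableAt_const e)]
  simp

/-! ### Weak and mild equations tested against bounded functions -/

section
variable {M : Model d E} {T : ℝ≥0∞} {μ : ℝ → Measure (Space d × E)}

theorem ProcessKernels.isFiniteMeasure_spaceTime [StandardBorelSpace E]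
    (k : ProcessKernels M T μ) (hμ : IsProcess T μ)
    (hMCD : MomentBound M T μ) {t : ℝ} (ht : Before T t) :
    IsFiniteMeasure (spaceTime k.m t) ∧ IsFiniteMeasure (spaceTime k.gain t) ∧
      IsFiniteMeasure (spaceTime k.loss t) := by
  have := k.isSFiniteKernel_gain
  have := k.isSFiniteKernel_loss
  have := k.isSFiniteKernel_m
  obtain ⟨C, hC⟩ := hMCD.exists_momentLE hμ ht
  obtain ⟨ε, hε, hw⟩ := M.w_uniformlyPositive
  have hs : ∀ s ∈ Ioo 0 t, Before T s := fun s hs => ht.mono hs.1.le hs.2.le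
  refine ⟨CoagDiff.isFiniteMeasure_spaceTime (C := C / ENNReal.ofReal ε) ?_ fun s hst => ?_,
    CoagDiff.isFiniteMeasure_spaceTime (C := C * C) (by simp [ENNReal.mul_eq_top]) fun s hst => ?_,
    CoagDiff.isFiniteMeasure_spaceTime (C := C * C) (by simp [ENNReal.mul_eq_top]) fun s hst => ?_⟩
  · exact (ENNReal.div_lt_top ENNReal.coe_ne_top (by simpa using hε)).ne
  · rw [k.m_eq s (hs s hst)]
    exact (hC s ⟨hst.1.le, hst.2.le⟩).univ_le hε hw
  · rw [k.gain_eq s (hs s hst)]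
    exact (hC s ⟨hst.1.le, hst.2.le⟩).Kplus_univ_le
  · rw [k.loss_eq s (hs s hst)]
    exact (hC s ⟨hst.1.le, hst.2.le⟩).Kminus_univ_le

theorem integrable_of_abs_le {α : Type*} [MeasurableSpace α] {ρ : Measure α} [IsFiniteMeasure ρ]
    {f : α → ℝ} (hf : Measurable f) {C : ℝ} (hC : ∀ q, |f q| ≤ C) : Integrable f ρ :=
  Integrable.of_bound hf.aestronglyMeasurable C (Filter.Eventually.of_forall hC)

theorem ProcessKernels.integral_mild [StandardBorelSpace E]
    (k : ProcessKernels M T μ) (hμ : IsProcess T μ)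
    (hMCD : MomentBound M T μ) (hE : MildEquation M T μ) {t : ℝ} (ht0 : 0 < t) (ht : Before T t)
    {f : Space d × E → ℝ} (hf : Measurable f) {C : ℝ} (hC : ∀ q, |f q| ≤ C) :
    ∫ q, f q ∂(k.m t) + ∫ p, heatAvg M (t - p.1) f p.2 ∂(spaceTime k.loss t) =
      ∫ q, heatAvg M t f q ∂(k.m 0) + ∫ p, heatAvg M (t - p.1) f p.2 ∂(spaceTime k.gain t) := by
  have := k.isSFiniteKernel_gain
  have := k.isSFiniteKernel_loss
  obtain ⟨-, h1, h2⟩ := k.isFiniteMeasure_spaceTime hμ hMCD ht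
  have : IsFiniteMeasure (k.m t) := ⟨k.m_fin t⟩
  have : IsFiniteMeasure (k.m 0) := ⟨k.m_fin 0⟩
  have := isFiniteMeasure_heatFlow M ht0 (k.m 0)
  have := isFiniteMeasure_duhamel M k.gain t
  have := isFiniteMeasure_duhamel M k.loss t
  have h := congrArg (fun ν : Measure (Space d × E) => ∫ q, f q ∂ν)
    (k.mildEquation_iff.1 hE t ht0 ht)
  rw [integral_add_measure (integrable_of_abs_le hf hC) (integrable_of_abs_le hf hC),
    integral_add_measure (integrable_of_abs_le hf hC) (integrable_of_abs_le hf hC),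
    integral_duhamel M _ _ hf hC, integral_duhamel M _ _ hf hC,
    integral_heatFlow M ht0 _ hf hC] at h
  exact h

/-- `½ a Δ f`. -/
noncomputable def gen (M : Model d E) (f : Space d → E → ℝ) (q : Space d × E) : ℝ :=
  1 / 2 * M.a q.2 * (Δ fun x => f x q.2) q.1

theorem IsTestFunction.measurable_gen {f : Space d → E → ℝ} (hf : IsTestFunction M f) :
    Measurable (gen M f) := by
  have := M.measurable_a
  have := measurable_laplacian hf.measurable hf.contDiff
  unfold gen
  fun_prop

/-- Here the support condition matters: `a` is bounded over a compact range of masses, and outside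
it `f(·, y)` vanishes identically, so its Laplacian does too. -/
theorem IsTestFunction.exists_gen_le {f : Space d → E → ℝ} (hf : IsTestFunction M f) :
    ∃ C : ℝ, ∀ q, |gen M f q| ≤ C := by
  obtain ⟨B, hB, hB0, hfB⟩ := hf.support
  obtain ⟨A, hA⟩ := M.a_locallyBounded B hB hB0
  obtain ⟨C, hC⟩ := hf.fderiv2_bounded
  refine ⟨|1 / 2 * A * (d * C)|, fun q => ?_⟩
  by_cases h : M.m q.2 ∈ B
  · have h1 := hA q.2 h
    have h2 := abs_laplacian_le (fun x => hC x q.2) q.1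
    have h3 : 0 ≤ A := (abs_nonneg _).trans h1
    refine le_trans ?_ (le_abs_self _)
    rw [gen, abs_mul, abs_mul, abs_of_pos (by norm_num : (0 : ℝ) < 1 / 2)]
    gcongr
  · have : (fun x => f x q.2) = fun _ => 0 := funext fun x => hfB x q.2 h
    rw [gen, this]
    simp
    positivity

/-- The heat equation for Gaussian averages, run at speed `a(y)` by the substitution `σ ↦ a(y) σ`.
-/
theorem IsTestFunction.integral_heatAvg_gen {f : Space d → E → ℝ} (hf : IsTestFunction M f)
    {τ : ℝ} (hτ : 0 ≤ τ) (q : Space d × E) :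
    ∫ σ in (0 : ℝ)..τ, heatAvg M σ (gen M f) q =
      heatAvg M τ (Function.uncurry f) q - f q.1 q.2 := by
  obtain ⟨C₀, h0⟩ := hf.bounded
  obtain ⟨C₁, h1⟩ := hf.fderiv_bounded
  obtain ⟨C₂, h2⟩ := hf.fderiv2_bounded
  have h := integral_stdGaussian_sub_eq (hf.contDiff q.2) (fun x => h0 x q.2) (fun x => h1 x q.2)
    (fun x => h2 x q.2) q.1 (mul_nonneg (M.a_pos q.2).le hτ)
  have hs := intervalIntegral.mul_integral_comp_mul_left (a := 0) (b := τ) (c := M.a q.2)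
    (f := fun σ => ∫ z, 1 / 2 * (Δ fun x => f x q.2) (q.1 + √σ • z) ∂(stdGaussian (Space d)))
  rw [mul_zero] at hs
  rw [heatAvg]
  simp only [Function.uncurry]
  rw [h, ← hs, ← intervalIntegral.integral_const_mul]
  refine intervalIntegral.integral_congr fun σ _ => ?_
  simp only [heatAvg, gen]
  rw [← integral_const_mul]
  refine integral_congr_ae (Filter.Eventually.of_forall fun z => ?_)
  simp only
  ring

/-- The weak equation in terms of space-time measures. -/
theorem ProcessKernels.weak_iff [StandardBorelSpace E]
    (k : ProcessKernels M T μ) (hμ : IsProcess T μ)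
    (hMCD : MomentBound M T μ) {f : Space d → E → ℝ} (hf : IsTestFunction M f) {t : ℝ}
    (ht : Before T t) :
    ∫ q, f q.1 q.2 ∂(μ t) = (∫ q, f q.1 q.2 ∂(μ 0)) +
      (∫ s in (0 : ℝ)..t, ∫ q, (1 / 2) * M.a q.2 * (Δ fun x => f x q.2) q.1 ∂(μ s)) +
      ∫ s in (0 : ℝ)..t, coagPairing M f (μ s) ↔
    ∫ q, f q.1 q.2 ∂(k.m t) = ∫ q, f q.1 q.2 ∂(k.m 0) + ∫ p, gen M f p.2 ∂(spaceTime k.m t) +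
      (∫ p, f p.2.1 p.2.2 ∂(spaceTime k.gain t) - ∫ p, f p.2.1 p.2.2 ∂(spaceTime k.loss t)) := by
  have := k.isSFiniteKernel_gain
  have := k.isSFiniteKernel_loss
  have := k.isSFiniteKernel_m
  obtain ⟨h0, h1, h2⟩ := k.isFiniteMeasure_spaceTime hμ hMCD ht
  obtain ⟨C, hC⟩ := hf.bounded
  obtain ⟨C', hC'⟩ := hf.exists_gen_le
  have hfm : Measurable fun p : ℝ × Space d × E => f p.2.1 p.2.2 :=
    hf.measurable.comp (f := fun p : ℝ × Space d × E => p.2) measurable_snd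
  have hgm : Measurable fun p : ℝ × Space d × E => gen M f p.2 :=
    hf.measurable_gen.comp measurable_snd
  have i1 : Integrable (fun p : ℝ × Space d × E => f p.2.1 p.2.2) (spaceTime k.gain t) :=
    integrable_of_abs_le hfm fun p => hC _ _
  have i2 : Integrable (fun p : ℝ × Space d × E => f p.2.1 p.2.2) (spaceTime k.loss t) :=
    integrable_of_abs_le hfm fun p => hC _ _
  have i3 : Integrable (fun p : ℝ × Space d × E => gen M f p.2) (spaceTime k.m t) :=
    integrable_of_abs_le hgm fun p => hC' _
  rw [integral_spaceTime ht.1 i1, integral_spaceTime ht.1 i2, integral_spaceTime ht.1 i3,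
    ← intervalIntegral.integral_sub (intervalIntegrable_spaceTime ht.1 i1)
      (intervalIntegrable_spaceTime ht.1 i2), k.m_eq t ht, k.m_eq 0 (ht.mono le_rfl ht.1)]
  have hs : ∀ s ∈ uIcc 0 t, Before T s := fun s hs => by
    rw [uIcc_of_le ht.1] at hs
    exact ht.mono hs.1 hs.2
  have e1 : ∫ s in (0 : ℝ)..t, ∫ q, (1 / 2) * M.a q.2 * (Δ fun x => f x q.2) q.1 ∂(μ s) =
      ∫ s in (0 : ℝ)..t, ∫ q, gen M f q ∂(k.m s) :=
    intervalIntegral.integral_congr fun s hst => by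
      simp only [k.m_eq s (hs s hst)]
      rfl
  have e2 : ∫ s in (0 : ℝ)..t, coagPairing M f (μ s) = ∫ s in (0 : ℝ)..t,
      (∫ q, f q.1 q.2 ∂(k.gain s) - ∫ q, f q.1 q.2 ∂(k.loss s)) :=
    intervalIntegral.integral_congr fun s hst => by
      simp only [k.gain_eq s (hs s hst), k.loss_eq s (hs s hst)]
      rfl
  rw [e1, e2]

/-- Testing (E) at `r` with `½aΔf` and integrating over `r`, a source at time `s` contributes
`P_{t-s}f - f`. The terms with `P_{t-s}f` recombine by (E) at time `t` tested with `f`, and those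
with `f` are the weak equation. -/
theorem MildEquation.isWeakSolution [StandardBorelSpace E]
    (hE : MildEquation M T μ) (hμ : IsProcess T μ)
    (hMCD : MomentBound M T μ) : IsWeakSolution M T μ := by
  obtain ⟨k⟩ := hμ.nonempty_processKernels hMCD
  refine ⟨hMCD, fun f hf t ht => (k.weak_iff hμ hMCD hf ht).2 ?_⟩
  -- The mild equation is stated for positive times only; at `t = 0` the weak equation is trivial.
  rcases ht.1.eq_or_lt with rfl | ht0
  · simp [spaceTime]
  have := k.isSFiniteKernel_gain
  have := k.isSFiniteKernel_loss
  have := k.isSFiniteKernel_m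
  obtain ⟨h0, h1, h2⟩ := k.isFiniteMeasure_spaceTime hμ hMCD ht
  have : IsFiniteMeasure (k.m 0) := ⟨k.m_fin 0⟩
  obtain ⟨C, hC⟩ := hf.bounded
  obtain ⟨C', hC'⟩ := hf.exists_gen_le
  have hgm := hf.measurable_gen
  have hfm : Measurable fun p : ℝ × Space d × E => f p.2.1 p.2.2 :=
    hf.measurable.comp (f := fun p : ℝ × Space d × E => p.2) measurable_snd
  have hfm0 : Measurable fun q : Space d × E => f q.1 q.2 := hf.measurable
  have hf' : ∀ q, |Function.uncurry f q| ≤ C := fun q => hC _ _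
  have hG : Measurable (Function.uncurry fun (r : ℝ) (p : ℝ × Space d × E) =>
      heatAvg M (r - p.1) (gen M f) p.2) :=
    (measurable_heatAvg M hgm).comp (f := fun q : ℝ × ℝ × Space d × E => (q.1 - q.2.1, q.2.2))
      (by fun_prop)
  have hGC : ∀ (r : ℝ) (p : ℝ × Space d × E), 0 < p.1 → p.1 < r → r < t →
      |heatAvg M (r - p.1) (gen M f) p.2| ≤ C' := fun r p _ _ _ => abs_heatAvg_le M hC' _ _
  have hA : Measurable (Function.uncurry fun (r : ℝ) (q : Space d × E) =>
      heatAvg M r (gen M f) q) := measurable_heatAvg M hgm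
  have hAC : ∀ (r : ℝ) (q : Space d × E), 0 < r → r < t → |heatAvg M r (gen M f) q| ≤ C' :=
    fun r q _ _ => abs_heatAvg_le M hC' _ _
  have hinner : ∀ p : ℝ × Space d × E, p.1 ∈ Ioo 0 t → ∫ r in p.1..t,
      heatAvg M (r - p.1) (gen M f) p.2 =
        heatAvg M (t - p.1) (Function.uncurry f) p.2 - f p.2.1 p.2.2 := by
    intro p hp
    rw [intervalIntegral.integral_comp_sub_right
      (fun r => heatAvg M r (gen M f) p.2) p.1, sub_self]
    exact hf.integral_heatAvg_gen (by linarith [hp.2]) p.2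
  have htri : ∀ (ν : Kernel ℝ (Space d × E)) [IsSFiniteKernel ν] [IsFiniteMeasure (spaceTime ν t)],
      ∫ r in (0 : ℝ)..t, ∫ p, heatAvg M (r - p.1) (gen M f) p.2 ∂(spaceTime ν r) =
        ∫ p, heatAvg M (t - p.1) (Function.uncurry f) p.2 ∂(spaceTime ν t) -
          ∫ p, f p.2.1 p.2.2 ∂(spaceTime ν t) := by
    intro ν _ _
    have hm : Measurable fun p : ℝ × Space d × E =>
        heatAvg M (t - p.1) (Function.uncurry f) p.2 :=
      (measurable_heatAvg M hf.measurable).comp (f := fun p : ℝ × Space d × E => (t - p.1, p.2))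
        (by fun_prop)
    rw [integral_integral_spaceTime ht.1 hG hGC, ← integral_sub
      (integrable_of_abs_le hm fun p => abs_heatAvg_le M hf' _ _)
      (integrable_of_abs_le hfm fun p => hC _ _)]
    refine integral_congr_ae ?_
    filter_upwards [ae_spaceTime_mem t] with p hp
    exact hinner p hp
  have hm : ∫ p, gen M f p.2 ∂(spaceTime k.m t) = ∫ r in (0 : ℝ)..t,
      ((∫ q, heatAvg M r (gen M f) q ∂(k.m 0) +
        ∫ p, heatAvg M (r - p.1) (gen M f) p.2 ∂(spaceTime k.gain r)) -
        ∫ p, heatAvg M (r - p.1) (gen M f) p.2 ∂(spaceTime k.loss r)) := by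
    have i : Integrable (fun p : ℝ × Space d × E => gen M f p.2) (spaceTime k.m t) :=
      integrable_of_abs_le (hgm.comp measurable_snd) fun p => hC' p.2
    rw [integral_spaceTime ht.1 i, intervalIntegral.integral_of_le ht.1, intervalIntegral.integral_of_le ht.1,
      integral_Ioc_eq_integral_Ioo, integral_Ioc_eq_integral_Ioo]
    refine setIntegral_congr_fun measurableSet_Ioo fun r hr => ?_
    exact eq_sub_of_add_eq (k.integral_mild hμ hMCD hE hr.1 (ht.mono hr.1.le hr.2.le) hgm hC')
  have hi0 : Integrable (fun q => heatAvg M t (Function.uncurry f) q) (k.m 0) :=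
    integrable_of_abs_le ((measurable_heatAvg M hf.measurable).comp measurable_prodMk_left)
      fun p => abs_heatAvg_le M hf' _ _
  have h3 : ∫ r in (0 : ℝ)..t, ∫ q, heatAvg M r (gen M f) q ∂(k.m 0) =
      ∫ q, heatAvg M t (Function.uncurry f) q ∂(k.m 0) - ∫ q, f q.1 q.2 ∂(k.m 0) := by
    rw [intervalIntegral_integral_comm (k.m 0) ht.1 hA hAC, ← integral_sub hi0
      (integrable_of_abs_le hfm0 fun p => hC _ _)]
    exact integral_congr_ae (Filter.Eventually.of_forall fun q =>
      hf.integral_heatAvg_gen ht.1 q)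
  rw [hm, intervalIntegral.integral_sub ((intervalIntegrable_integral _ ht.1 hA hAC).add
      (intervalIntegrable_integral_spaceTime ht.1 hG hGC))
      (intervalIntegrable_integral_spaceTime ht.1 hG hGC),
    intervalIntegral.integral_add (intervalIntegrable_integral _ ht.1 hA hAC)
      (intervalIntegrable_integral_spaceTime ht.1 hG hGC), h3, htri, htri]
  have hmild := k.integral_mild hμ hMCD hE ht0 ht hf.measurable hf'
  have e : ∫ q, f q.1 q.2 ∂(k.m t) = ∫ q, Function.uncurry f q ∂(k.m t) := rfl
  rw [e]
  linarith

end


/-! ### Plane waves -/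

/-- The function `h(y) cos(⟨x, ξ⟩ + θ)`. -/
noncomputable def wave (h : E → ℝ) (ξ : Space d) (θ : ℝ) (x : Space d) (y : E) : ℝ :=
  h y * Real.cos (inner ℝ x ξ + θ)

theorem measurable_wave {h : E → ℝ} (hh : Measurable h) (ξ : Space d) (θ : ℝ) :
    Measurable (Function.uncurry (wave h ξ θ)) := by
  unfold wave Function.uncurry
  fun_prop

theorem abs_wave_le {h : E → ℝ} {C : ℝ} (hC : ∀ y, |h y| ≤ C) (ξ : Space d) (θ : ℝ) (x : Space d)
    (y : E) : |wave h ξ θ x y| ≤ C := by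
  rw [wave, abs_mul]
  exact (mul_le_of_le_one_right (abs_nonneg _) (Real.abs_cos_le_one _)).trans (hC y)

theorem fderiv_wave (h : E → ℝ) (ξ : Space d) (θ : ℝ) (y : E) :
    fderiv ℝ (fun x => wave h ξ θ x y) =
      fun x => (-(h y * Real.sin (inner ℝ x ξ + θ))) • innerSL ℝ ξ := by
  ext1 x
  have h0 : HasFDerivAt (fun x : Space d => inner ℝ x ξ + θ) (innerSL ℝ ξ) x := by
    have := ((innerSL ℝ ξ).hasFDerivAt (x := x)).add_const θ
    simpa only [innerSL_apply_apply, real_inner_comm] using this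
  have := (h0.cos.const_mul (h y)).fderiv
  simp only [wave]
  rw [this, smul_smul]
  congr 1
  ring

theorem fderiv_fderiv_wave (h : E → ℝ) (ξ : Space d) (θ : ℝ) (x : Space d) (y : E) :
    fderiv ℝ (fderiv ℝ (fun x => wave h ξ θ x y)) x =
      ((-(wave h ξ θ x y)) • innerSL ℝ ξ).smulRight (innerSL ℝ ξ) := by
  have h0 : HasFDerivAt (fun x : Space d => inner ℝ x ξ + θ) (innerSL ℝ ξ) x := by
    have := ((innerSL ℝ ξ).hasFDerivAt (x := x)).add_const θ
    simpa only [innerSL_apply_apply, real_inner_comm] using this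
  rw [fderiv_wave]
  have h1 : HasFDerivAt (fun x => (-(h y * Real.sin (inner ℝ x ξ + θ))) • innerSL ℝ ξ) _ x :=
    ((h0.sin.const_mul (h y)).neg).smul_const (innerSL ℝ ξ)
  rw [h1.fderiv]
  ext u v
  simp [wave]
  exact Or.inl (by ring)

/-- Waves are eigenfunctions with an eigenvalue free of `x`, so `½aΔ` and the heat flow act on them
as multiplication by functions of `y`, which again yields waves. -/
theorem laplacian_wave (h : E → ℝ) (ξ : Space d) (θ : ℝ) (x : Space d) (y : E) :
    (Δ fun x => wave h ξ θ x y) x = -(‖ξ‖ ^ 2 * wave h ξ θ x y) := by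
  rw [laplacian_eq_sum]
  simp only [fderiv_fderiv_wave]
  have := (EuclideanSpace.basisFun (Fin d) ℝ).sum_sq_norm_inner_right ξ
  rw [← this, Finset.sum_mul, ← Finset.sum_neg_distrib]
  refine Finset.sum_congr rfl fun i _ => ?_
  simp only [smul_apply, ContinuousLinearMap.smulRight_apply,
    innerSL_apply_apply, smul_eq_mul, Real.norm_eq_abs, sq_abs, real_inner_comm]
  ring

theorem gen_wave (M : Model d E) (h : E → ℝ) (ξ : Space d) (θ : ℝ) (q : Space d × E) :
    gen M (wave h ξ θ) q = -(1 / 2 * M.a q.2 * ‖ξ‖ ^ 2 * wave h ξ θ q.1 q.2) := by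
  rw [gen, laplacian_wave]
  ring

theorem isTestFunction_wave (M : Model d E) {h : E → ℝ} (hh : Measurable h) {C : ℝ}
    (hC : ∀ y, |h y| ≤ C) {B : Set ℝ} (hB : IsCompact B) (hB0 : B ⊆ Ioi 0)
    (hhB : ∀ y, M.m y ∉ B → h y = 0) (ξ : Space d) (θ : ℝ) : IsTestFunction M (wave h ξ θ) where
  measurable := measurable_wave hh ξ θ
  bounded := ⟨C, abs_wave_le hC ξ θ⟩
  support := ⟨B, hB, hB0, fun x y hy => by simp [wave, hhB y hy]⟩
  contDiff y := by
    unfold wave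
    exact contDiff_const.mul (((contDiff_id.inner ℝ contDiff_const).add contDiff_const).cos)
  fderiv_bounded := by
    refine ⟨C * ‖ξ‖, fun x y => ?_⟩
    rw [fderiv_wave, norm_smul, norm_neg, innerSL_apply_norm, norm_mul]
    have h0 := hC y
    have h1 : |h y| * |Real.sin (inner ℝ x ξ + θ)| ≤ C :=
      (mul_le_of_le_one_right (abs_nonneg _) (Real.abs_sin_le_one _)).trans h0
    exact mul_le_mul_of_nonneg_right h1 (norm_nonneg _)
  fderiv2_bounded := by
    refine ⟨C * (‖ξ‖ * ‖ξ‖), fun x y => ?_⟩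
    rw [← norm_fderiv_fderiv_eq, fderiv_fderiv_wave,
      ContinuousLinearMap.norm_smulRight_apply, norm_smul, norm_neg, innerSL_apply_norm, mul_assoc]
    exact mul_le_mul_of_nonneg_right (abs_wave_le hC ξ θ x y) (by positivity)

/-- The cosine is the real part of an exponential, whose Gaussian average is the characteristic
function at `√(a(y)τ) ξ`. -/
theorem heatAvg_wave (M : Model d E) (h : E → ℝ) (ξ : Space d) (θ : ℝ) {τ : ℝ} (hτ : 0 ≤ τ)
    (q : Space d × E) : heatAvg M τ (Function.uncurry (wave h ξ θ)) q =
      Real.exp (-(1 / 2 * M.a q.2 * ‖ξ‖ ^ 2 * τ)) * wave h ξ θ q.1 q.2 := by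
  set s := M.a q.2 * τ with hs
  have hs0 : 0 ≤ s := mul_nonneg (M.a_pos _).le hτ
  have h1 : charFun (stdGaussian (Space d)) (√s • ξ) =
      (Real.exp (-(1 / 2 * M.a q.2 * ‖ξ‖ ^ 2 * τ)) : ℂ) := by
    rw [charFun_stdGaussian, norm_smul, Complex.ofReal_exp]
    congr 1
    have : ((‖√s‖ * ‖ξ‖ : ℝ) : ℂ) ^ 2 = ((s * ‖ξ‖ ^ 2 : ℝ) : ℂ) := by
      rw [← Complex.ofReal_pow, mul_pow, Real.norm_eq_abs, sq_abs, Real.sq_sqrt hs0]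
    rw [this, hs]
    push_cast
    ring
  have hint : Integrable (fun z : Space d => Complex.exp (inner ℝ z (√s • ξ) * Complex.I))
      (stdGaussian (Space d)) := by
    refine Integrable.of_bound (by fun_prop) 1 (Filter.Eventually.of_forall fun z => ?_)
    rw [Complex.norm_exp_ofReal_mul_I]
  rw [charFun_apply] at h1
  have h2 : ∀ z : Space d, wave h ξ θ (q.1 + √s • z) q.2 =
      (((h q.2 : ℂ) * Complex.exp (((inner ℝ q.1 ξ + θ : ℝ) : ℂ) * Complex.I)) *
        Complex.exp (inner ℝ z (√s • ξ) * Complex.I)).re := by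
    intro z
    rw [mul_assoc, ← Complex.exp_add, ← add_mul, ← Complex.ofReal_add, Complex.re_ofReal_mul,
      Complex.exp_ofReal_mul_I_re, wave, inner_add_left, inner_smul_left, inner_smul_right]
    simp only [conj_trivial]
    congr 2
    ring
  have h3 : ∫ z, wave h ξ θ (q.1 + √s • z) q.2 ∂(stdGaussian (Space d)) =
      (((h q.2 : ℂ) * Complex.exp (((inner ℝ q.1 ξ + θ : ℝ) : ℂ) * Complex.I)) *
        ∫ z, Complex.exp (inner ℝ z (√s • ξ) * Complex.I) ∂(stdGaussian (Space d))).re := by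
    rw [← integral_const_mul]
    simp_rw [h2]
    exact integral_re (hint.const_mul _)
  simp only [heatAvg, Function.uncurry]
  rw [h3, h1, mul_comm, Complex.re_ofReal_mul, Complex.re_ofReal_mul, Complex.exp_ofReal_mul_I_re,
    wave]

theorem integral_exp_decay {l s t : ℝ} :
    ∫ r in s..t, l * Real.exp (-(l * (t - r))) = 1 - Real.exp (-(l * (t - s))) := by
  have hd : ∀ r ∈ uIcc s t, HasDerivAt (fun r => Real.exp (-(l * (t - r))))
      (l * Real.exp (-(l * (t - r)))) r := by
    intro r _
    have : HasDerivAt (fun r => Real.exp (-(l * (t - r)))) _ r :=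
      ((((hasDerivAt_id r).const_sub t).const_mul l).neg).exp
    convert this using 1
    simp
    ring
  rw [intervalIntegral.integral_eq_sub_of_hasDerivAt hd
    (Continuous.intervalIntegrable (by fun_prop) _ _)]
  simp

/-- The phases `0` and `-π/2` give the real and imaginary parts of the characteristic function of
the spatial marginal restricted to types in `A`, which determines that marginal. -/
theorem eq_of_integral_wave_eq {α β : Measure (Space d × E)} [IsFiniteMeasure α]
    [IsFiniteMeasure β] {A : Set E} (hA : MeasurableSet A)
    (h : ∀ ξ θ, ∫ q, wave (A.indicator 1) ξ θ q.1 q.2 ∂α = ∫ q, wave (A.indicator 1) ξ θ q.1 q.2 ∂β)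
    {B : Set (Space d)} (hB : MeasurableSet B) : α (B ×ˢ A) = β (B ×ˢ A) := by
  have key : ∀ ρ : Measure (Space d × E), IsFiniteMeasure ρ → ∀ ξ,
      charFun ((ρ.restrict (univ ×ˢ A)).map Prod.fst) ξ =
        ((∫ q, wave (A.indicator 1) ξ 0 q.1 q.2 ∂ρ : ℝ) : ℂ) +
          ((∫ q, wave (A.indicator 1) ξ (-(Real.pi / 2)) q.1 q.2 ∂ρ : ℝ) : ℂ) * Complex.I := by
    intro ρ _ ξ
    have hi : Measurable (A.indicator (1 : E → ℝ)) := measurable_one.indicator hA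
    have hle : ∀ y, |A.indicator (1 : E → ℝ) y| ≤ 1 := fun y => by
      by_cases hy : y ∈ A <;> simp [hy]
    rw [charFun_apply, integral_map measurable_fst.aemeasurable (by fun_prop),
      ← integral_indicator (MeasurableSet.univ.prod hA), ← integral_complex_ofReal,
      ← integral_complex_ofReal, ← integral_mul_const, ← integral_add]
    · refine integral_congr_ae (Filter.Eventually.of_forall fun q => ?_)
      by_cases hq : q.2 ∈ A
      · rw [indicator_of_mem (by simp [hq])]
        simp only [wave, indicator_of_mem hq, Pi.one_apply, one_mul, add_zero]
        rw [← sub_eq_add_neg, Real.cos_sub_pi_div_two, Complex.exp_mul_I, Complex.ofReal_cos,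
          Complex.ofReal_sin]
      · rw [indicator_of_notMem (by simp [hq])]
        simp [wave, hq]
    · exact (integrable_of_abs_le (measurable_wave hi ξ 0)
        fun q => abs_wave_le hle ξ 0 q.1 q.2).ofReal
    · exact ((integrable_of_abs_le (measurable_wave hi ξ _)
        fun q => abs_wave_le hle ξ _ q.1 q.2).ofReal).mul_const _
  have e : (α.restrict (univ ×ˢ A)).map Prod.fst = (β.restrict (univ ×ˢ A)).map Prod.fst := by
    refine Measure.ext_of_charFun (funext fun ξ => ?_)
    rw [key α inferInstance, key β inferInstance, h, h]
  have e1 : ∀ ρ : Measure (Space d × E), (ρ.restrict (univ ×ˢ A)).map Prod.fst B = ρ (B ×ˢ A) := by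
    intro ρ
    rw [Measure.map_apply measurable_fst hB, Measure.restrict_apply (measurable_fst hB)]
    congr 1
    ext q
    simp
  rw [← e1, ← e1, e]

/-! ### Weak solutions satisfy the mild equation -/

section
variable [StandardBorelSpace E] {M : Model d E} {T : ℝ≥0∞} {μ : ℝ → Measure (Space d × E)}

/-- Duhamel's formula without time-dependent test functions. With `l = ½a|ξ|²`, the weak equation at
time `r` is tested with `G_r = l e^{-l(t-r)} f`, where `½aΔG_r = -l G_r`, and integrated over `r ∈
(0,t)`. The integrals of `G_s` against `μ_s` cancel, and the remaining integral of `l f` is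
eliminated by the weak equation at `t` tested with `f`. -/
theorem IsWeakSolution.integral_wave (hW : IsWeakSolution M T μ) (hμ : IsProcess T μ)
    (k : ProcessKernels M T μ) {t : ℝ} (ht : Before T t) {h : E → ℝ}
    (hh : Measurable h) {C : ℝ} (hC : ∀ y, |h y| ≤ C) {B : Set ℝ} (hB : IsCompact B)
    (hB0 : B ⊆ Ioi 0) (hhB : ∀ y, M.m y ∉ B → h y = 0) (ξ : Space d) (θ : ℝ) :
    ∫ q, wave h ξ θ q.1 q.2 ∂(k.m t) +
        ∫ p, heatAvg M (t - p.1) (Function.uncurry (wave h ξ θ)) p.2 ∂(spaceTime k.loss t) =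
      ∫ q, heatAvg M t (Function.uncurry (wave h ξ θ)) q ∂(k.m 0) +
        ∫ p, heatAvg M (t - p.1) (Function.uncurry (wave h ξ θ)) p.2 ∂(spaceTime k.gain t) := by
  have hMCD := hW.1
  have := k.isSFiniteKernel_gain
  have := k.isSFiniteKernel_loss
  have := k.isSFiniteKernel_m
  obtain ⟨_, _, _⟩ := k.isFiniteMeasure_spaceTime hμ hMCD ht
  have : IsFiniteMeasure (k.m 0) := ⟨k.m_fin 0⟩
  have ham := M.measurable_a
  set l : E → ℝ := fun y => 1 / 2 * M.a y * ‖ξ‖ ^ 2 with hl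
  have hlm : Measurable l := by fun_prop
  have hl0 : ∀ y, 0 ≤ l y := fun y => by have := (M.a_pos y).le; positivity
  have hf := isTestFunction_wave M hh hC hB hB0 hhB ξ θ
  set f := wave h ξ θ with hfdef
  have hfm : Measurable fun q : Space d × E => f q.1 q.2 := measurable_wave hh ξ θ
  have hfC : ∀ q : Space d × E, |f q.1 q.2| ≤ C := fun q => abs_wave_le hC ξ θ q.1 q.2
  obtain ⟨D, hD⟩ := hf.exists_gen_le
  have hlf : ∀ q : Space d × E, |l q.2 * f q.1 q.2| ≤ D := fun q => by
    have := hD q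
    rwa [gen_wave, abs_neg] at this
  obtain ⟨L, hL⟩ : ∃ L, ∀ y, h y ≠ 0 → l y ≤ L := by
    obtain ⟨A, hA⟩ := M.a_locallyBounded B hB hB0
    refine ⟨1 / 2 * A * ‖ξ‖ ^ 2, fun y hy => ?_⟩
    have h2 := (le_abs_self _).trans (hA y (not_imp_comm.1 (hhB y) hy))
    simp only [hl]
    gcongr
  -- The rate `l` may be unbounded on `E`, but it is at most `L` wherever `h` does not vanish, and
  -- every function below carries the factor `h`.
  have hL0 : ∀ {y} {c : ℝ} {D}, (h y = 0 → c = 0) → |c| ≤ D → |l y * c| ≤ |L| * D := by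
    intro y c D h1 h2
    rw [abs_mul, abs_of_nonneg (hl0 y)]
    by_cases hy : h y = 0
    · rw [h1 hy, abs_zero, mul_zero]
      have := (abs_nonneg _).trans h2
      positivity
    · have := (hL y hy).trans (le_abs_self L)
      gcongr
  have hexp : ∀ (y : E) {σ : ℝ}, 0 ≤ σ → Real.exp (-(l y * σ)) ≤ 1 := fun y σ hσ =>
    Real.exp_le_one_iff.2 (by have := mul_nonneg (hl0 y) hσ; linarith)
  set e : ℝ → E → ℝ := fun σ y => Real.exp (-(l y * σ)) with he
  have hem : Measurable (Function.uncurry e) := by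
    unfold e Function.uncurry
    fun_prop
  set G : ℝ → Space d × E → ℝ := fun r q => l q.2 * e (t - r) q.2 * f q.1 q.2 with hG
  have hGm : Measurable (Function.uncurry G) := by
    have h1 : Measurable fun p : ℝ × Space d × E => e (t - p.1) p.2.2 :=
      hem.comp (f := fun p : ℝ × Space d × E => (t - p.1, p.2.2)) (by fun_prop)
    have h2 : Measurable fun p : ℝ × Space d × E => f p.2.1 p.2.2 := hfm.comp measurable_snd
    exact ((hlm.comp (measurable_snd.comp measurable_snd)).mul h1).mul h2
  have hGC : ∀ r q, r < t → |G r q| ≤ D := fun r q hr => by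
    have h1 : G r q = e (t - r) q.2 * (l q.2 * f q.1 q.2) := by rw [hG]; ring
    rw [h1, abs_mul, abs_of_pos (Real.exp_pos _)]
    exact (mul_le_of_le_one_left (abs_nonneg _) (hexp _ (by linarith))).trans (hlf q)
  have hGT : ∀ r, r < t → IsTestFunction M fun x y => G r (x, y) := fun r hr => by
    have h1 : (fun x y => G r (x, y)) = wave (fun y => l y * e (t - r) y * h y) ξ θ := by
      ext x y
      simp only [hG, hfdef, wave]
      ring
    rw [h1]
    refine isTestFunction_wave M (C := |L| * C) ?_ (fun y => ?_) hB hB0 (fun y hy => ?_) ξ θ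
    · exact (hlm.mul (hem.comp (f := fun y => (t - r, y)) (by fun_prop))).mul hh
    · rw [mul_right_comm, abs_mul, abs_of_pos (a := e _ _) (Real.exp_pos _)]
      exact (mul_le_of_le_one_right (abs_nonneg _) (hexp _ (by linarith))).trans
        (hL0 id (hC y))
    · simp [hhB y hy]
  have hGgen : ∀ r q, gen M (fun x y => G r (x, y)) q = -(l q.2 * G r q) := fun r q => by
    have h1 : (fun x y => G r (x, y)) = wave (fun y => l y * e (t - r) y * h y) ξ θ := by
      ext x y
      simp only [hG, hfdef, wave]
      ring
    rw [h1, gen_wave, ← h1]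
  have hweak : ∀ r ∈ Ioo 0 t, ∫ q, G r q ∂(k.m r) = ∫ q, G r q ∂(k.m 0) +
      ∫ p, -(l p.2.2 * G r p.2) ∂(spaceTime k.m r) +
      (∫ p, G r p.2 ∂(spaceTime k.gain r) - ∫ p, G r p.2 ∂(spaceTime k.loss r)) := by
    intro r hr
    have hr' := ht.mono hr.1.le hr.2.le
    have := (k.weak_iff hμ hMCD (hGT r hr.2) hr').1 (hW.2 _ (hGT r hr.2) r hr')
    simpa only [hGgen, Prod.mk.eta] using this
  have hGl : ∀ r q, r < t → |-(l q.2 * G r q)| ≤ |L| * D := fun r q hr => by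
    rw [abs_neg]
    exact hL0 (fun h0 => by simp [hG, hfdef, wave, h0]) (hGC r q hr)
  -- The factor `l` in `G` makes the integrand an exact derivative in `r`, so a source at time `s`
  -- yields `f` minus its heat average.
  have hdec : ∀ s q, ∫ r in s..t, G r q = f q.1 q.2 - e (t - s) q.2 * f q.1 q.2 := fun s q => by
    simp only [hG, he]
    rw [intervalIntegral.integral_mul_const, integral_exp_decay]
    ring
  have hsm : Measurable fun p : ℝ × ℝ × Space d × E => G p.1 p.2.2 :=
    hGm.comp (f := fun p : ℝ × ℝ × Space d × E => (p.1, p.2.2)) (by fun_prop)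
  have hsl : Measurable fun p : ℝ × ℝ × Space d × E => -(l p.2.2.2 * G p.1 p.2.2) :=
    ((hlm.comp (f := fun p : ℝ × ℝ × Space d × E => p.2.2.2) (by fun_prop)).mul hsm).neg
  have hfp : Measurable fun p : ℝ × Space d × E => f p.2.1 p.2.2 := hfm.comp measurable_snd
  have hep : Measurable fun p : ℝ × Space d × E => e (t - p.1) p.2.2 * f p.2.1 p.2.2 :=
    (hem.comp (f := fun p : ℝ × Space d × E => (t - p.1, p.2.2)) (by fun_prop)).mul hfp
  have hGp : Measurable fun p : ℝ × Space d × E => G p.1 p.2 := hGm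
  have hlp : Measurable fun p : ℝ × Space d × E => -(l p.2.2 * f p.2.1 p.2.2) :=
    ((hlm.comp (f := fun p : ℝ × Space d × E => p.2.2) (by fun_prop)).mul hfp).neg
  have hint : ∀ (ν : Kernel ℝ (Space d × E)) [IsSFiniteKernel ν] [IsFiniteMeasure (spaceTime ν t)]
      {u : ℝ × Space d × E → ℝ} (D : ℝ), Measurable u → (∀ p, p.1 < t → |u p| ≤ D) →
      Integrable u (spaceTime ν t) := fun ν _ _ u D hu hD =>
    Integrable.of_bound hu.aestronglyMeasurable D
      ((ae_spaceTime_mem t).mono fun p hp => hD p hp.2)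
  have hef : ∀ (q : Space d × E) {σ : ℝ}, 0 ≤ σ → |e σ q.2 * f q.1 q.2| ≤ C := fun q σ hσ => by
    rw [abs_mul, abs_of_pos (a := e _ _) (Real.exp_pos _)]
    exact (mul_le_of_le_one_left (abs_nonneg _) (hexp _ hσ)).trans (hfC q)
  have hI4 : ∀ (ν : Kernel ℝ (Space d × E)) [IsSFiniteKernel ν] [IsFiniteMeasure (spaceTime ν t)],
      ∫ r in (0 : ℝ)..t, ∫ p, G r p.2 ∂(spaceTime ν r) =
        ∫ p, f p.2.1 p.2.2 ∂(spaceTime ν t) -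
          ∫ p, e (t - p.1) p.2.2 * f p.2.1 p.2.2 ∂(spaceTime ν t) := by
    intro ν _ _
    rw [integral_integral_spaceTime ht.1 hsm (fun r p _ _ hr => hGC r p.2 hr), ← integral_sub
      (hint ν C hfp fun p _ => hfC p.2) (hint ν C hep fun p hp => hef p.2 (by linarith))]
    exact integral_congr_ae (Filter.Eventually.of_forall fun p => hdec p.1 p.2)
  have hI1 : ∫ r in (0 : ℝ)..t, ∫ q, G r q ∂(k.m r) = ∫ p, G p.1 p.2 ∂(spaceTime k.m t) :=
    (integral_spaceTime ht.1 (hint k.m D hGp fun p hp => hGC p.1 p.2 hp)).symm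
  have hI2 : ∫ r in (0 : ℝ)..t, ∫ q, G r q ∂(k.m 0) =
      ∫ q, f q.1 q.2 ∂(k.m 0) - ∫ q, e t q.2 * f q.1 q.2 ∂(k.m 0) := by
    have he0 : Measurable fun q : Space d × E => e t q.2 * f q.1 q.2 :=
      (hem.comp (f := fun q : Space d × E => (t, q.2)) (by fun_prop)).mul hfm
    rw [intervalIntegral_integral_comm _ ht.1 hGm (fun r q _ hr => hGC r q hr), ← integral_sub
      (integrable_of_abs_le hfm hfC) (integrable_of_abs_le he0 fun q => hef q ht.1)]
    refine integral_congr_ae (Filter.Eventually.of_forall fun q => ?_)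
    simpa using hdec 0 q
  -- The second integral on the right is the one in `hI1`; the two cancel.
  have hI3 : ∫ r in (0 : ℝ)..t, ∫ p, -(l p.2.2 * G r p.2) ∂(spaceTime k.m r) =
      ∫ p, -(l p.2.2 * f p.2.1 p.2.2) ∂(spaceTime k.m t) + ∫ p, G p.1 p.2 ∂(spaceTime k.m t) := by
    rw [integral_integral_spaceTime ht.1 hsl (fun r p _ _ hr => hGl r p.2 hr), ← integral_add
      (hint k.m D hlp fun p _ => by rw [abs_neg]; exact hlf p.2)
      (hint k.m D hGp fun p hp => hGC p.1 p.2 hp)]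
    refine integral_congr_ae (Filter.Eventually.of_forall fun p => ?_)
    simp only
    rw [intervalIntegral.integral_neg, intervalIntegral.integral_const_mul, hdec]
    simp only [hG]
    ring
  have hsum : ∫ r in (0 : ℝ)..t, ∫ q, G r q ∂(k.m r) = ∫ r in (0 : ℝ)..t,
      (∫ q, G r q ∂(k.m 0) + ∫ p, -(l p.2.2 * G r p.2) ∂(spaceTime k.m r) +
        (∫ p, G r p.2 ∂(spaceTime k.gain r) - ∫ p, G r p.2 ∂(spaceTime k.loss r))) := by
    simp_rw [intervalIntegral.integral_of_le ht.1, integral_Ioc_eq_integral_Ioo]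
    exact setIntegral_congr_fun measurableSet_Ioo hweak
  have i2 := intervalIntegrable_integral (k.m 0) ht.1 hGm (fun r q _ hr => hGC r q hr)
  have i3 := intervalIntegrable_integral_spaceTime (ν := k.m)
    (G := fun r p => -(l p.2.2 * G r p.2)) ht.1 hsl
    (fun r p _ _ hr => hGl r p.2 hr)
  have i4 := intervalIntegrable_integral_spaceTime (ν := k.gain)
    (G := fun r p => G r p.2) ht.1 hsm
    (fun r p _ _ hr => hGC r p.2 hr)
  have i5 := intervalIntegrable_integral_spaceTime (ν := k.loss)
    (G := fun r p => G r p.2) ht.1 hsm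
    (fun r p _ _ hr => hGC r p.2 hr)
  rw [intervalIntegral.integral_add (i2.add i3) (i4.sub i5), intervalIntegral.integral_add i2 i3,
    intervalIntegral.integral_sub i4 i5, hI1, hI2, hI3, hI4, hI4] at hsum
  have hwt := (k.weak_iff hμ hMCD hf ht).1 (hW.2 _ hf t ht)
  simp only [hfdef, gen_wave] at hwt
  have hav : ∀ (ν : Kernel ℝ (Space d × E)) [IsSFiniteKernel ν],
      ∫ p, heatAvg M (t - p.1) (Function.uncurry f) p.2 ∂(spaceTime ν t) =
        ∫ p, e (t - p.1) p.2.2 * f p.2.1 p.2.2 ∂(spaceTime ν t) := fun ν _ => by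
    refine integral_congr_ae ((ae_spaceTime_mem t).mono fun p hp => ?_)
    exact heatAvg_wave M h ξ θ (by linarith [hp.2]) p.2
  have hav0 : ∫ q, heatAvg M t (Function.uncurry f) q ∂(k.m 0) =
      ∫ q, e t q.2 * f q.1 q.2 ∂(k.m 0) :=
    integral_congr_ae (Filter.Eventually.of_forall fun q => heatAvg_wave M h ξ θ ht.1 q)
  rw [hav, hav, hav0]
  linarith

/-- Waves identify the two finite measures on rectangles whose types have masses in a compact
interval. Since `m > 0`, such intervals exhaust `E`, and continuity from below gives all rectangles.
-/
theorem IsWeakSolution.mildEquation (hW : IsWeakSolution M T μ) (hμ : IsProcess T μ) :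
    MildEquation M T μ := by
  have hMCD := hW.1
  obtain ⟨k⟩ := hμ.nonempty_processKernels hMCD
  refine k.mildEquation_iff.2 fun t ht0 ht => ?_
  have := k.isSFiniteKernel_gain
  have := k.isSFiniteKernel_loss
  obtain ⟨-, h1, h2⟩ := k.isFiniteMeasure_spaceTime hμ hMCD ht
  have : IsFiniteMeasure (k.m t) := ⟨k.m_fin t⟩
  have : IsFiniteMeasure (k.m 0) := ⟨k.m_fin 0⟩
  have := isFiniteMeasure_heatFlow M ht0 (k.m 0)
  have := isFiniteMeasure_duhamel M k.gain t
  have := isFiniteMeasure_duhamel M k.loss t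
  refine Measure.ext_prod fun {S A} hS hA => ?_
  set J : ℕ → Set E := fun n => A ∩ M.m ⁻¹' Icc ((n + 1 : ℝ)⁻¹) (n + 1) with hJ
  have hJm : ∀ n, MeasurableSet (J n) := fun n => hA.inter (M.measurable_m measurableSet_Icc)
  have hn0 : ∀ n : ℕ, (0 : ℝ) < (n + 1 : ℝ)⁻¹ := fun n => by positivity
  have hJeq : ∀ n, (k.m t + duhamel M k.loss t) (S ×ˢ J n) =
      (heatFlow M t (k.m 0) + duhamel M k.gain t) (S ×ˢ J n) := by
    intro n
    refine eq_of_integral_wave_eq (hJm n) (fun ξ θ => ?_) hS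
    have hi : Measurable ((J n).indicator (1 : E → ℝ)) := measurable_one.indicator (hJm n)
    have hle : ∀ y, |(J n).indicator (1 : E → ℝ) y| ≤ 1 := fun y => by
      by_cases hy : y ∈ J n <;> simp [hy]
    have hw := measurable_wave hi ξ θ
    have hb : ∀ q : Space d × E, |Function.uncurry (wave ((J n).indicator 1) ξ θ) q| ≤ 1 :=
      fun q => abs_wave_le hle ξ θ q.1 q.2
    have h := hW.integral_wave hμ k ht hi hle isCompact_Icc
      (fun r hr => (hn0 n).trans_le hr.1) (fun y hy => indicator_of_notMem (fun h => hy h.2) _) ξ θ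
    rw [← integral_duhamel M _ _ hw hb, ← integral_duhamel M _ _ hw hb,
      ← integral_heatFlow M ht0 _ hw hb] at h
    have i : ∀ (ρ : Measure (Space d × E)) [IsFiniteMeasure ρ],
        Integrable (fun q : Space d × E => wave ((J n).indicator 1) ξ θ q.1 q.2) ρ :=
      fun ρ _ => integrable_of_abs_le hw hb
    rw [integral_add_measure (i _) (i _), integral_add_measure (i _) (i _)]
    exact h
  have hmono : Monotone fun n => S ×ˢ J n := fun n n' hnn => by
    have : (n : ℝ) ≤ n' := Nat.cast_le.2 hnn
    refine prod_mono le_rfl (inter_subset_inter le_rfl (preimage_mono (Icc_subset_Icc ?_ ?_)))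
    · gcongr
    · gcongr
  have hU : ⋃ n, S ×ˢ J n = S ×ˢ A := by
    rw [← prod_iUnion, ← inter_iUnion, ← preimage_iUnion]
    congr 1
    refine inter_eq_left.2 fun y _ => mem_preimage.2 (mem_iUnion.2 ?_)
    obtain ⟨n, hn⟩ := exists_nat_gt (max (M.m y) (M.m y)⁻¹)
    have h1 := (le_max_left _ _).trans_lt hn
    have h2 := (le_max_right _ _).trans_lt hn
    exact ⟨n, inv_le_of_inv_le₀ (M.m_pos y) (by linarith), by linarith⟩
  rw [← hU]
  refine tendsto_nhds_unique (tendsto_measure_iUnion_atTop hmono) ?_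
  refine (tendsto_measure_iUnion_atTop hmono).congr fun n => ?_
  exact (hJeq n).symm

end


/-! ### Gaussian processes in `ℝ^d` -/

section
variable {Ω : Type*} [MeasurableSpace Ω] {P : Measure Ω} {S : Type*} {X Y : S → Ω → Space d}

theorem memLp_coord {U : Ω → Space d} (hU : HasGaussianLaw U P) (i : Fin d) :
    MemLp (fun ω => U ω i) 2 P :=
  (hU.map_fun (EuclideanSpace.proj i : Space d →L[ℝ] ℝ)).memLp_two

/-- In coordinates, the mean and variance of a functional of a Gaussian vector involve only
coordinate means and covariances, so these determine the law. -/
theorem pi_dual_apply {ι : Type*} [Fintype ι] [DecidableEq ι] (L : (ι → Space d) →L[ℝ] ℝ)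
    (v : ι → Space d) :
    L v = ∑ p : ι × Fin d, L (Pi.single p.1 (EuclideanSpace.single p.2 1)) * v p.1 p.2 := by
  have h1 : v = ∑ p : ι × Fin d, v p.1 p.2 • Pi.single p.1 (EuclideanSpace.single p.2 (1 : ℝ)) := by
    ext i j
    rw [Finset.sum_apply, WithLp.ofLp_sum, Finset.sum_apply, Fintype.sum_prod_type,
      Finset.sum_eq_single i, Finset.sum_eq_single j]
    · simp
    · intro j' _ hj
      simp [hj.symm]
    · simp
    · intro i' _ hi
      simp [hi.symm]
    · simp
  conv_lhs => rw [h1]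
  rw [map_sum]
  refine Finset.sum_congr rfl fun p _ => ?_
  rw [map_smul, smul_eq_mul, mul_comm]

/-- Gaussian processes with the same means and covariances have the same law. -/
theorem map_eq_of_covariance_eq (hX : IsGaussianProcess X P) (hY : IsGaussianProcess Y P)
    (hXm : ∀ s, Measurable (X s)) (hYm : ∀ s, Measurable (Y s))
    (hm : ∀ s i, ∫ ω, X s ω i ∂P = ∫ ω, Y s ω i ∂P)
    (hc : ∀ s t i j, cov[fun ω => X s ω i, fun ω => X t ω j; P] =
      cov[fun ω => Y s ω i, fun ω => Y t ω j; P]) :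
    P.map (fun ω s => X s ω) = P.map fun ω s => Y s ω := by
  classical
  have hP := hX.isProbabilityMeasure
  refine (map_eq_iff_forall_finset_map_restrict_eq (measurable_pi_lambda _ hXm).aemeasurable
    (measurable_pi_lambda _ hYm).aemeasurable).2 fun I => Measure.ext_of_charFunDual ?_
  ext L
  have key : ∀ Z : S → Ω → Space d, IsGaussianProcess Z P → (∀ s, Measurable (Z s)) →
      charFunDual (P.map fun ω => I.restrict (Z · ω)) L = Complex.exp
        ((∑ p : I × Fin d, L (Pi.single p.1 (EuclideanSpace.single p.2 1)) *
          ∫ ω, Z p.1 ω p.2 ∂P : ℝ) * Complex.I - (∑ p : I × Fin d, ∑ q : I × Fin d,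
            L (Pi.single p.1 (EuclideanSpace.single p.2 1)) *
              (L (Pi.single q.1 (EuclideanSpace.single q.2 1)) *
                cov[fun ω => Z p.1 ω p.2, fun ω => Z q.1 ω q.2; P]) : ℝ) / 2) := by
    intro Z hZ hZm
    have hL : ∀ p : I × Fin d, MemLp (fun ω => Z p.1 ω p.2) 2 P := fun p =>
      memLp_coord (hZ.hasGaussianLaw_eval _) _
    have e : (fun ω => L (I.restrict (Z · ω))) = fun ω => ∑ p : I × Fin d,
        L (Pi.single p.1 (EuclideanSpace.single p.2 1)) * Z p.1 ω p.2 := by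
      ext ω
      exact pi_dual_apply L _
    rw [(hZ.hasGaussianLaw I).charFunDual_map_eq_fun, e, integral_finsetSum _ fun p _ =>
      ((hL p).integrable one_le_two).const_mul _, ← covariance_self
      (Measurable.aemeasurable (by fun_prop)), covariance_fun_sum_fun_sum
      (fun p => (hL p).const_mul _) fun p => (hL p).const_mul _]
    simp_rw [integral_const_mul, covariance_const_mul_left, covariance_const_mul_right]
  rw [key X hX hXm, key Y hY hYm]
  simp_rw [hm, hc]

end

/-! ### The Brownian bridge -/

section
variable {Ω : Type*} [MeasurableSpace Ω] {P : Measure Ω} {b : ℝ → Ω → Space d}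

namespace IsBrownianBridge

theorem isProbabilityMeasure (hb : IsBrownianBridge b P) : IsProbabilityMeasure P :=
  hb.gaussian.isProbabilityMeasure

theorem hasGaussianLaw (hb : IsBrownianBridge b P) {τ : ℝ} (hτ : τ ∈ Icc (0 : ℝ) 1) :
    HasGaussianLaw (b τ) P :=
  hb.gaussian.hasGaussianLaw_eval ⟨τ, hτ⟩

theorem covariance_eq (hb : IsBrownianBridge b P) {σ τ : ℝ} (hσ : σ ∈ Icc (0 : ℝ) 1)
    (hτ : τ ∈ Icc (0 : ℝ) 1) (i j : Fin d) :
    cov[fun ω => b σ ω i, fun ω => b τ ω j; P] = if i = j then min σ τ - σ * τ else 0 := by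
  have := hb.isProbabilityMeasure
  rw [covariance_eq_sub (memLp_coord (hb.hasGaussianLaw hσ) i)
    (memLp_coord (hb.hasGaussianLaw hτ) j), hb.mean σ hσ, zero_mul, sub_zero]
  rcases le_total σ τ with h | h
  · rw [min_eq_left h]
    refine (hb.covariance σ hσ τ hτ h i j).trans ?_
    congr 1
    ring
  · rw [min_eq_right h]
    simp_rw [Pi.mul_apply, mul_comm (b σ _ i)]
    refine (hb.covariance τ hτ σ hσ h j i).trans ?_
    simp_rw [eq_comm (a := i)]
    congr 1
    ring

/-- The rescaled part of a Brownian bridge before time `ρ`. -/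
noncomputable def _root_.CoagDiff.bridgeBefore (b : ℝ → Ω → Space d) (ρ τ : ℝ) (ω : Ω) : Space d :=
  (√ρ)⁻¹ • (b (ρ * τ) ω - τ • b ρ ω)

theorem map_eval (hb : IsBrownianBridge b P) {ρ : ℝ} (hρ : ρ ∈ Icc (0 : ℝ) 1) :
    P.map (b ρ) = (stdGaussian (Space d)).map fun z => √(ρ * (1 - ρ)) • z := by
  have := hb.isProbabilityMeasure
  have h0 : 0 ≤ ρ * (1 - ρ) := mul_nonneg hρ.1 (by linarith [hρ.2])
  refine Measure.ext_of_charFun (funext fun t => ?_)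
  have hL : ∀ i, MemLp (fun ω => b ρ ω i) 2 P := fun i => memLp_coord (hb.hasGaussianLaw hρ) i
  have e : (fun ω => inner ℝ t (b ρ ω)) = fun ω => ∑ i, t i * b ρ ω i := by
    ext ω
    simp [PiLp.inner_apply, mul_comm]
  have hbm := hb.measurable ρ hρ
  rw [(hb.hasGaussianLaw hρ).charFun_map_eq, charFun_map_smul, charFun_stdGaussian, e,
    integral_finsetSum _ fun i _ => ((hL i).integrable one_le_two).const_mul _, ← covariance_self
      (Measurable.aemeasurable (by fun_prop)), covariance_fun_sum_fun_sum
      (fun i => (hL i).const_mul _) fun i => (hL i).const_mul _]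
  simp_rw [integral_const_mul, covariance_const_mul_left, covariance_const_mul_right,
    hb.covariance_eq hρ hρ, hb.mean ρ hρ]
  congr 1
  have h2 : ‖√(ρ * (1 - ρ)) • t‖ ^ 2 = ρ * (1 - ρ) * ∑ i, t i * t i := by
    rw [norm_smul, mul_pow, Real.norm_eq_abs, sq_abs, Real.sq_sqrt h0, EuclideanSpace.norm_sq_eq]
    simp_rw [Real.norm_eq_abs, sq_abs, pow_two]
  rw [← Complex.ofReal_pow, h2]
  simp only [mul_zero, Finset.sum_const_zero, Complex.ofReal_zero, zero_mul, zero_sub, mul_ite,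
    Finset.sum_ite_eq, Finset.mem_univ, if_true, min_self]
  rw [Finset.mul_sum, neg_div]
  congr 3
  refine Finset.sum_congr rfl fun i _ => ?_
  ring

section
variable {ρ : ℝ}

theorem mul_mem (hρ : ρ ∈ Ioc (0 : ℝ) 1)
    {τ : ℝ} (hτ : τ ∈ Icc (0 : ℝ) 1) : ρ * τ ∈ Icc (0 : ℝ) 1 :=
  ⟨mul_nonneg hρ.1.le hτ.1, mul_le_one₀ hρ.2 hτ.1 hτ.2⟩

/-- Every variable here is a linear function of at most two values of the bridge. Joint Gaussianity
is what turns zero covariance into independence below. -/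
theorem isGaussianProcess_sum (hρ : ρ ∈ Ioc (0 : ℝ) 1) (hb : IsBrownianBridge b P) :
    IsGaussianProcess (Sum.elim (fun _ : Unit => b ρ)
      fun τ : Icc (0 : ℝ) 1 => bridgeBefore b ρ τ) P := by
  classical
  have hρ' : ρ ∈ Icc (0 : ℝ) 1 := ⟨hρ.1.le, hρ.2⟩
  refine hb.gaussian.of_isGaussianProcess fun s => ?_
  rcases s with s | τ
  · exact ⟨{⟨ρ, hρ'⟩}, ContinuousLinearMap.proj ⟨⟨ρ, hρ'⟩, by simp⟩, fun ω => rfl⟩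
  · set I : Finset (Icc (0 : ℝ) 1) := {⟨ρ * τ, mul_mem hρ τ.2⟩, ⟨ρ, hρ'⟩} with hI
    have h1 : (⟨ρ * τ, mul_mem hρ τ.2⟩ : Icc (0 : ℝ) 1) ∈ I := by simp [hI]
    have h2 : (⟨ρ, hρ'⟩ : Icc (0 : ℝ) 1) ∈ I := by simp [hI]
    clear_value I
    refine ⟨I, (√ρ)⁻¹ • ((ContinuousLinearMap.proj ⟨_, h1⟩ : (I → Space d) →L[ℝ] Space d) -
      (τ : ℝ) • (ContinuousLinearMap.proj ⟨_, h2⟩ : (I → Space d) →L[ℝ] Space d)), fun ω => ?_⟩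
    simp [bridgeBefore]

theorem measurable_bridgeBefore (hρ : ρ ∈ Ioc (0 : ℝ) 1)
    (hb : IsBrownianBridge b P) {τ : ℝ} (hτ : τ ∈ Icc (0 : ℝ) 1) :
    Measurable (bridgeBefore b ρ τ) := by
  have h1 := hb.measurable _ (mul_mem hρ hτ)
  have h2 := hb.measurable ρ ⟨hρ.1.le, hρ.2⟩
  unfold bridgeBefore
  fun_prop

theorem hasGaussianLaw_bridgeBefore (hρ : ρ ∈ Ioc (0 : ℝ) 1)
    (hb : IsBrownianBridge b P) {τ : ℝ} (hτ : τ ∈ Icc (0 : ℝ) 1) :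
    HasGaussianLaw (bridgeBefore b ρ τ) P :=
  (isGaussianProcess_sum hρ hb).hasGaussianLaw_eval (Sum.inr ⟨τ, hτ⟩)

theorem integral_bridgeBefore (hρ : ρ ∈ Ioc (0 : ℝ) 1)
    (hb : IsBrownianBridge b P) {τ : ℝ} (hτ : τ ∈ Icc (0 : ℝ) 1)
    (i : Fin d) : ∫ ω, bridgeBefore b ρ τ ω i ∂P = 0 := by
  have := hb.isProbabilityMeasure
  have hρ' : ρ ∈ Icc (0 : ℝ) 1 := ⟨hρ.1.le, hρ.2⟩
  simp only [bridgeBefore, PiLp.smul_apply, PiLp.sub_apply, smul_eq_mul]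
  rw [integral_const_mul, integral_sub, integral_const_mul, hb.mean _ (mul_mem hρ hτ),
    hb.mean _ hρ']
  · simp
  · exact (memLp_coord (hb.hasGaussianLaw (mul_mem hρ hτ)) i).integrable one_le_two
  · exact ((memLp_coord (hb.hasGaussianLaw hρ') i).integrable one_le_two).const_mul _

/-- Before normalization the covariance is `ρ (min σ τ - στ)`; the factor `(√ρ)⁻¹` restores the
standard bridge. -/
theorem covariance_bridgeBefore (hρ : ρ ∈ Ioc (0 : ℝ) 1)
    (hb : IsBrownianBridge b P) {σ τ : ℝ} (hσ : σ ∈ Icc (0 : ℝ) 1)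
    (hτ : τ ∈ Icc (0 : ℝ) 1) (i j : Fin d) :
    cov[fun ω => bridgeBefore b ρ σ ω i, fun ω => bridgeBefore b ρ τ ω j; P] =
      if i = j then min σ τ - σ * τ else 0 := by
  have := hb.isProbabilityMeasure
  have hρ' : ρ ∈ Icc (0 : ℝ) 1 := ⟨hρ.1.le, hρ.2⟩
  have m1 : ∀ i, MemLp (fun ω => b (ρ * σ) ω i) 2 P :=
    memLp_coord (hb.hasGaussianLaw (mul_mem hρ hσ))
  have m2 : ∀ i, MemLp (fun ω => b (ρ * τ) ω i) 2 P :=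
    memLp_coord (hb.hasGaussianLaw (mul_mem hρ hτ))
  have m3 : ∀ i, MemLp (fun ω => b ρ ω i) 2 P :=
    memLp_coord (hb.hasGaussianLaw hρ')
  have m4 : MemLp (fun ω => b (ρ * τ) ω j - τ * b ρ ω j) 2 P := (m2 j).sub ((m3 j).const_mul _)
  simp only [bridgeBefore, PiLp.smul_apply, PiLp.sub_apply, smul_eq_mul]
  rw [covariance_const_mul_left, covariance_const_mul_right,
    covariance_fun_sub_left (m1 i) ((m3 i).const_mul _) m4,
    covariance_fun_sub_right (m1 i) (m2 j) ((m3 j).const_mul _),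
    covariance_fun_sub_right ((m3 i).const_mul _) (m2 j) ((m3 j).const_mul _)]
  simp_rw [covariance_const_mul_left, covariance_const_mul_right]
  rw [hb.covariance_eq (mul_mem hρ hσ) (mul_mem hρ hτ), hb.covariance_eq (mul_mem hρ hσ) hρ',
    hb.covariance_eq hρ' (mul_mem hρ hτ), hb.covariance_eq hρ' hρ', ← mul_min_of_nonneg _ _ hρ.1.le,
    min_eq_left (mul_le_of_le_one_right hρ.1.le hσ.2),
    min_eq_right (mul_le_of_le_one_right hρ.1.le hτ.2), min_self]
  split_ifs
  · have h1 : (√ρ)⁻¹ * (√ρ)⁻¹ = ρ⁻¹ := by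
      rw [← mul_inv, Real.mul_self_sqrt hρ.1.le]
    rw [← mul_assoc, h1]
    have := hρ.1.ne'
    field_simp
    ring
  · simp

/-- `τ b_ρ` is the linear regression of `b_{ρτ}` on `b_ρ`: both covariances with `b_ρ` equal `ρτ(1 -
ρ)`, so the difference is uncorrelated with `b_ρ`. -/
theorem indepFun_bridgeBefore (hρ : ρ ∈ Ioc (0 : ℝ) 1) (hb : IsBrownianBridge b P) :
    IndepFun (fun ω (_ : Unit) => b ρ ω) (fun ω (τ : Icc (0 : ℝ) 1) => bridgeBefore b ρ τ ω) P := by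
  have := hb.isProbabilityMeasure
  have hρ' : ρ ∈ Icc (0 : ℝ) 1 := ⟨hρ.1.le, hρ.2⟩
  have m3 : ∀ i, MemLp (fun ω => b ρ ω i) 2 P :=
    memLp_coord (hb.hasGaussianLaw hρ')
  refine (isGaussianProcess_sum hρ hb).indepFun_of_covariance_inner
    (fun _ => (hb.measurable ρ hρ').aemeasurable)
    (fun τ => (measurable_bridgeBefore hρ hb τ.2).aemeasurable) fun _ τ x y => ?_
  have m1 : ∀ i, MemLp (fun ω => bridgeBefore b ρ τ ω i) 2 P :=
    memLp_coord (hasGaussianLaw_bridgeBefore hρ hb τ.2)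
  have m2 : ∀ i, MemLp (fun ω => b (ρ * τ) ω i) 2 P :=
    memLp_coord (hb.hasGaussianLaw (mul_mem hρ τ.2))
  have e : ∀ (x v : Space d), inner ℝ x v = ∑ i, x i * v i := fun x v => by
    simp [PiLp.inner_apply, mul_comm]
  simp_rw [e]
  rw [covariance_fun_sum_fun_sum (fun i => (m3 i).const_mul _) fun i => (m1 i).const_mul _]
  refine Finset.sum_eq_zero fun i _ => Finset.sum_eq_zero fun j _ => ?_
  rw [covariance_const_mul_left, covariance_const_mul_right]
  simp only [bridgeBefore, PiLp.smul_apply, PiLp.sub_apply, smul_eq_mul]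
  rw [covariance_const_mul_right, covariance_fun_sub_right (m3 i) (m2 j) ((m3 j).const_mul _),
    covariance_const_mul_right, hb.covariance_eq hρ' (mul_mem hρ τ.2), hb.covariance_eq hρ' hρ',
    min_eq_right (mul_le_of_le_one_right hρ.1.le τ.2.2), min_self]
  split_ifs
  · ring
  · simp

/-- The law of a Brownian bridge at time `ρ` and of its rescaled part before time `ρ`. -/
theorem lintegral_bridgeBefore (hρ : ρ ∈ Ioc (0 : ℝ) 1) (hb : IsBrownianBridge b P)
    {Φ : Space d × (Icc (0 : ℝ) 1 → Space d) → ℝ≥0∞} (hΦ : Measurable Φ) :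
    ∫⁻ ω, Φ (b ρ ω, fun τ => bridgeBefore b ρ τ ω) ∂P =
      ∫⁻ z, (∫⁻ ω, Φ (√(ρ * (1 - ρ)) • z, fun τ => b τ ω) ∂P) ∂(stdGaussian (Space d)) := by
  have := hb.isProbabilityMeasure
  have hρ' : ρ ∈ Icc (0 : ℝ) 1 := ⟨hρ.1.le, hρ.2⟩
  have hbρ := hb.measurable ρ hρ'
  have hB : Measurable fun ω (τ : Icc (0 : ℝ) 1) => b τ ω :=
    measurable_pi_lambda _ fun τ => hb.measurable τ τ.2
  have hB' : Measurable fun ω (τ : Icc (0 : ℝ) 1) => bridgeBefore b ρ τ ω :=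
    measurable_pi_lambda _ fun τ => measurable_bridgeBefore hρ hb τ.2
  have hind : IndepFun (b ρ) (fun ω (τ : Icc (0 : ℝ) 1) => bridgeBefore b ρ τ ω) P :=
    (indepFun_bridgeBefore hρ hb).comp (measurable_pi_apply ()) measurable_id
  have hlaw : P.map (fun ω (τ : Icc (0 : ℝ) 1) => bridgeBefore b ρ τ ω) =
      P.map fun ω (τ : Icc (0 : ℝ) 1) => b τ ω := by
    refine map_eq_of_covariance_eq ?_ hb.gaussian (fun τ => measurable_bridgeBefore hρ hb τ.2)
      (fun τ => hb.measurable τ τ.2) (fun τ i => ?_) fun σ τ i j => ?_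
    · exact (isGaussianProcess_sum hρ hb).comp_right Sum.inr
    · rw [integral_bridgeBefore hρ hb τ.2, hb.mean _ τ.2]
    · rw [covariance_bridgeBefore hρ hb σ.2 τ.2, hb.covariance_eq σ.2 τ.2]
  have hmap := (indepFun_iff_map_prod_eq_prod_map_map hbρ.aemeasurable hB'.aemeasurable).1 hind
  rw [hlaw, map_eval hb hρ'] at hmap
  have h1 : ∫⁻ ω, Φ (b ρ ω, fun τ => bridgeBefore b ρ τ ω) ∂P =
      ∫⁻ p, Φ p ∂(P.map fun ω => (b ρ ω, fun τ : Icc (0 : ℝ) 1 => bridgeBefore b ρ τ ω)) :=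
    (lintegral_map hΦ (hbρ.prodMk hB')).symm
  have : IsProbabilityMeasure (P.map fun ω (τ : Icc (0 : ℝ) 1) => b τ ω) :=
    Measure.isProbabilityMeasure_map hB.aemeasurable
  rw [h1, hmap, lintegral_prod _ hΦ.aemeasurable,
    lintegral_map hΦ.lintegral_prod_right' (by fun_prop)]
  refine lintegral_congr fun z => ?_
  exact lintegral_map (hΦ.comp measurable_prodMk_left) hB

end

end IsBrownianBridge

end


/-! ### Evaluation of continuous paths -/

/-- The value at `θ` of a continuous path, as a measurable function of the path in the product
space. -/
noncomputable def pathEval (θ : ℝ) (v : Icc (0 : ℝ) 1 → Space d) : Space d :=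
  Filter.limUnder Filter.atTop fun n : ℕ => v (projIcc 0 1 zero_le_one (⌊θ * n⌋₊ / n))

/-- For each `n` only countably many coordinates are read, so the map is measurable jointly in time
and path for the product σ-algebra, on which the Gaussian laws are compared. -/
theorem measurable_pathEval :
    Measurable fun p : ℝ × (Icc (0 : ℝ) 1 → Space d) => pathEval p.1 p.2 := by
  refine (StronglyMeasurable.limUnder fun n => Measurable.stronglyMeasurable ?_).measurable
  have h1 : Measurable fun p : ℕ × (Icc (0 : ℝ) 1 → Space d) =>
      p.2 (projIcc 0 1 zero_le_one (p.1 / n)) :=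
    measurable_from_prod_countable_right fun k => by
      exact measurable_pi_apply (projIcc 0 1 zero_le_one ((k : ℝ) / n))
  exact h1.comp (f := fun p : ℝ × (Icc (0 : ℝ) 1 → Space d) => (⌊p.1 * n⌋₊, p.2))
    ((Nat.measurable_floor.comp (measurable_fst.mul_const _)).prodMk measurable_snd)

theorem pathEval_eq {w : ℝ → Space d} (hw : ContinuousOn w (Icc 0 1)) {θ : ℝ}
    (hθ : θ ∈ Icc (0 : ℝ) 1) : pathEval θ (fun τ => w τ) = w θ := by
  refine Filter.Tendsto.limUnder_eq ?_
  have h1 : Filter.Tendsto (fun n : ℕ => (⌊θ * n⌋₊ / n : ℝ)) Filter.atTop (nhds θ) :=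
    (tendsto_nat_floor_mul_div_atTop hθ.1).comp tendsto_natCast_atTop_atTop
  have h2 : Continuous fun r : ℝ => w (projIcc 0 1 zero_le_one r) :=
    (continuousOn_iff_continuous_domRestrict.1 hw).comp continuous_projIcc
  have h3 := (h2.tendsto θ).comp h1
  rw [projIcc_of_mem _ hθ] at h3
  exact h3

/-! ### The exponential of an integral -/

theorem EReal_exp_neg_coe {c : ℝ≥0∞} (hc : c ≠ ∞) :
    EReal.exp (-(c : EReal)) = ENNReal.ofReal (Real.exp (-c.toReal)) := by
  lift c to ℝ≥0 using hc
  rfl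

theorem abs_exp_neg_sub_le {a b : ℝ} (ha : 0 ≤ a) (hb : 0 ≤ b) :
    |Real.exp (-a) - Real.exp (-b)| ≤ |a - b| := by
  wlog hab : a ≤ b generalizing a b
  · rw [abs_sub_comm, abs_sub_comm a]
    exact this hb ha (le_of_not_ge hab)
  have h1 : Real.exp (-b) = Real.exp (-a) * Real.exp (-(b - a)) := by
    rw [← Real.exp_add]; congr 1; ring
  have h2 := Real.add_one_le_exp (-(b - a))
  have h3 : Real.exp (-a) ≤ 1 := Real.exp_le_one_iff.2 (by linarith)
  have h4 : Real.exp (-(b - a)) ≤ 1 := Real.exp_le_one_iff.2 (by linarith)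
  rw [abs_of_nonneg (by nlinarith [Real.exp_pos (-a)]), abs_of_nonpos (by linarith), h1]
  nlinarith [Real.exp_pos (-a)]

/-- `g` is merely measurable, but bounded, so `r ↦ exp(-∫_s^r g)` is Lipschitz on `[s, t]`. Hence it
is absolutely continuous and the integral of its a.e. derivative `-g exp(-∫_s^r g)`. -/
theorem exp_neg_integral_add {g : ℝ → ℝ} (hg : Measurable g) (hg0 : ∀ r, 0 ≤ g r) {D s t : ℝ}
    (hgD : ∀ r, g r ≤ D) (hst : s ≤ t) :
    Real.exp (-∫ r in s..t, g r) + ∫ r in s..t, g r * Real.exp (-∫ u in s..r, g u) = 1 := by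
  have hgi : ∀ a b, IntervalIntegrable g volume a b := fun a b => by
    refine (intervalIntegrable_const (c := D)).mono_fun hg.aestronglyMeasurable
      (Filter.Eventually.of_forall fun r => ?_)
    simp only [Real.norm_eq_abs, abs_of_nonneg (hg0 r)]
    exact (hgD r).trans (le_abs_self D)
  have hD : 0 ≤ D := (hg0 0).trans (hgD 0)
  set J : ℝ → ℝ := fun r => ∫ u in s..r, g u with hJ
  have hJ0 : ∀ r ∈ uIcc s t, 0 ≤ J r := fun r hr => by
    rw [uIcc_of_le hst] at hr
    exact intervalIntegral.integral_nonneg hr.1 fun u _ => hg0 u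
  have hlip : LipschitzOnWith D.toNNReal (fun r => Real.exp (-J r)) (uIcc s t) := by
    refine LipschitzOnWith.of_dist_le_mul fun r hr r' hr' => ?_
    rw [Real.dist_eq, Real.dist_eq, Real.coe_toNNReal _ hD]
    refine (abs_exp_neg_sub_le (hJ0 r hr) (hJ0 r' hr')).trans ?_
    rw [hJ]
    simp only
    rw [intervalIntegral.integral_interval_sub_left (hgi _ _) (hgi _ _), ← Real.norm_eq_abs]
    refine intervalIntegral.norm_integral_le_of_norm_le_const fun u _ => ?_
    rw [Real.norm_eq_abs, abs_of_nonneg (hg0 u)]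
    exact hgD u
  have hftc := hlip.absolutelyContinuousOnInterval.integral_deriv_eq_sub
  have hderiv : ∫ r in s..t, deriv (fun r => Real.exp (-J r)) r =
      ∫ r in s..t, -(g r * Real.exp (-J r)) := by
    refine intervalIntegral.integral_congr_ae ?_
    filter_upwards [(hgi s t).ae_hasDerivAt_integral] with r hr hrm
    have h := (hr (uIoc_subset_uIcc hrm) s left_mem_uIcc).neg.exp
    have h' : HasDerivAt (fun r => Real.exp (-J r)) (Real.exp (-J r) * -g r) r := h
    rw [h'.deriv]
    ring
  rw [hderiv, intervalIntegral.integral_neg] at hftc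
  have hs : J s = 0 := by simp [hJ]
  rw [hs] at hftc
  simp only [neg_zero, Real.exp_zero] at hftc
  linarith

/-- `exp(-∫_s^t f) + ∫_s^t f(r) exp(-∫_s^r f) dr = 1`. -/
theorem exp_neg_lintegral_add {f : ℝ → ℝ≥0∞} (hf : Measurable f) {D : ℝ≥0} {s t : ℝ} (hst : s ≤ t)
    (hD : ∀ᵐ r, r ∈ Ioo s t → f r ≤ D) :
    EReal.exp (-((∫⁻ r in Ioo s t, f r : ℝ≥0∞) : EReal)) +
      ∫⁻ r in Ioo s t, f r * EReal.exp (-((∫⁻ u in Ioo s r, f u : ℝ≥0∞) : EReal)) = 1 := by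
  -- The truncation changes `f` only on a null subset of `(s, t)` and gives a real function bounded
  -- everywhere.
  set g : ℝ → ℝ := fun r => (min (f r) D).toReal with hg
  have hgm : Measurable g := (hf.min measurable_const).ennreal_toReal
  have hg0 : ∀ r, 0 ≤ g r := fun r => ENNReal.toReal_nonneg
  have hgt : ∀ r, ENNReal.ofReal (g r) = min (f r) D := fun r =>
    ENNReal.ofReal_toReal (ne_top_of_le_ne_top ENNReal.coe_ne_top (min_le_right _ _))
  have hgD : ∀ r, g r ≤ D := fun r =>
    ENNReal.toReal_mono ENNReal.coe_ne_top (min_le_right _ _)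
  have hgi : ∀ a b, IntervalIntegrable g volume a b := fun a b => by
    refine (intervalIntegrable_const (c := (D : ℝ))).mono_fun hgm.aestronglyMeasurable
      (Filter.Eventually.of_forall fun r => ?_)
    simp only [Real.norm_eq_abs, abs_of_nonneg (hg0 r)]
    exact (hgD r).trans (le_abs_self _)
  have hI : ∀ r, s ≤ r → r ≤ t → EReal.exp (-((∫⁻ u in Ioo s r, f u : ℝ≥0∞) : EReal)) =
      ENNReal.ofReal (Real.exp (-∫ u in s..r, g u)) := by
    intro r hsr hrt
    have h1 : ∫⁻ u in Ioo s r, f u = ENNReal.ofReal (∫ u in s..r, g u) := by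
      rw [intervalIntegral.integral_of_le hsr, integral_Ioc_eq_integral_Ioo,
        ofReal_integral_eq_lintegral_ofReal
        ((intervalIntegrable_iff_integrableOn_Ioo_of_le hsr).1 (hgi s r))
        (Filter.Eventually.of_forall hg0)]
      refine setLIntegral_congr_fun_ae measurableSet_Ioo ?_
      filter_upwards [hD] with u hu hur
      rw [hgt, min_eq_left (hu ⟨hur.1, hur.2.trans_le hrt⟩)]
    rw [h1, EReal_exp_neg_coe ENNReal.ofReal_ne_top,
      ENNReal.toReal_ofReal (intervalIntegral.integral_nonneg hsr fun u _ => hg0 u)]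
  have hcont : Continuous fun r => Real.exp (-∫ u in s..r, g u) :=
    Real.continuous_exp.comp (intervalIntegral.continuous_primitive hgi s).neg
  have h2 : ∫⁻ r in Ioo s t, f r * EReal.exp (-((∫⁻ u in Ioo s r, f u : ℝ≥0∞) : EReal)) =
      ENNReal.ofReal (∫ r in s..t, g r * Real.exp (-∫ u in s..r, g u)) := by
    rw [intervalIntegral.integral_of_le hst, integral_Ioc_eq_integral_Ioo,
      ofReal_integral_eq_lintegral_ofReal
      ((intervalIntegrable_iff_integrableOn_Ioo_of_le hst).1
        ((hgi s t).mul_continuousOn hcont.continuousOn))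
      (Filter.Eventually.of_forall fun r => mul_nonneg (hg0 r) (Real.exp_pos _).le)]
    refine setLIntegral_congr_fun_ae measurableSet_Ioo ?_
    filter_upwards [hD] with r hr hrt
    rw [hI r hrt.1.le hrt.2.le, ENNReal.ofReal_mul (hg0 r), hgt, min_eq_left (hr hrt)]
  rw [h2, hI t hst le_rfl, ← ENNReal.ofReal_add (Real.exp_pos _).le
    (intervalIntegral.integral_nonneg hst fun r _ => mul_nonneg (hg0 r) (Real.exp_pos _).le),
    exp_neg_integral_add hgm hg0 hgD hst, ENNReal.ofReal_one]

/-! ### The survival factor as a function of the path -/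

/-- The position at time `r` of the bridge of diffusivity `a` from `x` at time `s` to `x'` at time
`t`, whose normalization is at `v`. -/
noncomputable def bridgePos (a s t : ℝ) (x x' : Space d) (r : ℝ) (v : Space d) : Space d :=
  x + ((r - s) / (t - s)) • (x' - x) + √(a * (t - s)) • v

/-- `exp(-∫_s^t c_r(β_r, y) dr)` as a function of the normalized path. -/
noncomputable def pathFactor (M : Model d E) (c : ℝ → Space d → E → ℝ≥0∞) (s t : ℝ) (x : Space d)
    (y : E) (x' : Space d) (v : Icc (0 : ℝ) 1 → Space d) : ℝ≥0∞ :=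
  EReal.exp (-((∫⁻ r in Ioo s t,
    c r (bridgePos (M.a y) s t x x' r (pathEval ((r - s) / (t - s)) v)) y : ℝ≥0∞) : EReal))

theorem measurable_pathRate (M : Model d E) {c : ℝ → Space d → E → ℝ≥0∞}
    (hc : Measurable fun p : ℝ × Space d × E => c p.1 p.2.1 p.2.2) :
    Measurable fun p : ((ℝ × ℝ × Space d × E × Space d) × (Icc (0 : ℝ) 1 → Space d)) × ℝ =>
      c p.2 (bridgePos (M.a p.1.1.2.2.2.1) p.1.1.1 p.1.1.2.1 p.1.1.2.2.1 p.1.1.2.2.2.2 p.2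
        (pathEval ((p.2 - p.1.1.1) / (p.1.1.2.1 - p.1.1.1)) p.1.2)) p.1.1.2.2.2.1 := by
  have ha := M.measurable_a
  have h1 : Measurable
      fun p : ((ℝ × ℝ × Space d × E × Space d) × (Icc (0 : ℝ) 1 → Space d)) × ℝ =>
        pathEval ((p.2 - p.1.1.1) / (p.1.1.2.1 - p.1.1.1)) p.1.2 :=
    measurable_pathEval.comp (f := fun p :
      ((ℝ × ℝ × Space d × E × Space d) × (Icc (0 : ℝ) 1 → Space d)) × ℝ =>
        ((p.2 - p.1.1.1) / (p.1.1.2.1 - p.1.1.1), p.1.2)) (by fun_prop)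
  refine hc.comp (f := fun p :
    ((ℝ × ℝ × Space d × E × Space d) × (Icc (0 : ℝ) 1 → Space d)) × ℝ => (p.2,
      bridgePos (M.a p.1.1.2.2.2.1) p.1.1.1 p.1.1.2.1 p.1.1.2.2.1 p.1.1.2.2.2.2 p.2
        (pathEval ((p.2 - p.1.1.1) / (p.1.1.2.1 - p.1.1.1)) p.1.2), p.1.1.2.2.2.1)) ?_
  refine measurable_snd.prodMk (Measurable.prodMk ?_ (by fun_prop))
  unfold bridgePos
  fun_prop

theorem measurable_pathFactor (M : Model d E) {c : ℝ → Space d → E → ℝ≥0∞}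
    (hc : Measurable fun p : ℝ × Space d × E => c p.1 p.2.1 p.2.2) :
    Measurable fun p : (ℝ × ℝ × Space d × E × Space d) × (Icc (0 : ℝ) 1 → Space d) =>
      pathFactor M c p.1.1 p.1.2.1 p.1.2.2.1 p.1.2.2.2.1 p.1.2.2.2.2 p.2 := by
  have hset : MeasurableSet
      {p : ((ℝ × ℝ × Space d × E × Space d) × (Icc (0 : ℝ) 1 → Space d)) × ℝ |
        p.1.1.1 < p.2 ∧ p.2 < p.1.1.2.1} :=
    (measurableSet_lt (measurable_fst.comp (measurable_fst.comp measurable_fst))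
      measurable_snd).inter (measurableSet_lt measurable_snd
        (measurable_fst.comp (measurable_snd.comp (measurable_fst.comp measurable_fst))))
  have h := ((measurable_pathRate M hc).indicator hset).lintegral_prod_right'
    (ν := (volume : Measure ℝ))
  unfold pathFactor
  refine EReal.measurable_exp.comp (Measurable.neg ?_)
  refine measurable_coe_ennreal_ereal.comp ?_
  convert h using 2 with p
  rw [← lintegral_indicator measurableSet_Ioo]
  rfl

section
variable {M : Model d E} {c : ℝ → Space d → E → ℝ≥0∞}
  {Ω : Type*} [MeasurableSpace Ω] {P : Measure Ω} {b : ℝ → Ω → Space d}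

theorem div_sub_mem_Icc {s t r : ℝ} (hr : r ∈ Ioo s t) : (r - s) / (t - s) ∈ Icc (0 : ℝ) 1 :=
  ⟨div_nonneg (by linarith [hr.1]) (by linarith [hr.1, hr.2]),
    div_le_one_of_le₀ (by linarith [hr.2]) (by linarith [hr.1, hr.2])⟩

/-- Continuity of the paths lets `pathEval` replace evaluation, so the factor is the integral of a
measurable functional of the path and depends only on its law. -/
theorem IsBrownianBridge.bridgeFactor_eq (hb : IsBrownianBridge b P) (s t : ℝ) (x : Space d)
    (y : E) (x' : Space d) : bridgeFactor M b P c s t x y x' =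
      ∫⁻ ω, pathFactor M c s t x y x' (fun τ => b τ ω) ∂P := by
  refine lintegral_congr fun ω => ?_
  rw [pathFactor]
  congr 3
  refine setLIntegral_congr_fun measurableSet_Ioo fun r hr => ?_
  simp only [bridgePos, pathEval_eq (hb.continuous ω) (div_sub_mem_Icc hr)]

theorem IsBrownianBridge.measurable_path (hb : IsBrownianBridge b P) :
    Measurable fun ω (τ : Icc (0 : ℝ) 1) => b τ ω :=
  measurable_pi_lambda _ fun τ => hb.measurable τ τ.2

theorem IsBrownianBridge.measurable_bridgeFactor (hb : IsBrownianBridge b P)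
    (hc : Measurable fun p : ℝ × Space d × E => c p.1 p.2.1 p.2.2) :
    Measurable fun p : ℝ × ℝ × Space d × E × Space d =>
      bridgeFactor M b P c p.1 p.2.1 p.2.2.1 p.2.2.2.1 p.2.2.2.2 := by
  have := hb.isProbabilityMeasure
  simp_rw [hb.bridgeFactor_eq]
  have hp := hb.measurable_path
  have h : Measurable fun p : (ℝ × ℝ × Space d × E × Space d) × Ω =>
      pathFactor M c p.1.1 p.1.2.1 p.1.2.2.1 p.1.2.2.2.1 p.1.2.2.2.2 (fun τ => b τ p.2) :=
    (measurable_pathFactor M hc).comp (measurable_fst.prodMk (hp.comp measurable_snd))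
  exact h.lintegral_prod_right'

end


/-! ### The first collision decomposition of the heat kernel -/

section
variable {M : Model d E} {c : ℝ → Space d → E → ℝ≥0∞}
  {Ω : Type*} [MeasurableSpace Ω] {P : Measure Ω} {b : ℝ → Ω → Space d}

/-- Pathwise form of the Markov property: seen up to time `r`, the bridge is a bridge to its own
position at `r`, driven by the rescaled initial part. The factor `√ρ` from `√(a(r-s)) = √(a(t-s))
√ρ` cancels the normalization in `bridgeBefore`. -/
theorem bridgePos_eq (b : ℝ → Ω → Space d) {a s r t : ℝ} (ha : 0 < a) (hr : r ∈ Ioo s t)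
    (x x' : Space d) (u : ℝ) (ω : Ω) :
    bridgePos a s t x x' u (b ((u - s) / (t - s)) ω) =
      bridgePos a s r x (bridgePos a s t x x' r (b ((r - s) / (t - s)) ω)) u
        (bridgeBefore b ((r - s) / (t - s)) ((u - s) / (r - s)) ω) := by
  have h1 : 0 < r - s := by linarith [hr.1]
  have h2 : 0 < t - s := by linarith [hr.1, hr.2]
  set ρ := (r - s) / (t - s) with hρ
  set θ := (u - s) / (r - s) with hθ
  have hρ0 : 0 < ρ := div_pos h1 h2
  have e1 : (u - s) / (t - s) = ρ * θ := by
    rw [hρ, hθ]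
    field_simp
  have e2 : √(a * (r - s)) = √(a * (t - s)) * √ρ := by
    rw [← Real.sqrt_mul (by positivity), hρ]
    congr 1
    field_simp
  have e3 : √(a * (t - s)) * √ρ * (√ρ)⁻¹ = √(a * (t - s)) := by
    have := (Real.sqrt_pos.2 hρ0).ne'
    field_simp
  unfold bridgePos bridgeBefore
  rw [← hρ, ← hθ, e1, e2, smul_smul, e3]
  module

/-- The law of a bridge at an intermediate time `r` and of its part before `r`. -/
theorem IsBrownianBridge.lintegral_bridgePos (hb : IsBrownianBridge b P) {a s r t : ℝ}
    (ha : 0 < a) (hr : r ∈ Ioo s t) (x x' : Space d)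
    {Ψ : Space d × (Icc (0 : ℝ) 1 → Space d) → ℝ≥0∞} (hΨ : Measurable Ψ) :
    ENNReal.ofReal (heatKernel (a * (t - s)) x x') *
      ∫⁻ ω, Ψ (bridgePos a s t x x' r (b ((r - s) / (t - s)) ω),
        fun τ => bridgeBefore b ((r - s) / (t - s)) τ ω) ∂P =
      ∫⁻ z, ENNReal.ofReal (heatKernel (a * (r - s)) x z) *
        (∫⁻ ω, Ψ (z, fun τ => b τ ω) ∂P) * ENNReal.ofReal (heatKernel (a * (t - r)) z x') := by
  have := hb.isProbabilityMeasure
  have h1 : 0 < r - s := by linarith [hr.1]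
  have h2 : 0 < t - s := by linarith [hr.1, hr.2]
  set ρ := (r - s) / (t - s) with hρ
  have hρ0 : 0 < ρ := div_pos h1 h2
  have hρ1 : ρ < 1 := (div_lt_one h2).2 (by linarith [hr.2])
  have hτ : 0 < a * (t - s) := mul_pos ha h2
  have hτ' : 0 < a * (t - s) * (ρ * (1 - ρ)) := by
    have : 0 < 1 - ρ := by linarith
    positivity
  have e1 : a * (t - s) * ρ = a * (r - s) := by
    rw [hρ]; field_simp
  have e2 : a * (t - s) * (1 - ρ) = a * (t - r) := by
    rw [hρ]; field_simp; ring
  have hm : Measurable fun p : Space d × (Icc (0 : ℝ) 1 → Space d) =>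
      Ψ (bridgePos a s t x x' r p.1, p.2) := by
    refine hΨ.comp (Measurable.prodMk ?_ measurable_snd)
    unfold bridgePos
    fun_prop
  have hp := hb.measurable_path
  have hG : Measurable fun z : Space d => ∫⁻ ω, Ψ (z, fun τ => b τ ω) ∂P := by
    have h : Measurable fun p : Space d × Ω => Ψ (p.1, fun τ => b τ p.2) :=
      hΨ.comp (measurable_fst.prodMk (hp.comp measurable_snd))
    exact h.lintegral_prod_right'
  rw [IsBrownianBridge.lintegral_bridgeBefore (Φ := fun p => Ψ (bridgePos a s t x x' r p.1, p.2))
    ⟨hρ0, hρ1.le⟩ hb hm]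
  -- The position at `r` is Gaussian with the mean and variance appearing in
  -- `heatKernel_mul_bridge`, which factors the two kernels through `z`.
  have e3 : ∀ z : Space d, bridgePos a s t x x' r (√(ρ * (1 - ρ)) • z) =
      (x + ρ • (x' - x)) + √(a * (t - s) * (ρ * (1 - ρ))) • z := by
    intro z
    rw [bridgePos, smul_smul, ← Real.sqrt_mul hτ.le]
  simp_rw [e3]
  rw [← lintegral_heatKernel_mul hτ' (x + ρ • (x' - x)) hG,
    ← lintegral_const_mul _ (by fun_prop)]
  refine lintegral_congr fun z => ?_
  rw [← mul_assoc, ← ENNReal.ofReal_mul (heatKernel_nonneg hτ.le _ _),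
    heatKernel_mul_bridge hτ hρ0 hρ1, e1, e2, ENNReal.ofReal_mul (heatKernel_nonneg
      (mul_pos ha h1).le _ _)]
  ring

theorem heatKernel_pos {t : ℝ} (ht : 0 < t) (x x' : Space d) : 0 < heatKernel t x x' := by
  unfold heatKernel
  positivity

/-- Average `exp_neg_lintegral_add` along the bridge and multiply by the heat kernel. The term at
time `r` involves the position at `r` and the path before `r`, whose joint law is given by
`lintegral_bridgePos`. -/
theorem IsBrownianBridge.heatKernel_eq (hb : IsBrownianBridge b P)
    (hc : Measurable fun p : ℝ × Space d × E => c p.1 p.2.1 p.2.2) {s t : ℝ} (hst : s < t)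
    (x : Space d) (y : E) (x' : Space d) {D : ℝ≥0}
    (hD : ∀ r ∈ Ioo s t, ∀ᵐ z ∂(volume : Measure (Space d)), c r z y ≤ D) :
    ENNReal.ofReal (heatKernel (M.a y * (t - s)) x x') =
      ENNReal.ofReal (heatKernel (M.a y * (t - s)) x x') * bridgeFactor M b P c s t x y x' +
      ∫⁻ r in Ioo s t, ∫⁻ z, ENNReal.ofReal (heatKernel (M.a y * (r - s)) x z) *
        bridgeFactor M b P c s r x y z * c r z y *
          ENNReal.ofReal (heatKernel (M.a y * (t - r)) z x') := by
  have := hb.isProbabilityMeasure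
  have ha := M.a_pos y
  have hp := hb.measurable_path
  have hpos := heatKernel_pos (mul_pos ha (sub_pos.2 hst)) x x'
  have hpos' : ENNReal.ofReal (heatKernel (M.a y * (t - s)) x x') ≠ 0 := by simpa using hpos
  have hrate : Measurable fun p : Ω × ℝ => c p.2 (bridgePos (M.a y) s t x x' p.2
      (pathEval ((p.2 - s) / (t - s)) fun τ => b τ p.1)) y :=
    (measurable_pathRate M hc).comp (f := fun p : Ω × ℝ =>
      (((s, t, x, y, x'), fun τ : Icc (0 : ℝ) 1 => b τ p.1), p.2))
      ((measurable_const.prodMk (hp.comp measurable_fst)).prodMk measurable_snd)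
  have heval : ∀ ω, ∀ r ∈ Ioo s t, c r (bridgePos (M.a y) s t x x' r
      (pathEval ((r - s) / (t - s)) fun τ => b τ ω)) y =
        c r (bridgePos (M.a y) s t x x' r (b ((r - s) / (t - s)) ω)) y := fun ω r hr => by
    rw [pathEval_eq (hb.continuous ω) (div_sub_mem_Icc hr)]
  -- The bound on the rate holds only off a null set of positions. At each interior time the bridge
  -- does not charge null sets, so by Fubini almost every path respects the bound at almost every
  -- time.
  have hbd : ∀ᵐ ω ∂P, ∀ᵐ r, r ∈ Ioo s t → c r (bridgePos (M.a y) s t x x' r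
      (pathEval ((r - s) / (t - s)) fun τ => b τ ω)) y ≤ D := by
    have hset : MeasurableSet {p : Ω × ℝ | p.2 ∈ Ioo s t → c p.2 (bridgePos (M.a y) s t x x' p.2
      (pathEval ((p.2 - s) / (t - s)) fun τ => b τ p.1)) y ≤ D} :=
      (measurable_snd measurableSet_Ioo).imp (measurableSet_le hrate measurable_const)
    refine (Measure.ae_ae_comm (μ := P) (ν := volume) hset).2
      (Filter.Eventually.of_forall fun r => ?_)
    by_cases hr : r ∈ Ioo s t
    swap
    · exact Filter.Eventually.of_forall fun ω h => absurd h hr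
    have hcr : Measurable fun z => c r z y :=
      hc.comp (f := fun z : Space d => (r, z, y)) (by fun_prop)
    have hbad : MeasurableSet {z : Space d | ¬ c r z y ≤ D} :=
      (measurableSet_le hcr measurable_const).compl
    have h := hb.lintegral_bridgePos (a := M.a y) ha hr x x'
      (Ψ := fun p => {z : Space d | ¬ c r z y ≤ D}.indicator 1 p.1)
      ((measurable_one.indicator hbad).comp measurable_fst)
    have h0 : ∫⁻ z, ENNReal.ofReal (heatKernel (M.a y * (r - s)) x z) *
        (∫⁻ _ω, {z : Space d | ¬ c r z y ≤ D}.indicator (1 : Space d → ℝ≥0∞) z ∂P) *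
          ENNReal.ofReal (heatKernel (M.a y * (t - r)) z x') = 0 := by
      rw [lintegral_eq_zero_iff' (by
        have := measurable_one.indicator (β := ℝ≥0∞) hbad
        refine Measurable.aemeasurable ?_
        simp only [lintegral_const, measure_univ, mul_one]
        fun_prop)]
      filter_upwards [hD r hr] with z hz
      simp [hz]
    rw [h0] at h
    have h1 := (mul_eq_zero.1 h).resolve_left hpos'
    have hβ : Measurable fun ω => bridgePos (M.a y) s t x x' r (b ((r - s) / (t - s)) ω) := by
      have := hb.measurable _ (div_sub_mem_Icc hr)
      unfold bridgePos
      fun_prop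
    have h2 : Measurable fun ω => {z : Space d | ¬ c r z y ≤ D}.indicator (1 : Space d → ℝ≥0∞)
      (bridgePos (M.a y) s t x x' r (b ((r - s) / (t - s)) ω)) :=
      (measurable_one.indicator hbad).comp hβ
    rw [lintegral_eq_zero_iff h2] at h1
    filter_upwards [h1] with ω hω _
    rw [heval ω r hr]
    by_contra hcon
    simp [hcon] at hω
  set G : Ω × ℝ → ℝ≥0∞ := fun p => c p.2 (bridgePos (M.a y) s t x x' p.2
    (pathEval ((p.2 - s) / (t - s)) fun τ => b τ p.1)) y *
      EReal.exp (-((∫⁻ u in Ioo s p.2, c u (bridgePos (M.a y) s t x x' u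
        (pathEval ((u - s) / (t - s)) fun τ => b τ p.1)) y : ℝ≥0∞) : EReal)) with hG
  have hGm : Measurable G := by
    have hset : MeasurableSet {q : (Ω × ℝ) × ℝ | s < q.2 ∧ q.2 < q.1.2} :=
      (measurableSet_lt measurable_const measurable_snd).inter
        (measurableSet_lt measurable_snd (measurable_snd.comp measurable_fst))
    have h1 : Measurable fun q : (Ω × ℝ) × ℝ => c q.2 (bridgePos (M.a y) s t x x' q.2
        (pathEval ((q.2 - s) / (t - s)) fun τ => b τ q.1.1)) y :=
      hrate.comp (f := fun q : (Ω × ℝ) × ℝ => (q.1.1, q.2)) (by fun_prop)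
    have h2 := (h1.indicator hset).lintegral_prod_right' (ν := (volume : Measure ℝ))
    refine hrate.mul (EReal.measurable_exp.comp (Measurable.neg ?_))
    refine measurable_coe_ennreal_ereal.comp ?_
    convert h2 using 2 with p
    rw [← lintegral_indicator measurableSet_Ioo]
    rfl
  have hone : ∀ᵐ ω ∂P, pathFactor M c s t x y x' (fun τ => b τ ω) +
      ∫⁻ r in Ioo s t, G (ω, r) = 1 := by
    filter_upwards [hbd] with ω hω
    exact exp_neg_lintegral_add (hrate.comp measurable_prodMk_left) hst.le hω
  -- The collision density at `r` becomes a function of the position at `r` and the rescaled past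
  -- alone.
  have hGeq : ∀ r ∈ Ioo s t, ∀ ω, G (ω, r) =
      c r (bridgePos (M.a y) s t x x' r (b ((r - s) / (t - s)) ω)) y *
        pathFactor M c s r x y (bridgePos (M.a y) s t x x' r (b ((r - s) / (t - s)) ω))
          (fun τ => bridgeBefore b ((r - s) / (t - s)) τ ω) := by
    intro r hr ω
    simp only [hG]
    rw [heval ω r hr, pathFactor]
    congr 4
    refine setLIntegral_congr_fun measurableSet_Ioo fun u hu => ?_
    have hu' : u ∈ Ioo s t := ⟨hu.1, hu.2.trans hr.2⟩
    have hcont : ContinuousOn (fun τ => bridgeBefore b ((r - s) / (t - s)) τ ω) (Icc 0 1) := by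
      have h1 := hb.continuous ω
      have hρ := div_sub_mem_Icc hr
      have h2 : ContinuousOn (fun τ => b ((r - s) / (t - s) * τ) ω) (Icc 0 1) :=
        h1.comp (f := fun τ => (r - s) / (t - s) * τ) (by fun_prop)
          fun τ hτ => ⟨mul_nonneg hρ.1 hτ.1, mul_le_one₀ hρ.2 hτ.1 hτ.2⟩
      exact (h2.sub (continuousOn_id.smul continuousOn_const)).const_smul (√((r - s) / (t - s)))⁻¹
    rw [heval ω u hu', pathEval_eq hcont (div_sub_mem_Icc hu), bridgePos_eq b ha hr]
  have hmeas1 : Measurable fun ω => pathFactor M c s t x y x' (fun τ => b τ ω) :=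
    (measurable_pathFactor M hc).comp (f := fun ω =>
      ((s, t, x, y, x'), fun τ : Icc (0 : ℝ) 1 => b τ ω)) (measurable_const.prodMk hp)
  have htotal : ∫⁻ ω, pathFactor M c s t x y x' (fun τ => b τ ω) ∂P +
      ∫⁻ r in Ioo s t, ∫⁻ ω, G (ω, r) ∂P = 1 := by
    rw [← lintegral_lintegral_swap (f := fun ω r => G (ω, r)) hGm.aemeasurable,
      ← lintegral_add_left hmeas1, lintegral_congr_ae hone, lintegral_one, measure_univ]
  rw [hb.bridgeFactor_eq, ← mul_one (ENNReal.ofReal _)]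
  nth_rewrite 1 [← htotal]
  rw [mul_add, mul_one, ← lintegral_const_mul _ (hGm.lintegral_prod_left')]
  congr 1
  refine setLIntegral_congr_fun measurableSet_Ioo fun r hr => ?_
  have hΨ : Measurable fun p : Space d × (Icc (0 : ℝ) 1 → Space d) =>
      c r p.1 y * pathFactor M c s r x y p.1 p.2 :=
    (hc.comp (f := fun p : Space d × (Icc (0 : ℝ) 1 → Space d) => (r, p.1, y)) (by fun_prop)).mul
      ((measurable_pathFactor M hc).comp (f := fun p : Space d × (Icc (0 : ℝ) 1 → Space d) =>
        ((s, r, x, y, p.1), p.2)) (by fun_prop))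
  simp only [hGeq r hr]
  rw [hb.lintegral_bridgePos ha hr x x'
    (Ψ := fun p => c r p.1 y * pathFactor M c s r x y p.1 p.2) hΨ]
  refine lintegral_congr fun z => ?_
  simp only
  rw [lintegral_const_mul, hb.bridgeFactor_eq]
  · ring
  · exact (measurable_pathFactor M hc).comp (f := fun ω =>
      ((s, r, x, y, z), fun τ : Icc (0 : ℝ) 1 => b τ ω)) (measurable_const.prodMk hp)

end


/-! ### Markov solutions satisfy the mild equation -/

/-- Exchanges the birth time `s` of a particle with its later collision time `r`. -/
theorem lintegral_triangle {F : ℝ → ℝ → ℝ≥0∞} (hF : Measurable (Function.uncurry F)) (t : ℝ) :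
    ∫⁻ s in Ioo 0 t, ∫⁻ r in Ioo s t, F s r = ∫⁻ r in Ioo 0 t, ∫⁻ s in Ioo 0 r, F s r := by
  let S : Set (ℝ × ℝ) := {p | p.1 ∈ Ioo 0 t ∧ p.2 ∈ Ioo p.1 t}
  have hset : MeasurableSet S :=
    (measurable_fst measurableSet_Ioo).inter ((measurableSet_lt measurable_fst measurable_snd).inter
      (measurableSet_lt measurable_snd measurable_const))
  set G := S.indicator (Function.uncurry F) with hG
  have h1 : ∀ s, (Ioo 0 t).indicator (fun s => ∫⁻ r in Ioo s t, F s r) s = ∫⁻ r, G (s, r) := by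
    intro s
    by_cases hs : s ∈ Ioo 0 t
    · rw [indicator_of_mem hs, ← lintegral_indicator measurableSet_Ioo]
      refine lintegral_congr fun r => ?_
      by_cases hr : r ∈ Ioo s t
      · rw [indicator_of_mem hr, hG,
          indicator_of_mem (show (s, r) ∈ S from ⟨hs, hr⟩)]
        rfl
      · rw [indicator_of_notMem hr, hG, indicator_of_notMem fun h => hr h.2]
    · rw [indicator_of_notMem hs]
      refine (lintegral_eq_zero_of_ae_eq_zero (Filter.Eventually.of_forall fun r => ?_)).symm
      rw [hG, indicator_of_notMem fun h => hs h.1]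
      rfl
  have h2 : ∀ r, (Ioo 0 t).indicator (fun r => ∫⁻ s in Ioo 0 r, F s r) r = ∫⁻ s, G (s, r) := by
    intro r
    by_cases hr : r ∈ Ioo 0 t
    · rw [indicator_of_mem hr, ← lintegral_indicator measurableSet_Ioo]
      refine lintegral_congr fun s => ?_
      by_cases hs : s ∈ Ioo 0 r
      · rw [indicator_of_mem hs, hG,
          indicator_of_mem (show (s, r) ∈ S from ⟨⟨hs.1, hs.2.trans hr.2⟩, hs.2, hr.2⟩)]
        rfl
      · rw [indicator_of_notMem hs, hG, indicator_of_notMem fun h => hs ⟨h.1.1, h.2.1⟩]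
    · rw [indicator_of_notMem hr]
      refine (lintegral_eq_zero_of_ae_eq_zero (Filter.Eventually.of_forall fun s => ?_)).symm
      rw [hG, indicator_of_notMem fun h => hr ⟨h.1.1.trans h.2.1, h.2.2⟩]
      rfl
  rw [← lintegral_indicator measurableSet_Ioo, ← lintegral_indicator measurableSet_Ioo,
    lintegral_congr h1, lintegral_congr h2]
  exact lintegral_lintegral_swap (f := fun s r => G (s, r)) (hF.indicator hset).aemeasurable

section
variable {M : Model d E} {c : ℝ → Space d → E → ℝ≥0∞}
  {Ω : Type*} [MeasurableSpace Ω] {P : Measure Ω} {b : ℝ → Ω → Space d}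

theorem IsBrownianBridge.measurable_bridgeFactor_comp (hb : IsBrownianBridge b P)
    (hc : Measurable fun p : ℝ × Space d × E => c p.1 p.2.1 p.2.2) {α : Type*} [MeasurableSpace α]
    {s t : α → ℝ} {x x' : α → Space d} {y : α → E} (hs : Measurable s) (ht : Measurable t)
    (hx : Measurable x) (hy : Measurable y) (hx' : Measurable x') :
    Measurable fun q => bridgeFactor M b P c (s q) (t q) (x q) (y q) (x' q) :=
  (hb.measurable_bridgeFactor hc).comp (hs.prodMk (ht.prodMk (hx.prodMk (hy.prodMk hx'))))

theorem IsBrownianBridge.lintegral_propagator (hb : IsBrownianBridge b P)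
    (hc : Measurable fun p : ℝ × Space d × E => c p.1 p.2.1 p.2.2) (s t : ℝ)
    (ν : Measure (Space d × E)) [SFinite ν] {F : Space d × E → ℝ≥0∞} (hF : Measurable F) :
    ∫⁻ q, F q ∂(propagator M b P c s t ν) =
      ∫⁻ q, (∫⁻ x', ENNReal.ofReal (heatKernel (M.a q.2 * (t - s)) q.1 x') *
        bridgeFactor M b P c s t q.1 q.2 x' * F (x', q.2)) ∂ν := by
  have ha := M.measurable_a
  have h := hb.measurable_bridgeFactor_comp (M := M) hc
    (α := (Space d × E) × Space d) (s := fun _ => s) (t := fun _ => t) (x := fun q => q.1.1)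
    (y := fun q => q.1.2) (x' := fun q => q.2) (by fun_prop) (by fun_prop) (by fun_prop)
    (by fun_prop) (by fun_prop)
  exact lintegral_transport (Measurable.mul (by fun_prop) h) ν hF

/-- Joint measurability in `s` and `r` of the integrals with respect to `P^μ_{rs} ν_s`. -/
theorem IsBrownianBridge.measurable_lintegral_propagator (hb : IsBrownianBridge b P)
    (hc : Measurable fun p : ℝ × Space d × E => c p.1 p.2.1 p.2.2)
    (ν : Kernel ℝ (Space d × E)) [IsSFiniteKernel ν] {F : ℝ → Space d × E → ℝ≥0∞}
    (hF : Measurable (Function.uncurry F)) :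
    Measurable fun p : ℝ × ℝ => ∫⁻ q, F p.2 q ∂(propagator M b P c p.1 p.2 (ν p.1)) := by
  have ha := M.measurable_a
  have h1 := hb.measurable_bridgeFactor_comp (M := M) hc
    (α := ((ℝ × ℝ) × Space d × E) × Space d) (s := fun p => p.1.1.1) (t := fun p => p.1.1.2)
    (x := fun p => p.1.2.1) (y := fun p => p.1.2.2) (x' := fun p => p.2) (by fun_prop)
    (by fun_prop) (by fun_prop) (by fun_prop) (by fun_prop)
  have h2 : Measurable fun p : ((ℝ × ℝ) × Space d × E) × Space d => F p.1.1.2 (p.2, p.1.2.2) :=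
    hF.comp (f := fun p : ((ℝ × ℝ) × Space d × E) × Space d => (p.1.1.2, (p.2, p.1.2.2)))
      (by fun_prop)
  have e : (fun p : ℝ × ℝ => ∫⁻ q, F p.2 q ∂(propagator M b P c p.1 p.2 (ν p.1))) =
      fun p => ∫⁻ q, (∫⁻ x', ENNReal.ofReal (heatKernel (M.a q.2 * (p.2 - p.1)) q.1 x') *
        bridgeFactor M b P c p.1 p.2 q.1 q.2 x' * F p.2 (x', q.2))
          ∂(ν.comap (Prod.fst : ℝ × ℝ → ℝ) (measurable_fst : Measurable Prod.fst) p) := by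
    ext p
    exact hb.lintegral_propagator hc _ _ _ (hF.comp measurable_prodMk_left)
  rw [e]
  refine Measurable.lintegral_kernel_prod_right' (f := fun p : (ℝ × ℝ) × Space d × E =>
    ∫⁻ x', ENNReal.ofReal (heatKernel (M.a p.2.2 * (p.1.2 - p.1.1)) p.2.1 x') *
        bridgeFactor M b P c p.1.1 p.1.2 p.2.1 p.2.2 x' * F p.1.2 (x', p.2.2)) ?_
  refine Measurable.lintegral_prod_right' (f := fun p : ((ℝ × ℝ) × Space d × E) × Space d =>
    ENNReal.ofReal (heatKernel (M.a p.1.2.2 * (p.1.1.2 - p.1.1.1)) p.1.2.1 p.2) *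
      bridgeFactor M b P c p.1.1.1 p.1.1.2 p.1.2.1 p.1.2.2 p.2 * F p.1.1.2 (p.2, p.1.2.2)) ?_
  exact Measurable.mul (Measurable.mul (by fun_prop) h1) h2

/-- `P_{t-r} (c_r ν)(C)` is the integral of this function with respect to `ν`. -/
noncomputable def lossHeat (M : Model d E) (c : ℝ → Space d → E → ℝ≥0∞) (t : ℝ)
    (C : Set (Space d × E)) (r : ℝ) (q : Space d × E) : ℝ≥0∞ :=
  c r q.1 q.2 * ∫⁻ x', ENNReal.ofReal (heatKernel (M.a q.2 * (t - r)) q.1 x') *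
    C.indicator 1 (x', q.2)

theorem measurable_lossHeat (M : Model d E)
    (hc : Measurable fun p : ℝ × Space d × E => c p.1 p.2.1 p.2.2) (t : ℝ) {C : Set (Space d × E)}
    (hC : MeasurableSet C) : Measurable (Function.uncurry (lossHeat M c t C)) := by
  have ha := M.measurable_a
  have hind : Measurable (C.indicator (1 : Space d × E → ℝ≥0∞)) := measurable_one.indicator hC
  have h1 := hind.comp (f := fun p : (ℝ × Space d × E) × Space d => (p.2, p.1.2.2)) (by fun_prop)
  have h2 : Measurable fun p : ℝ × Space d × E => ∫⁻ x',
      ENNReal.ofReal (heatKernel (M.a p.2.2 * (t - p.1)) p.2.1 x') *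
        C.indicator 1 (x', p.2.2) :=
    Measurable.lintegral_prod_right' (f := fun p : (ℝ × Space d × E) × Space d =>
      ENNReal.ofReal (heatKernel (M.a p.1.2.2 * (t - p.1.1)) p.1.2.1 p.2) *
        C.indicator 1 (p.2, p.1.2.2)) (Measurable.mul (by fun_prop) h1)
  exact hc.mul h2

/-- The weight of the Brownian paths from `q` that first collide at `z` at time `r`, and continue
from there to `x'` at time `t`. -/
noncomputable def collisionWeight (M : Model d E) (b : ℝ → Ω → Space d) (P : Measure Ω)
    (c : ℝ → Space d → E → ℝ≥0∞) (s t : ℝ) (q : Space d × E) (r : ℝ) (z x' : Space d) : ℝ≥0∞ :=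
  ENNReal.ofReal (heatKernel (M.a q.2 * (r - s)) q.1 z) * bridgeFactor M b P c s r q.1 q.2 z *
    c r z q.2 * ENNReal.ofReal (heatKernel (M.a q.2 * (t - r)) z x')

theorem IsBrownianBridge.measurable_collisionWeight (hb : IsBrownianBridge b P)
    (hc : Measurable fun p : ℝ × Space d × E => c p.1 p.2.1 p.2.2) (s t : ℝ) (q : Space d × E) :
    Measurable fun p : (Space d × ℝ) × Space d =>
      collisionWeight M b P c s t q p.1.2 p.2 p.1.1 := by
  have h1 := hb.measurable_bridgeFactor_comp (M := M) hc
    (α := (Space d × ℝ) × Space d) (s := fun _ => s) (t := fun p => p.1.2)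
    (x := fun _ => q.1) (y := fun _ => q.2) (x' := fun p => p.2) (by fun_prop)
    (by fun_prop) (by fun_prop) (by fun_prop) (by fun_prop)
  have h2 : Measurable fun p : (Space d × ℝ) × Space d => c p.1.2 p.2 q.2 :=
    hc.comp (f := fun p : (Space d × ℝ) × Space d => (p.1.2, p.2, q.2)) (by fun_prop)
  exact Measurable.mul (Measurable.mul (Measurable.mul (by fun_prop) h1) h2) (by fun_prop)

theorem IsBrownianBridge.lintegral_collisionWeight (hb : IsBrownianBridge b P)
    (hc : Measurable fun p : ℝ × Space d × E => c p.1 p.2.1 p.2.2) (s t : ℝ) (q : Space d × E)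
    {C : Set (Space d × E)} (hC : MeasurableSet C) :
    ∫⁻ x', (∫⁻ r in Ioo s t, ∫⁻ z, collisionWeight M b P c s t q r z x') *
        C.indicator 1 (x', q.2) =
      ∫⁻ r in Ioo s t, ∫⁻ z, ENNReal.ofReal (heatKernel (M.a q.2 * (r - s)) q.1 z) *
        bridgeFactor M b P c s r q.1 q.2 z * lossHeat M c t C r (z, q.2) := by
  have hA := hb.measurable_collisionWeight (M := M) hc s t q
  have hind : Measurable fun x' : Space d => C.indicator (1 : Space d × E → ℝ≥0∞) (x', q.2) :=
    (measurable_one.indicator hC).comp (f := fun x' : Space d => (x', q.2)) (by fun_prop)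
  have hAq : Measurable fun p : (Space d × ℝ) × Space d =>
      collisionWeight M b P c s t q p.1.2 p.2 p.1.1 * C.indicator 1 (p.1.1, q.2) :=
    hA.mul (hind.comp (f := fun p : (Space d × ℝ) × Space d => p.1.1) (by fun_prop))
  have e2 : ∀ x', (∫⁻ r in Ioo s t, ∫⁻ z, collisionWeight M b P c s t q r z x') *
        C.indicator 1 (x', q.2) =
      ∫⁻ r in Ioo s t, ∫⁻ z, collisionWeight M b P c s t q r z x' * C.indicator 1 (x', q.2) := by
    intro x'
    have m1 : Measurable fun p : ℝ × Space d => collisionWeight M b P c s t q p.1 p.2 x' :=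
      hA.comp (f := fun p : ℝ × Space d => ((x', p.1), p.2)) (by fun_prop)
    rw [← lintegral_mul_const _ m1.lintegral_prod_right']
    refine lintegral_congr fun r => ?_
    have m2 : Measurable fun z => collisionWeight M b P c s t q r z x' :=
      hA.comp (f := fun z : Space d => ((x', r), z)) (by fun_prop)
    exact (lintegral_mul_const _ m2).symm
  simp_rw [e2]
  rw [lintegral_lintegral_swap
    (f := fun x' r => ∫⁻ z, collisionWeight M b P c s t q r z x' * C.indicator 1 (x', q.2))
    hAq.lintegral_prod_right'.aemeasurable]
  refine lintegral_congr fun r => ?_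
  have m3 : Measurable fun p : Space d × Space d =>
      collisionWeight M b P c s t q r p.2 p.1 * C.indicator 1 (p.1, q.2) :=
    hAq.comp (f := fun p : Space d × Space d => ((p.1, r), p.2)) (by fun_prop)
  rw [lintegral_lintegral_swap
    (f := fun x' z => collisionWeight M b P c s t q r z x' * C.indicator 1 (x', q.2))
    m3.aemeasurable]
  refine lintegral_congr fun z => ?_
  simp only [lossHeat, collisionWeight]
  have m4 : Measurable fun x' : Space d =>
      ENNReal.ofReal (heatKernel (M.a q.2 * (t - r)) z x') * C.indicator 1 (x', q.2) :=
    Measurable.mul (by fun_prop) hind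
  rw [← mul_assoc, ← lintegral_const_mul _ m4]
  exact lintegral_congr fun x' => by simp only [mul_assoc]

/-- The heat flow decomposed at the first collision. -/
theorem IsBrownianBridge.heatFlow_apply (hb : IsBrownianBridge b P)
    (hc : Measurable fun p : ℝ × Space d × E => c p.1 p.2.1 p.2.2) {s t : ℝ} (hst : s < t)
    (hD : ∀ y, ∃ D : ℝ≥0, ∀ r ∈ Ioo s t, ∀ᵐ z ∂(volume : Measure (Space d)), c r z y ≤ D)
    (ν : Measure (Space d × E)) [SFinite ν] {C : Set (Space d × E)} (hC : MeasurableSet C) :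
    heatFlow M (t - s) ν C = propagator M b P c s t ν C +
      ∫⁻ r in Ioo s t, ∫⁻ q, lossHeat M c t C r q ∂(propagator M b P c s r ν) := by
  have ha := M.measurable_a
  have hind : Measurable (C.indicator (1 : Space d × E → ℝ≥0∞)) := measurable_one.indicator hC
  have hm1 : Measurable fun p : (Space d × E) × Space d =>
      ENNReal.ofReal (heatKernel (M.a p.1.2 * (t - s)) p.1.1 p.2) *
          bridgeFactor M b P c s t p.1.1 p.1.2 p.2 * C.indicator 1 (p.2, p.1.2) := by
    have h1 := hb.measurable_bridgeFactor_comp (M := M) hc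
      (α := (Space d × E) × Space d) (s := fun _ => s) (t := fun _ => t) (x := fun q => q.1.1)
      (y := fun q => q.1.2) (x' := fun q => q.2) (by fun_prop) (by fun_prop) (by fun_prop)
      (by fun_prop) (by fun_prop)
    have h2 := hind.comp (f := fun p : (Space d × E) × Space d => (p.2, p.1.2)) (by fun_prop)
    exact Measurable.mul (Measurable.mul (by fun_prop) h1) h2
  have e1 : ∀ q : Space d × E,
      ∫⁻ x', ENNReal.ofReal (heatKernel (M.a q.2 * (t - s)) q.1 x') * C.indicator 1 (x', q.2) =
      (∫⁻ x', ENNReal.ofReal (heatKernel (M.a q.2 * (t - s)) q.1 x') *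
        bridgeFactor M b P c s t q.1 q.2 x' * C.indicator 1 (x', q.2)) +
      ∫⁻ r in Ioo s t, ∫⁻ z, ENNReal.ofReal (heatKernel (M.a q.2 * (r - s)) q.1 z) *
        bridgeFactor M b P c s r q.1 q.2 z * lossHeat M c t C r (z, q.2) := by
    intro q
    -- The type is constant along a path, so a bound on the rate depending on `y` is enough.
    obtain ⟨D, hD⟩ := hD q.2
    have hm1q : Measurable fun x' => ENNReal.ofReal (heatKernel (M.a q.2 * (t - s)) q.1 x') *
        bridgeFactor M b P c s t q.1 q.2 x' * C.indicator 1 (x', q.2) :=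
      hm1.comp (f := fun x' : Space d => (q, x')) (by fun_prop)
    rw [← hb.lintegral_collisionWeight hc s t q hC, ← lintegral_add_left hm1q]
    refine lintegral_congr fun x' => ?_
    rw [← add_mul]
    exact congrArg (· * _) (hb.heatKernel_eq hc hst q.1 q.2 x' hD)
  have hL := measurable_lossHeat M hc t hC
  have hm2 : Measurable fun p : ((Space d × E) × ℝ) × Space d =>
      ENNReal.ofReal (heatKernel (M.a p.1.1.2 * (p.1.2 - s)) p.1.1.1 p.2) *
        bridgeFactor M b P c s p.1.2 p.1.1.1 p.1.1.2 p.2 * lossHeat M c t C p.1.2 (p.2, p.1.1.2) := by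
    have h1 := hb.measurable_bridgeFactor_comp (M := M) hc
      (α := ((Space d × E) × ℝ) × Space d) (s := fun _ => s) (t := fun p => p.1.2)
      (x := fun p => p.1.1.1) (y := fun p => p.1.1.2) (x' := fun p => p.2) (by fun_prop)
      (by fun_prop) (by fun_prop) (by fun_prop) (by fun_prop)
    have h2 := hL.comp (f := fun p : ((Space d × E) × ℝ) × Space d => (p.1.2, (p.2, p.1.1.2)))
      (by fun_prop)
    exact Measurable.mul (Measurable.mul (by fun_prop) h1) h2
  have hm1i : Measurable fun q : Space d × E =>
      ∫⁻ x', ENNReal.ofReal (heatKernel (M.a q.2 * (t - s)) q.1 x') *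
        bridgeFactor M b P c s t q.1 q.2 x' * C.indicator 1 (x', q.2) :=
    hm1.lintegral_prod_right'
  have f1 : heatFlow M (t - s) ν C = ∫⁻ q, (∫⁻ x',
      ENNReal.ofReal (heatKernel (M.a q.2 * (t - s)) q.1 x') * C.indicator 1 (x', q.2)) ∂ν := by
    rw [← lintegral_indicator_one hC]
    exact lintegral_heatFlow M _ _ hind
  have f2 : propagator M b P c s t ν C = ∫⁻ q, (∫⁻ x',
      ENNReal.ofReal (heatKernel (M.a q.2 * (t - s)) q.1 x') *
        bridgeFactor M b P c s t q.1 q.2 x' * C.indicator 1 (x', q.2)) ∂ν := by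
    rw [← lintegral_indicator_one hC]
    exact hb.lintegral_propagator hc _ _ _ hind
  have f3 : (∫⁻ r in Ioo s t, ∫⁻ q, lossHeat M c t C r q ∂(propagator M b P c s r ν)) =
      ∫⁻ q, (∫⁻ r in Ioo s t, ∫⁻ z, ENNReal.ofReal (heatKernel (M.a q.2 * (r - s)) q.1 z) *
        bridgeFactor M b P c s r q.1 q.2 z * lossHeat M c t C r (z, q.2)) ∂ν := by
    have f4 := lintegral_lintegral_swap (μ := ν) (ν := volume.restrict (Ioo s t))
      (f := fun q r => ∫⁻ z, ENNReal.ofReal (heatKernel (M.a q.2 * (r - s)) q.1 z) *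
        bridgeFactor M b P c s r q.1 q.2 z * lossHeat M c t C r (z, q.2))
      hm2.lintegral_prod_right'.aemeasurable
    rw [f4]
    refine lintegral_congr fun r => ?_
    have hLr : Measurable (lossHeat M c t C r) := hL.comp (f := fun q => (r, q)) (by fun_prop)
    exact hb.lintegral_propagator hc _ _ _ hLr
  rw [f1, f2, f3, lintegral_congr e1]
  exact lintegral_add_left hm1i _

end

/-! ### From the Markov equation to the mild equation. -/

section
variable {M : Model d E} {T : ℝ≥0∞} {μ : ℝ → Measure (Space d × E)}

/-- A version of the densities that vanishes off `[0, T)`. -/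
theorem IsDensityProcess.exists_finite {κ : Kernel (ℝ × Space d) E} (hκ : IsDensityProcess T κ μ) :
    ∃ κ' : Kernel (ℝ × Space d) E, IsDensityProcess T κ' μ ∧ IsSFiniteKernel κ' ∧
      ∀ t, Before T t → ∀ x, κ' (t, x) = κ (t, x) := by
  classical
  have hs : MeasurableSet {p : ℝ × Space d | Before T p.1} :=
    measurable_fst (measurableSet_before T)
  have h1 : ∀ t, Before T t → ∀ x, Kernel.piecewise hs κ 0 (t, x) = κ (t, x) := fun t ht x => by
    rw [Kernel.piecewise_apply, if_pos (show (t, x) ∈ {p : ℝ × Space d | Before T p.1} from ht)]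
  refine ⟨Kernel.piecewise hs κ 0, fun t ht => ?_, isSFiniteKernel_of_finite _ fun p => ?_, h1⟩
  · have : (Kernel.piecewise hs κ 0).comap (Prod.mk t) measurable_prodMk_left =
        κ.comap (Prod.mk t) measurable_prodMk_left := by
      ext1 x
      exact h1 t ht x
    rw [this]
    exact hκ t ht
  · rw [Kernel.piecewise_apply]
    split_ifs with hp
    · exact (hκ p.1 hp).1 p.2
    · simp

theorem propagator_congr {Ω : Type*} [MeasurableSpace Ω] (P : Measure Ω) (b : ℝ → Ω → Space d)
    {c c' : ℝ → Space d → E → ℝ≥0∞} {s t : ℝ} (h : ∀ r ∈ Ioo s t, c r = c' r)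
    (ν : Measure (Space d × E)) : propagator M b P c s t ν = propagator M b P c' s t ν := by
  have : bridgeFactor M b P c s t = bridgeFactor M b P c' s t := by
    ext x y x'
    refine lintegral_congr fun ω => ?_
    congr 3
    exact setLIntegral_congr_fun measurableSet_Ioo fun r hr => by simp only [h r hr]
  rw [propagator, this, propagator]

/-- Both sides of (E) expand into the same four nonnegative terms: paths from `μ_0` or from a gain
at time `s`, either without collision up to `t` or continued freely after a first collision at `r`.
Nothing is subtracted, so no finiteness is needed at this point. -/
theorem IsMarkovSolution.mildEquation [StandardBorelSpace E]
    (h : IsMarkovSolution M T μ) (hμ : IsProcess T μ) :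
    MildEquation M T μ := by
  obtain ⟨hMCD, Ω, _, P, b, κ₀, hb, hκ₀, heq₀⟩ := h
  -- The given kernel is unconstrained off `[0, T)`; the replacement is s-finite, which makes the
  -- loss rate jointly measurable, and the propagators before `T` are unchanged.
  obtain ⟨κ, hκ, hκs, hκeq⟩ := hκ₀.exists_finite
  obtain ⟨k⟩ := hμ.nonempty_processKernels hMCD
  have := k.isSFiniteKernel_gain
  set c := lossRate M κ with hcdef
  have hc : Measurable fun p : ℝ × Space d × E => c p.1 p.2.1 p.2.2 :=
    (measurable_lintegral_K_univ M κ).comp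
      (f := fun p : ℝ × Space d × E => ((p.1, p.2.1), p.2.2)) (by fun_prop)
  have hcc : ∀ {s t}, 0 ≤ s → Before T t → ∀ r ∈ Ioo s t, lossRate M κ₀ r = c r := by
    intro s t hs ht r hr
    ext x y
    simp only [hcdef, lossRate, hκeq r (ht.mono (hs.trans hr.1.le) hr.2.le)]
  -- the Markov equation in terms of the measurable kernels
  have hmarkov : ∀ t, 0 < t → Before T t → ∀ C, MeasurableSet C →
      μ t C = propagator M b P c 0 t (μ 0) C +
        ∫⁻ s in Ioo 0 t, propagator M b P c s t (k.gain s) C := by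
    intro t ht0 ht C hC
    rw [heq₀ t ht0 ht C hC, propagator_congr P b (hcc le_rfl ht)]
    congr 1
    refine setLIntegral_congr_fun measurableSet_Ioo fun s hs => ?_
    rw [propagator_congr P b (hcc hs.1.le ht), k.gain_eq s (ht.mono hs.1.le hs.2.le)]
  have hprop : ∀ t, Measurable fun s => propagator M b P c s t (k.gain s) := by
    intro t
    refine Measure.measurable_of_measurable_coe _ fun C hC => ?_
    have h1 := hb.measurable_lintegral_propagator (M := M) hc k.gain
      (F := fun _ => C.indicator 1) ((measurable_one.indicator hC).comp measurable_snd)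
    have h2 := h1.comp (f := fun s : ℝ => (s, t)) (by fun_prop)
    convert h2 using 2 with s
    exact (lintegral_indicator_one hC).symm
  have hlint : ∀ t, 0 < t → Before T t → ∀ F : Space d × E → ℝ≥0∞, Measurable F →
      ∫⁻ q, F q ∂(μ t) = ∫⁻ q, F q ∂(propagator M b P c 0 t (μ 0)) +
        ∫⁻ s in Ioo 0 t, ∫⁻ q, F q ∂(propagator M b P c s t (k.gain s)) := by
    intro t ht0 ht F hF
    have e : μ t = propagator M b P c 0 t (μ 0) + (volume.restrict (Ioo 0 t)).bind
        fun s => propagator M b P c s t (k.gain s) := by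
      ext C hC
      rw [Measure.add_apply, Measure.bind_apply hC (hprop t).aemeasurable, hmarkov t ht0 ht C hC]
    rw [e, lintegral_add_measure, Measure.lintegral_bind (hprop t).aemeasurable hF.aemeasurable]
  intro t ht0 ht C hC
  obtain ⟨B, hB⟩ := hMCD.exists_momentLE hμ ht
  -- The constant is `w(y)` times the `L^∞` bound of `⟨w, μ_r⟩`.
  have hD : ∀ s, 0 ≤ s → ∀ y, ∃ D : ℝ≥0, ∀ r ∈ Ioo s t,
      ∀ᵐ z ∂(volume : Measure (Space d)), c r z y ≤ D := by
    intro s hs y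
    refine ⟨(M.w y).toNNReal * B, fun r hr => ?_⟩
    have hr' := ht.mono (hs.trans hr.1.le) hr.2.le
    filter_upwards [(hB r ⟨hs.trans hr.1.le, hr.2.le⟩).linfty _ (hκ r hr')] with z hz
    refine (lintegral_K_univ_le M _ y).trans ?_
    rw [ENNReal.coe_mul]
    exact mul_le_mul' le_rfl hz
  have hL := measurable_lossHeat M hc t hC
  have hfin : IsFiniteMeasure (μ 0) := (hμ.1 0 (ht.mono le_rfl ht.1)).1
  have hloss : ∀ r ∈ Ioo 0 t, heatFlow M (t - r) (Kminus M (μ r)) C =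
      ∫⁻ q, lossHeat M c t C r q ∂(μ r) := by
    intro r hr
    have hr' := ht.mono hr.1.le hr.2.le
    have hMr := hμ.1 r hr'
    have := hMr.1
    have hind : Measurable (C.indicator (1 : Space d × E → ℝ≥0∞)) := measurable_one.indicator hC
    have ha := M.measurable_a
    have hcr : Measurable fun q : Space d × E => c r q.1 q.2 := hc.comp measurable_prodMk_left
    have hK : Kminus M (μ r) = (μ r).withDensity fun q => c r q.1 q.2 := by
      rw [Kminus_eq_withDensity M hMr (hκ r hr')]
      simp only [hcdef, lossRate, Kernel.comap_apply]
    rw [← lintegral_indicator_one hC, hK, lintegral_heatFlow M _ _ hind,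
      lintegral_withDensity_eq_lintegral_mul _ hcr]
    · rfl
    · have h1 := hind.comp (f := fun p : (Space d × E) × Space d => (p.2, p.1.2)) (by fun_prop)
      exact Measurable.lintegral_prod_right' (f := fun p : (Space d × E) × Space d =>
        ENNReal.ofReal (heatKernel (M.a p.1.2 * (t - r)) p.1.1 p.2) *
          C.indicator 1 (p.2, p.1.2)) (Measurable.mul (by fun_prop) h1)
  have hF := hb.measurable_lintegral_propagator (M := M) hc k.gain hL
  have hpC : Measurable fun s => propagator M b P c s t (k.gain s) C :=
    (Measure.measurable_coe hC).comp (hprop t)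
  have hgain : ∫⁻ s in Ioo 0 t, heatFlow M (t - s) (Kplus M (μ s)) C =
      (∫⁻ s in Ioo 0 t, propagator M b P c s t (k.gain s) C) + ∫⁻ r in Ioo 0 t, ∫⁻ s in Ioo 0 r,
        ∫⁻ q, lossHeat M c t C r q ∂(propagator M b P c s r (k.gain s)) := by
    rw [← lintegral_triangle (F := fun s r =>
      ∫⁻ q, lossHeat M c t C r q ∂(propagator M b P c s r (k.gain s))) hF,
      ← lintegral_add_left hpC]
    refine setLIntegral_congr_fun measurableSet_Ioo fun s hs => ?_
    beta_reduce
    rw [← k.gain_eq s (ht.mono hs.1.le hs.2.le), hb.heatFlow_apply hc hs.2 (hD s hs.1.le) _ hC]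
  have h0 := hb.heatFlow_apply (M := M) hc ht0 (hD 0 le_rfl) (μ 0) hC
  rw [sub_zero] at h0
  -- The loss at time `r` is `c_r μ_r`, and `μ_r` is expanded by the Markov equation at `r`.
  have hsum : ∫⁻ r in Ioo 0 t, heatFlow M (t - r) (Kminus M (μ r)) C =
      (∫⁻ r in Ioo 0 t, ∫⁻ q, lossHeat M c t C r q ∂(propagator M b P c 0 r (μ 0))) +
        ∫⁻ r in Ioo 0 t, ∫⁻ s in Ioo 0 r,
          ∫⁻ q, lossHeat M c t C r q ∂(propagator M b P c s r (k.gain s)) := by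
    have hm0 : Measurable fun r => ∫⁻ q, lossHeat M c t C r q ∂(propagator M b P c 0 r (μ 0)) :=
      (hb.measurable_lintegral_propagator (M := M) hc (Kernel.const ℝ (μ 0)) hL).comp
      (f := fun r : ℝ => ((0 : ℝ), r)) (by fun_prop)
    rw [← lintegral_add_left hm0]
    refine setLIntegral_congr_fun measurableSet_Ioo fun r hr => ?_
    beta_reduce
    have hLr : Measurable (lossHeat M c t C r) := hL.comp (f := fun q => (r, q)) (by fun_prop)
    rw [hloss r hr, hlint r hr.1 (ht.mono hr.1.le hr.2.le) _ hLr]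
  rw [hgain, h0, hsum, hmarkov t ht0 ht C hC]
  abel

end

end CoagDiff

/-! ### Assembly of the implications. -/

theorem mainTheorem4 {d : ℕ} {E : Type*} [MeasurableSpace E] [StandardBorelSpace E]
    (M : CoagDiff.Model d E) (T : ℝ≥0∞) (hT : 0 < T)
    (μ : ℝ → Measure (EuclideanSpace ℝ (Fin d) × E))
    (hμ : CoagDiff.IsProcess T μ) (hMCD : CoagDiff.MomentBound M T μ) :
    (CoagDiff.IsSolution M T μ ↔
      CoagDiff.IsWeakSolution M T μ ∧ CoagDiff.InitialBound M (μ 0)) ∧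
    (CoagDiff.IsMarkovSolution M T μ → CoagDiff.InitialBound M (μ 0) →
      CoagDiff.IsSolution M T μ) ∧
    (CoagDiff.IsWeakSolution M T μ ↔
      CoagDiff.MildEquation M T μ ∧ CoagDiff.GainBound M T μ) ∧
    (CoagDiff.IsMarkovSolution M T μ →
      CoagDiff.MildEquation M T μ ∧ CoagDiff.GainBound M T μ) := by
  have hweak : CoagDiff.IsWeakSolution M T μ ↔
      CoagDiff.MildEquation M T μ ∧ CoagDiff.GainBound M T μ :=
    ⟨fun h => ⟨h.mildEquation hμ, (h.mildEquation hμ).gainBound hμ hMCD⟩,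
      fun h => h.1.isWeakSolution hμ hMCD⟩
  have hmarkov : CoagDiff.IsMarkovSolution M T μ →
      CoagDiff.MildEquation M T μ ∧ CoagDiff.GainBound M T μ :=
    fun h => ⟨h.mildEquation hμ, (h.mildEquation hμ).gainBound hμ hMCD⟩
  refine ⟨⟨fun h => ⟨hweak.2 ⟨h.1, h.2.2⟩, h.2.1⟩, fun h => ?_⟩, fun h hI => ?_, hweak, hmarkov⟩
  · exact ⟨(hweak.1 h.1).1, h.2, (hweak.1 h.1).2⟩
  · exact ⟨(hmarkov h).1, hI, (hmarkov h).2⟩
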